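/- Let $M$ be a smooth Riemannian manifold of dimension $n\ge 1$ (Hausdorff, without boundary; completeness is not needed) with Levi-Civita connection $\nabla$ and curvature tensor $R(Y,Z)W=\nabla_Y\nabla_Z W-\nabla_Z\nabla_Y W-\nabla_{[Y,Z]}W$. Let $L>0$ and let $\gamma:[0,L]\to M$ be a $C^2$ curve parameterized by arc length, $T=\gamma'$. A *Bishop frame* along a $C^2$ arc-length curve $c:[0,L]\to M$ is a $C^1$ orthonormal frame $T=c',N_2,\dots,N_n$ along $c$ such that each $\nabla_T N_i$ is a multiple of $T$; its *geodesic curvature functions* $\kappa_2,\dots,\kappa_n:[0,L]\to\mathbb R$ are defined by $\nabla_T T=\sum_{i=2}^n\kappa_i N_i$. A *rigid variation* of $\gamma$ is a family of $C^2$ arc-length curves $\gamma_\tau:[0,L]\to M$, $|\tau|<\epsilon$ (for some $\epsilon>0$), with $\gamma_0=\gamma$, together with a Bishop frame $T_\tau=\gamma_\tau',(N_2)_\tau,\dots,(N_n)_\tau$ along each $\gamma_\tau$, such that the geodesic curvature functions $\kappa_i$ of $\gamma_\tau$ do not depend on $\tau$, and such that the curve $\tau\mapsto\gamma_\tau(0)$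 and the frame $T_\tau(0),(N_2)_\tau(0),\dots,(N_n)_\tau(0)$ along it are $C^1$ in $\tau$. Its *variation field* is the vector field $X(t)=\frac{\partial}{\partial\tau}\big|_{\tau=0}\gamma_\tau(t)$ along $\gamma$, and the *transverse derivative of its frame* is the $(1,1)$ tensor $A$ along $\gamma$ with $$A(t)T_0(t)=\nabla_{\partial/\partial\tau}T_\tau(t)\big|_{\tau=0},\qquad A(t)(N_i)_0(t)=\nabla_{\partial/\partial\tau}(N_i)_\tau(t)\big|_{\tau=0}\quad(2\le i\le n),$$ the covariant derivatives being taken along the curve $\tau\mapsto\gamma_\tau(t)$. (1) For every rigid variation of $\gamma$, the variation field $X$ and the transverse derivative $A$ of the frame exist along $\gamma$, $A$ is skew-symmetric, and $X$, $A$ are differentiable along $\gamma$ and satisfy the generalized Jacobi equations on $[0,L]$: $$\nabla_T X=AT\qquad\text{and}\qquad\nabla_T A=R(T,X).$$ (2) Conversely, if $X$ is a vector field and $A$ a skew-symmetric $(1,1)$ tensor along $\gamma$, both differentiable, which satisfy the generalized Jacobi equations on $[0,L]$, then there is a rigid variation of $\gamma$ with variation field $X$ and with transverse derivative of the frame $A$.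 -/

import Mathlib

open scoped Manifold ContDiff Topology
open Bundle

noncomputable section

section LeviCivita

variable {E : Type*} [NormedAddCommGroup E] [NormedSpace ℝ E]
  {M : Type*} [TopologicalSpace M] [ChartedSpace E M] [IsManifold 𝓘(ℝ, E) ∞ M]

/-- The coordinates of tangent vectors at `y` in the preferred chart at `x` (zero if `y` is
outside the domain of that chart). -/
def chartCoord (x y : M) : TangentSpace 𝓘(ℝ, E) y →L[ℝ] E :=
  (trivializationAt E (TangentSpace 𝓘(ℝ, E)) x).continuousLinearMapAt ℝ y

/-- The tangent vectors at `y` with given coordinates in the preferred chart at `x` (zero if `y`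
is outside the domain of that chart). -/
def chartVector (x y : M) : E →L[ℝ] TangentSpace 𝓘(ℝ, E) y :=
  (trivializationAt E (TangentSpace 𝓘(ℝ, E)) x).symmL ℝ y

/-- The vector field with value `v` at `x` whose coordinates in the preferred chart at `x` are
constant (extended by zero outside the domain of that chart). -/
def constField {x : M} (v : TangentSpace 𝓘(ℝ, E) x) (y : M) : TangentSpace 𝓘(ℝ, E) y :=
  chartVector x y (chartCoord x x v)

lemma chartVector_chartCoord_self (x : M) (v : TangentSpace 𝓘(ℝ, E) x) :
    chartVector x x (chartCoord x x v) = v :=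
  Trivialization.symmL_continuousLinearMapAt _ (mem_baseSet_trivializationAt E _ x) v

lemma constField_self {x : M} (v : TangentSpace 𝓘(ℝ, E) x) : constField v x = v :=
  chartVector_chartCoord_self x v

lemma constField_add {x : M} (v w : TangentSpace 𝓘(ℝ, E) x) (y : M) :
    constField (v + w) y = constField v y + constField w y := by
  simp only [constField, map_add]

lemma constField_smul {x : M} (a : ℝ) (v : TangentSpace 𝓘(ℝ, E) x) (y : M) :
    constField (a • v) y = a • constField v y := by
  simp only [constField, map_smul]

lemma mdifferentiableAt_chartCoord {σ : ∀ y : M, TangentSpace 𝓘(ℝ, E) y} {x : M}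
    (h : MDiffAt (T% σ) x) :
    MDifferentiableAt 𝓘(ℝ, E) 𝓘(ℝ, E) (fun y : M => chartCoord x y (σ y)) x := by
  refine ((mdifferentiableAt_section 𝓘(ℝ, E) σ).1 h).congr_of_eventuallyEq ?_
  filter_upwards [(trivializationAt E (TangentSpace 𝓘(ℝ, E)) x).open_baseSet.mem_nhds
    (mem_baseSet_trivializationAt E _ x)] with y hy
  exact Trivialization.continuousLinearMapAt_apply_of_mem ℝ _ hy _

lemma chartCoord_constField_eventuallyEq {x : M} (v : TangentSpace 𝓘(ℝ, E) x) :
    (fun y => chartCoord x y (constField v y)) =ᶠ[𝓝 x] fun _ => chartCoord x x v := by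
  filter_upwards [(trivializationAt E (TangentSpace 𝓘(ℝ, E)) x).open_baseSet.mem_nhds
    (mem_baseSet_trivializationAt E _ x)] with y hy
  exact Trivialization.continuousLinearMapAt_symmL _ hy _

lemma mdifferentiableAt_constField {x : M} (v : TangentSpace 𝓘(ℝ, E) x) :
    MDiffAt (T% (constField v)) x := by
  rw [mdifferentiableAt_section]
  refine (mdifferentiableAt_const (c := chartCoord x x v)).congr_of_eventuallyEq ?_
  filter_upwards [(trivializationAt E (TangentSpace 𝓘(ℝ, E)) x).open_baseSet.mem_nhds
    (mem_baseSet_trivializationAt E _ x), chartCoord_constField_eventuallyEq v] with y hy h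
  rw [← h]
  exact (Trivialization.continuousLinearMapAt_apply_of_mem ℝ _ hy _).symm

lemma mlieBracket_constField {x : M} (u v : TangentSpace 𝓘(ℝ, E) x) :
    VectorField.mlieBracket 𝓘(ℝ, E) (constField u) (constField v) x = 0 := by
  have h : ∀ u : TangentSpace 𝓘(ℝ, E) x, VectorField.mpullbackWithin 𝓘(ℝ, E) 𝓘(ℝ, E)
      (extChartAt 𝓘(ℝ, E) x).symm (constField u) (Set.range 𝓘(ℝ, E))
      =ᶠ[𝓝 (extChartAt 𝓘(ℝ, E) x x)] fun _ => chartCoord x x u := by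
    intro u
    filter_upwards [(isOpen_extChartAt_target x).mem_nhds (mem_extChartAt_target x)] with z hz
    have hz' := (extChartAt 𝓘(ℝ, E) x).map_target hz
    rw [extChartAt_source] at hz'
    have h1 := TangentBundle.symmL_trivializationAt (I := 𝓘(ℝ, E)) hz'
    rw [(extChartAt 𝓘(ℝ, E) x).right_inv hz] at h1
    rw [VectorField.mpullbackWithin_apply, constField, chartVector, h1]
    exact (isInvertible_mfderivWithin_extChartAt_symm hz).inverse_apply_eq.2 rfl
  rw [← VectorField.mlieBracketWithin_univ, VectorField.mlieBracketWithin_apply]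
  rw [((h u).filter_mono nhdsWithin_le_nhds).lieBracketWithin_vectorField_eq (h u).eq_of_nhds
    ((h v).filter_mono nhdsWithin_le_nhds) (h v).eq_of_nhds]
  have h0 : ∀ (a b : E) (s : Set E) (z : E),
      VectorField.lieBracketWithin ℝ (fun _ => a) (fun _ => b) s z = 0 := fun a b s z => by
    simp [VectorField.lieBracketWithin]
  erw [h0]
  exact (mfderiv 𝓘(ℝ, E) 𝓘(ℝ, E) (extChartAt 𝓘(ℝ, E) x) x).inverse.map_zero

variable [RiemannianBundle (fun x : M => TangentSpace 𝓘(ℝ, E) x)]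

/-- `metricDeriv x u v w` is the derivative at `x`, in the direction `u`, of the metric coefficient
`y ↦ g_y(V, W)`, where `V`, `W` have constant coordinates and extend `v`, `w`. -/
def metricDeriv (x : M) (u v w : TangentSpace 𝓘(ℝ, E) x) : ℝ :=
  mvfderiv 𝓘(ℝ, E) (fun y : M => inner ℝ (constField v y) (constField w y)) x u

lemma metricDeriv_comm (x : M) (u v w : TangentSpace 𝓘(ℝ, E) x) :
    metricDeriv x u v w = metricDeriv x u w v := by
  simp only [metricDeriv, real_inner_comm]

lemma metricDeriv_add_left (x : M) (u u' v w : TangentSpace 𝓘(ℝ, E) x) :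
    metricDeriv x (u + u') v w = metricDeriv x u v w + metricDeriv x u' v w :=
  map_add _ _ _

lemma metricDeriv_smul_left (x : M) (a : ℝ) (u v w : TangentSpace 𝓘(ℝ, E) x) :
    metricDeriv x (a • u) v w = a * metricDeriv x u v w :=
  map_smul _ _ _

variable [IsContMDiffRiemannianBundle 𝓘(ℝ, E) ∞ E (fun x : M => TangentSpace 𝓘(ℝ, E) x)]

lemma mdifferentiableAt_inner {x : M} {σ τ : ∀ y : M, TangentSpace 𝓘(ℝ, E) y}
    (hσ : MDiffAt (T% σ) x) (hτ : MDiffAt (T% τ) x) :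
    MDifferentiableAt 𝓘(ℝ, E) 𝓘(ℝ, ℝ) (fun y : M => inner ℝ (σ y) (τ y)) x :=
  MDifferentiableAt.inner_bundle (IB := 𝓘(ℝ, E)) (F := E)
    (E := fun x : M => TangentSpace 𝓘(ℝ, E) x) hσ hτ

lemma metricDeriv_add_right (x : M) (u v w w' : TangentSpace 𝓘(ℝ, E) x) :
    metricDeriv x u v (w + w') = metricDeriv x u v w + metricDeriv x u v w' := by
  simp only [metricDeriv, constField_add, inner_add_right]
  rw [mvfderiv_fun_add
    (mdifferentiableAt_inner (mdifferentiableAt_constField v) (mdifferentiableAt_constField w))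
    (mdifferentiableAt_inner (mdifferentiableAt_constField v) (mdifferentiableAt_constField w'))]
  rfl

lemma metricDeriv_smul_right (x : M) (a : ℝ) (u v w : TangentSpace 𝓘(ℝ, E) x) :
    metricDeriv x u v (a • w) = a * metricDeriv x u v w := by
  simp only [metricDeriv, constField_smul, inner_smul_right]
  rw [mvfderiv_fun_mul mdifferentiableAt_const
    (mdifferentiableAt_inner (mdifferentiableAt_constField v) (mdifferentiableAt_constField w))]
  simp [mvfderiv]

variable [FiniteDimensional ℝ E]

instance (x : M) : FiniteDimensional ℝ (TangentSpace 𝓘(ℝ, E) x) :=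
  inferInstanceAs (FiniteDimensional ℝ E)

instance (x : M) : CompleteSpace (TangentSpace 𝓘(ℝ, E) x) :=
  FiniteDimensional.complete ℝ _

/-- The right-hand side of the Koszul formula for fields with constant coordinates
(their Lie brackets vanish). -/
def koszulForm (x : M) (u v : TangentSpace 𝓘(ℝ, E) x) : TangentSpace 𝓘(ℝ, E) x →L[ℝ] ℝ :=
  LinearMap.toContinuousLinearMap
    { toFun := fun w =>
        (metricDeriv x u v w + metricDeriv x v u w - metricDeriv x w u v) / 2
      map_add' := fun w w' => by
        rw [metricDeriv_add_right, metricDeriv_add_right, metricDeriv_add_left]; ring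
      map_smul' := fun a w => by
        rw [metricDeriv_smul_right, metricDeriv_smul_right, metricDeriv_smul_left]
        simp only [RingHom.id_apply, smul_eq_mul]; ring }

/-- The Christoffel symbols at `x`, in the preferred chart at `x`: the vector `Γ(u, v)` with
`g(Γ(u, v), w) = (∂_u g(v, w) + ∂_v g(u, w) - ∂_w g(u, v)) / 2` for all `w`. -/
def christoffel (x : M) (u v : TangentSpace 𝓘(ℝ, E) x) : TangentSpace 𝓘(ℝ, E) x :=
  (InnerProductSpace.toDual ℝ (TangentSpace 𝓘(ℝ, E) x)).symm (koszulForm x u v)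

lemma inner_christoffel (x : M) (u v w : TangentSpace 𝓘(ℝ, E) x) :
    inner ℝ (christoffel x u v) w =
      (metricDeriv x u v w + metricDeriv x v u w - metricDeriv x w u v) / 2 := by
  rw [christoffel, InnerProductSpace.toDual_symm_apply]
  rfl

lemma christoffel_comm (x : M) (u v : TangentSpace 𝓘(ℝ, E) x) :
    christoffel x u v = christoffel x v u := by
  refine ext_inner_right ℝ fun w => ?_
  rw [inner_christoffel, inner_christoffel, metricDeriv_comm x w u v]
  ring

lemma christoffel_add_left (x : M) (u u' v : TangentSpace 𝓘(ℝ, E) x) :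
    christoffel x (u + u') v = christoffel x u v + christoffel x u' v := by
  refine ext_inner_right ℝ fun w => ?_
  rw [inner_add_left, inner_christoffel, inner_christoffel, inner_christoffel,
    metricDeriv_add_left, metricDeriv_comm x v, metricDeriv_add_right,
    metricDeriv_comm x w (u + u'), metricDeriv_add_right, metricDeriv_comm x v w,
    metricDeriv_comm x v w, metricDeriv_comm x w v, metricDeriv_comm x w v]
  ring

lemma christoffel_smul_left (x : M) (a : ℝ) (u v : TangentSpace 𝓘(ℝ, E) x) :
    christoffel x (a • u) v = a • christoffel x u v := by
  refine ext_inner_right ℝ fun w => ?_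
  rw [real_inner_smul_left, inner_christoffel, inner_christoffel, metricDeriv_smul_left,
    metricDeriv_comm x v, metricDeriv_smul_right, metricDeriv_comm x w (a • u),
    metricDeriv_smul_right, metricDeriv_comm x v w, metricDeriv_comm x w v]
  ring

lemma christoffel_add_right (x : M) (u v v' : TangentSpace 𝓘(ℝ, E) x) :
    christoffel x u (v + v') = christoffel x u v + christoffel x u v' := by
  simp only [christoffel_comm x u, christoffel_add_left]

lemma christoffel_smul_right (x : M) (a : ℝ) (u v : TangentSpace 𝓘(ℝ, E) x) :
    christoffel x u (a • v) = a • christoffel x u v := by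
  simp only [christoffel_comm x u, christoffel_smul_left]

/-- `(∇σ)(x)`, computed in the preferred chart at `x`: `∇_v σ = ∂_v σ + Γ(v, σ)`. -/
def leviCivitaFun (σ : ∀ x : M, TangentSpace 𝓘(ℝ, E) x) (x : M) :
    TangentSpace 𝓘(ℝ, E) x →L[ℝ] TangentSpace 𝓘(ℝ, E) x :=
  chartVector x x ∘L mvfderiv 𝓘(ℝ, E) (fun y : M => chartCoord x y (σ y)) x +
    LinearMap.toContinuousLinearMap
      { toFun := fun v => christoffel x v (σ x)
        map_add' := fun v v' => christoffel_add_left x v v' _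
        map_smul' := fun a v => christoffel_smul_left x a v _ }

lemma leviCivitaFun_apply (σ : ∀ x : M, TangentSpace 𝓘(ℝ, E) x) (x : M)
    (v : TangentSpace 𝓘(ℝ, E) x) :
    leviCivitaFun σ x v =
      chartVector x x (mvfderiv 𝓘(ℝ, E) (fun y : M => chartCoord x y (σ y)) x v) +
        christoffel x v (σ x) :=
  rfl

variable (E M) in
/-- The Levi-Civita connection of a Riemannian manifold. -/
def leviCivita : CovariantDerivative 𝓘(ℝ, E) E (fun x : M => TangentSpace 𝓘(ℝ, E) x) where
  toFun := leviCivitaFun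
  isCovariantDerivativeOnUniv :=
    { add := by
        intro σ σ' x hσ hσ' _
        ext v
        have h : mvfderiv 𝓘(ℝ, E) (fun y : M => chartCoord x y ((σ + σ') y)) x =
            mvfderiv 𝓘(ℝ, E) (fun y : M => chartCoord x y (σ y)) x +
              mvfderiv 𝓘(ℝ, E) (fun y : M => chartCoord x y (σ' y)) x := by
          rw [← mvfderiv_fun_add (mdifferentiableAt_chartCoord hσ)
            (mdifferentiableAt_chartCoord hσ')]
          simp only [Pi.add_apply, map_add]
        rw [add_apply, leviCivitaFun_apply, leviCivitaFun_apply,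
          leviCivitaFun_apply, h, add_apply, map_add, Pi.add_apply,
          christoffel_add_right]
        abel
      leibniz := by
        intro σ g x hσ hg _
        ext v
        have h : mvfderiv 𝓘(ℝ, E) (fun y : M => chartCoord x y ((g • σ) y)) x =
            g x • mvfderiv 𝓘(ℝ, E) (fun y : M => chartCoord x y (σ y)) x +
              (mvfderiv 𝓘(ℝ, E) g x).smulRight (chartCoord x x (σ x)) := by
          rw [← mvfderiv_fun_smul hg (mdifferentiableAt_chartCoord hσ)]
          simp only [Pi.smul_apply', map_smul]
        rw [add_apply, leviCivitaFun_apply, h, add_apply,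
          smul_apply, smul_apply, leviCivitaFun_apply,
          ContinuousLinearMap.smulRight_apply, ContinuousLinearMap.smulRight_apply, map_add,
          map_smul, map_smul, chartVector_chartCoord_self, Pi.smul_apply', christoffel_smul_right,
          smul_add]
        abel }

lemma leviCivita_constField {x : M} (u v : TangentSpace 𝓘(ℝ, E) x) :
    leviCivita E M (constField v) x u = christoffel x u v := by
  have h : mvfderiv 𝓘(ℝ, E) (fun y : M => chartCoord x y (constField v y)) x = 0 := by
    rw [mvfderiv, (chartCoord_constField_eventuallyEq v).mfderiv_eq, mfderiv_const]
    exact ContinuousLinearMap.comp_zero _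
  change leviCivitaFun (constField v) x u = _
  rw [leviCivitaFun_apply, h, constField_self]
  simp

/-- The Levi-Civita connection is compatible with the metric. -/
theorem leviCivita_metric {x : M} {σ τ : ∀ y : M, TangentSpace 𝓘(ℝ, E) y}
    (hσ : MDiffAt (T% σ) x) (hτ : MDiffAt (T% τ) x) (v : TangentSpace 𝓘(ℝ, E) x) :
    mvfderiv 𝓘(ℝ, E) (fun y : M => inner ℝ (σ y) (τ y)) x v =
      inner ℝ (leviCivita E M σ x v) (τ x) + inner ℝ (σ x) (leviCivita E M τ x v) := by
  let Φ (σ τ : ∀ y : M, TangentSpace 𝓘(ℝ, E) y) : ℝ :=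
    mvfderiv 𝓘(ℝ, E) (fun y : M => inner ℝ (σ y) (τ y)) x v -
      inner ℝ (leviCivita E M σ x v) (τ x) - inner ℝ (σ x) (leviCivita E M τ x v)
  have hsymm : ∀ σ τ, Φ σ τ = Φ τ σ := fun σ τ => by
    have h : (fun y : M => inner ℝ (σ y) (τ y)) = fun y => inner ℝ (τ y) (σ y) :=
      funext fun y => real_inner_comm _ _
    simp only [Φ, h, real_inner_comm (τ x), real_inner_comm _ (σ x)]
    ring
  have h1 : ∀ τ, MDiffAt (T% τ) x → TensorialAt 𝓘(ℝ, E) E (Φ · τ) x := fun τ hτ =>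
    { smul := by
        intro f σ hf hσ
        have h := (leviCivita E M).isCovariantDerivativeOnUniv.leibniz hσ hf
        simp only [Φ, h, Pi.smul_apply', real_inner_smul_left]
        rw [mvfderiv_fun_mul hf (mdifferentiableAt_inner hσ hτ)]
        simp only [add_apply, smul_apply, ContinuousLinearMap.smulRight_apply, inner_add_left,
          real_inner_smul_left, smul_eq_mul]
        ring
      add := by
        intro σ σ' hσ hσ'
        have h := (leviCivita E M).isCovariantDerivativeOnUniv.add hσ hσ'
        simp only [Φ, h, Pi.add_apply, inner_add_left, add_apply]
        rw [mvfderiv_fun_add (mdifferentiableAt_inner hσ hτ) (mdifferentiableAt_inner hσ' hτ)]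
        simp only [add_apply]
        ring }
  have h2 : ∀ σ, MDiffAt (T% σ) x → TensorialAt 𝓘(ℝ, E) E (Φ σ ·) x := fun σ hσ =>
    { smul := fun hf hτ => by
        simp only [hsymm σ]
        exact (h1 σ hσ).smul hf hτ
      add := fun hτ hτ' => by
        simp only [hsymm σ]
        exact (h1 σ hσ).add hτ hτ' }
  have h := TensorialAt.pointwise₂ h1 h2 hσ (mdifferentiableAt_constField (σ x)) hτ
    (mdifferentiableAt_constField (τ x)) (constField_self _).symm (constField_self _).symm
  have h3 : Φ (constField (σ x)) (constField (τ x)) = 0 := by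
    change metricDeriv x v (σ x) (τ x) - _ - _ = 0
    rw [leviCivita_constField, leviCivita_constField, constField_self, constField_self,
      inner_christoffel, real_inner_comm, inner_christoffel, metricDeriv_comm x v (τ x),
      metricDeriv_comm x (σ x) v, metricDeriv_comm x (τ x) v]
    ring
  have h4 := h.trans h3
  simp only [Φ] at h4
  linarith

/-- The Levi-Civita connection is torsion-free. -/
theorem leviCivita_torsion : (leviCivita E M).torsion = 0 := by
  ext x u v
  have h := (leviCivita E M).torsion_apply (mdifferentiableAt_constField u)
    (mdifferentiableAt_constField v)
  rw [constField_self, constField_self, leviCivita_constField, leviCivita_constField,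
    christoffel_comm, mlieBracket_constField] at h
  rw [h]
  simp

/-- The Riemann curvature tensor
`R(u, v) w = ∇_U ∇_V W - ∇_V ∇_U W - ∇_[U, V] W` at `x`, where `U`, `V`, `W` are smooth local
extensions of `u`, `v`, `w` (the value does not depend on their choice). -/
def curvature (x : M) (u v w : TangentSpace 𝓘(ℝ, E) x) : TangentSpace 𝓘(ℝ, E) x :=
  leviCivita E M (fun y => leviCivita E M (constField w) y (constField v y)) x u -
    leviCivita E M (fun y => leviCivita E M (constField w) y (constField u y)) x v -
    leviCivita E M (constField w) x
      (VectorField.mlieBracket 𝓘(ℝ, E) (constField u) (constField v) x)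

end LeviCivita

section AlongCurves

variable {E : Type*} [NormedAddCommGroup E] [NormedSpace ℝ E]
  {M : Type*} [TopologicalSpace M] [ChartedSpace E M]

/-- The velocity of a curve, with the derivative taken within the interval `s`
(one-sided at its endpoints). -/
def velocity (c : ℝ → M) (s : Set ℝ) (t : ℝ) : TangentSpace 𝓘(ℝ, E) (c t) :=
  mfderivWithin 𝓘(ℝ, ℝ) 𝓘(ℝ, E) c s t (1 : ℝ)

variable [FiniteDimensional ℝ E] [IsManifold 𝓘(ℝ, E) ∞ M]
  [RiemannianBundle (fun x : M => TangentSpace 𝓘(ℝ, E) x)]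
  [IsContMDiffRiemannianBundle 𝓘(ℝ, E) ∞ E (fun x : M => TangentSpace 𝓘(ℝ, E) x)]

/-- The vector field `V` along the curve `c` is differentiable at `t` within `s`, and its covariant
derivative there is `W`. Writing `V = ∑ aⁱ eᵢ` in the coordinate frame `(eᵢ)` of a chart at `c t`,
this is `W = ∑ (aⁱ)' eᵢ + ∑ aⁱ ∇_{c'} eᵢ`. -/
def HasCovDerivWithinAt (c : ℝ → M) (V : ∀ t, TangentSpace 𝓘(ℝ, E) (c t)) (s : Set ℝ) (t : ℝ)
    (W : TangentSpace 𝓘(ℝ, E) (c t)) : Prop :=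
  MDifferentiableWithinAt 𝓘(ℝ, ℝ) 𝓘(ℝ, E) c s t ∧
    ∃ a : E, HasDerivWithinAt (fun r => chartCoord (c t) (c r) (V r)) a s t ∧
      W = chartVector (c t) (c t) a + leviCivita E M (constField (V t)) (c t) (velocity c s t)

/-- The `(1,1)` tensor `A` along the curve `c` is differentiable at `t` within `s`, and its
covariant derivative there is `B`, by the Leibniz rule `∇(A V) = (∇A) V + A (∇V)`. -/
def HasTensorCovDerivWithinAt (c : ℝ → M)
    (A : ∀ t, TangentSpace 𝓘(ℝ, E) (c t) →L[ℝ] TangentSpace 𝓘(ℝ, E) (c t)) (s : Set ℝ) (t : ℝ)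
    (B : TangentSpace 𝓘(ℝ, E) (c t) → TangentSpace 𝓘(ℝ, E) (c t)) : Prop :=
  ∀ (V : ∀ t, TangentSpace 𝓘(ℝ, E) (c t)) (W : TangentSpace 𝓘(ℝ, E) (c t)),
    HasCovDerivWithinAt c V s t W →
      HasCovDerivWithinAt c (fun r => A r (V r)) s t (B (V t) + A t W)

/-- `γ : [0, L] → M` is a `C²` curve parameterized by arc length. -/
structure IsArcLengthCurve (L : ℝ) (γ : ℝ → M) : Prop where
  contMDiffOn : ContMDiffOn 𝓘(ℝ, ℝ) 𝓘(ℝ, E) 2 γ (Set.Icc 0 L)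
  norm_velocity : ∀ t ∈ Set.Icc 0 L, ‖velocity (E := E) γ (Set.Icc 0 L) t‖ = 1

/-- `T = γ'` and `N₀, …, N_{m-1}` form a Bishop frame along the arc-length curve
`γ : [0, L] → M`: a `C¹` orthonormal frame for which every `∇_T Nᵢ` is a multiple of `T`
(that is, every `Nᵢ` is parallel in the normal bundle of `γ`). -/
structure IsBishopFrame {m : ℕ} (L : ℝ) (γ : ℝ → M)
    (N : Fin m → ∀ t, TangentSpace 𝓘(ℝ, E) (γ t)) : Prop where
  isArcLengthCurve : IsArcLengthCurve (E := E) L γ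
  contMDiffOn : ∀ i, ContMDiffOn 𝓘(ℝ, ℝ) (𝓘(ℝ, E).prod 𝓘(ℝ, E)) 1
    (fun t => (⟨γ t, N i t⟩ : TangentBundle 𝓘(ℝ, E) M)) (Set.Icc 0 L)
  orthonormal : ∀ t ∈ Set.Icc 0 L, Orthonormal ℝ
    (Fin.cons (velocity γ (Set.Icc 0 L) t) (fun i => N i t) :
      Fin (m + 1) → TangentSpace 𝓘(ℝ, E) (γ t))
  spanning : Module.finrank ℝ E = m + 1
  normalParallel : ∀ i, ∀ t ∈ Set.Icc 0 L, ∃ a : ℝ,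
    HasCovDerivWithinAt γ (N i) (Set.Icc 0 L) t (a • velocity γ (Set.Icc 0 L) t)

/-- `κ₀, …, κ_{m-1}` are the geodesic curvature functions of `γ : [0, L] → M` with respect to the
normal fields `N`: `∇_T T = ∑ κᵢ Nᵢ`. -/
def HasGeodesicCurvatures {m : ℕ} (L : ℝ) (γ : ℝ → M)
    (N : Fin m → ∀ t, TangentSpace 𝓘(ℝ, E) (γ t)) (κ : Fin m → ℝ → ℝ) : Prop :=
  ∀ t ∈ Set.Icc 0 L, HasCovDerivWithinAt γ (fun r => velocity γ (Set.Icc 0 L) r) (Set.Icc 0 L) t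
    (∑ i, κ i t • N i t)

variable (E M) in
/-- A rigid variation of the curve `curve 0`: arc-length curves `γ_τ = curve τ : [0, L] → M`,
`|τ| < ε`, each with its own Bishop frame, which all have the same geodesic curvature functions,
and such that the initial points `γ_τ(0)` and the initial frames at these points depend on `τ` in a
`C¹` manner. -/
structure RigidVariation (m : ℕ) (L : ℝ) where
  /-- The parameter range is `(-ε, ε)`. -/
  ε : ℝ
  ε_pos : 0 < ε
  /-- The curves `γ_τ`. -/
  curve : ℝ → ℝ → M
  /-- The normal fields of the Bishop frame along `γ_τ`. -/
  normal : ∀ τ : ℝ, Fin m → ∀ t, TangentSpace 𝓘(ℝ, E) (curve τ t)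
  isBishopFrame : ∀ τ ∈ Set.Ioo (-ε) ε, IsBishopFrame L (curve τ) (normal τ)
  /-- The common geodesic curvature functions. -/
  κ : Fin m → ℝ → ℝ
  hasGeodesicCurvatures : ∀ τ ∈ Set.Ioo (-ε) ε,
    HasGeodesicCurvatures L (curve τ) (normal τ) κ
  contMDiffOn_point : ContMDiffOn 𝓘(ℝ, ℝ) 𝓘(ℝ, E) 1 (fun τ => curve τ 0) (Set.Ioo (-ε) ε)
  contMDiffOn_tangent : ContMDiffOn 𝓘(ℝ, ℝ) (𝓘(ℝ, E).prod 𝓘(ℝ, E)) 1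
    (fun τ => (⟨curve τ 0, velocity (curve τ) (Set.Icc 0 L) 0⟩ : TangentBundle 𝓘(ℝ, E) M))
    (Set.Ioo (-ε) ε)
  contMDiffOn_normal : ∀ i, ContMDiffOn 𝓘(ℝ, ℝ) (𝓘(ℝ, E).prod 𝓘(ℝ, E)) 1
    (fun τ => (⟨curve τ 0, normal τ i 0⟩ : TangentBundle 𝓘(ℝ, E) M)) (Set.Ioo (-ε) ε)

/-- The pair `(X, A)` arises from the rigid variation `R`: along `curve 0`, `X` is the variation
field `∂γ_τ/∂τ|₀` of `R`, and `A` is the transverse derivative of its Bishop frames, that is,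
`A T = ∇_X T` and `A Nᵢ = ∇_X Nᵢ`, the covariant derivatives being taken at `τ = 0` along the
curves `τ ↦ γ_τ(t)`. All these derivatives are part of the claim. -/
structure RigidVariation.Generates {m : ℕ} {L : ℝ} (R : RigidVariation E M m L)
    (X : ∀ t, TangentSpace 𝓘(ℝ, E) (R.curve 0 t))
    (A : ∀ t, TangentSpace 𝓘(ℝ, E) (R.curve 0 t) →L[ℝ] TangentSpace 𝓘(ℝ, E) (R.curve 0 t)) :
    Prop where
  mdifferentiableAt : ∀ t ∈ Set.Icc 0 L,
    MDifferentiableAt 𝓘(ℝ, ℝ) 𝓘(ℝ, E) (fun τ => R.curve τ t) 0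
  field : ∀ t ∈ Set.Icc 0 L, velocity (fun τ => R.curve τ t) Set.univ 0 = X t
  tangent : ∀ t ∈ Set.Icc 0 L, HasCovDerivWithinAt (fun τ => R.curve τ t)
    (fun τ => velocity (R.curve τ) (Set.Icc 0 L) t) Set.univ 0
    (A t (velocity (R.curve 0) (Set.Icc 0 L) t))
  normal : ∀ i, ∀ t ∈ Set.Icc 0 L, HasCovDerivWithinAt (fun τ => R.curve τ t)
    (fun τ => R.normal τ i t) Set.univ 0 (A t (R.normal 0 i t))

/-- The `(1,1)` tensor `A` along `γ : [0, L] → M` is skew-symmetric. -/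
def IsSkewAlong (L : ℝ) (γ : ℝ → M)
    (A : ∀ t, TangentSpace 𝓘(ℝ, E) (γ t) →L[ℝ] TangentSpace 𝓘(ℝ, E) (γ t)) : Prop :=
  ∀ t ∈ Set.Icc 0 L, ∀ u v : TangentSpace 𝓘(ℝ, E) (γ t), inner ℝ (A t u) v = -inner ℝ u (A t v)

/-- The generalized Jacobi equations `∇_T X = A T` and `∇_T A = R(T, X)` along
`γ : [0, L] → M`, where `T = γ'`. -/
structure GeneralizedJacobi (L : ℝ) (γ : ℝ → M) (X : ∀ t, TangentSpace 𝓘(ℝ, E) (γ t))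
    (A : ∀ t, TangentSpace 𝓘(ℝ, E) (γ t) →L[ℝ] TangentSpace 𝓘(ℝ, E) (γ t)) : Prop where
  field : ∀ t ∈ Set.Icc 0 L,
    HasCovDerivWithinAt γ X (Set.Icc 0 L) t (A t (velocity γ (Set.Icc 0 L) t))
  tensor : ∀ t ∈ Set.Icc 0 L, HasTensorCovDerivWithinAt γ A (Set.Icc 0 L) t
    (curvature (γ t) (velocity γ (Set.Icc 0 L) t) (X t))

end AlongCurves

end

/-! A curve together with a Bishop frame is a solution of one first-order system on families of
tangent vectors: `c' = ∑ bⱼ eⱼ`, `∇eᵢ = ∑ kᵢⱼ eⱼ`, where the coefficients `(b, k)` are built from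
the curvature functions and `k` is skew. A rigid variation keeps these functions fixed, so it is a
family of solutions of the same system in which only the initial data vary with `τ`.

Part (1) is then differentiable dependence on initial data. The derivative in `τ` solves the
linearized system, and that system, rewritten invariantly, is the Jacobi system. Torsion-freeness
gives `∇_T X = ∇_τ T`. The curvature gives `∇_T Dᵢ = R(T, X) eᵢ + ∑ kᵢⱼ Dⱼ` for `Dᵢ = ∇_τ eᵢ`. For
the tensor with `A eᵢ = Dᵢ` the `k`-terms cancel because `k` is skew, leaving `∇_T A = R(T, X)`.
Orthonormality for every `τ` makes `A` skew. The variation is only known to be differentiable in `τ`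
at `0` for each fixed `t`, so mixed derivatives are never interchanged: both identities are read off
from the linearized equation in a chart (`hasCovDerivWithinAt_frameVelocity`,
`hasCovDerivWithinAt_frameCovDeriv`, `exists_frameVariation`).

For part (2), the Jacobi equations are linear, so `(X, A)` is determined by `(X 0, A 0)`
(`GeneralizedJacobi.eq_of_eq_zero`). A curve of initial frames with derivative `(X 0, A 0)` comes
from a frame system in `τ` with constant coefficients; these are skew because `A 0` is, so the
frames stay orthonormal. Solving the original system from these frames (`exists_frame_family`) gives
a rigid variation. By part (1) it generates some solution of the Jacobi equations with the same
initial values, hence the given one. The Bishop frame along `γ` needed to start is built in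
`IsArcLengthCurve.exists_bishopFrame`.

Completeness is not needed: near a solution on the compact interval `[0, L]`, solutions with nearby
initial data also live on all of `[0, L]`. This is proved chart by chart in time windows and
propagated by a supremum argument. The coefficients are merely continuous in `t`, so dependence on
parameters is proved directly with Gronwall's inequality. -/

noncomputable section

set_option linter.unusedSectionVars false

/-! ### Metric, Christoffel symbols and Levi-Civita connection in an arbitrary chart. -/

section ChartCalculus

variable {E : Type*} [NormedAddCommGroup E] [NormedSpace ℝ E]
  {M : Type*} [TopologicalSpace M] [ChartedSpace E M] [IsManifold 𝓘(ℝ, E) ∞ M]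

lemma mem_baseSet_of_mem_source {x y : M} (hy : y ∈ (chartAt E x).source) :
    y ∈ (trivializationAt E (TangentSpace 𝓘(ℝ, E)) x).baseSet := by
  simpa using hy

lemma chartCoord_chartVector {x y : M} (hy : y ∈ (chartAt E x).source) (a : E) :
    chartCoord x y (chartVector x y a) = a :=
  Trivialization.continuousLinearMapAt_symmL _ (mem_baseSet_of_mem_source hy) a

lemma chartVector_chartCoord {x y : M} (hy : y ∈ (chartAt E x).source)
    (v : TangentSpace 𝓘(ℝ, E) y) : chartVector x y (chartCoord x y v) = v :=
  Trivialization.symmL_continuousLinearMapAt _ (mem_baseSet_of_mem_source hy) v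

lemma chartCoord_eq_mfderiv {x y : M} (hy : y ∈ (chartAt E x).source) :
    chartCoord x y = mfderiv 𝓘(ℝ, E) 𝓘(ℝ, E) (extChartAt 𝓘(ℝ, E) x) y :=
  TangentBundle.continuousLinearMapAt_trivializationAt hy

lemma extChartAt_symm_mem_source {x : M} {z : E} (hz : z ∈ (extChartAt 𝓘(ℝ, E) x).target) :
    (extChartAt 𝓘(ℝ, E) x).symm z ∈ (chartAt E x).source := by
  have := (extChartAt 𝓘(ℝ, E) x).map_target hz
  rwa [extChartAt_source] at this

lemma extChartAt_left_inv {x y : M} (hy : y ∈ (chartAt E x).source) :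
    (extChartAt 𝓘(ℝ, E) x).symm (extChartAt 𝓘(ℝ, E) x y) = y :=
  (extChartAt 𝓘(ℝ, E) x).left_inv (by rwa [extChartAt_source])

lemma extChartAt_mem_target {x y : M} (hy : y ∈ (chartAt E x).source) :
    extChartAt 𝓘(ℝ, E) x y ∈ (extChartAt 𝓘(ℝ, E) x).target :=
  (extChartAt 𝓘(ℝ, E) x).map_source (by rwa [extChartAt_source])

/-- The differential of a differentiable vector valued function in the coordinates of a chart. -/
lemma mdifferentiableAt_iff_chart {F : Type*} [NormedAddCommGroup F] [NormedSpace ℝ F]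
    {x y : M} (hy : y ∈ (chartAt E x).source) (f : M → F) :
    MDifferentiableAt 𝓘(ℝ, E) 𝓘(ℝ, F) f y ↔
      DifferentiableAt ℝ (f ∘ (extChartAt 𝓘(ℝ, E) x).symm) (extChartAt 𝓘(ℝ, E) x y) := by
  have hs : (extChartAt 𝓘(ℝ, E) x).symm (extChartAt 𝓘(ℝ, E) x y) = y :=
    (extChartAt 𝓘(ℝ, E) x).left_inv (by rwa [extChartAt_source])
  have hz : extChartAt 𝓘(ℝ, E) x y ∈ (extChartAt 𝓘(ℝ, E) x).target :=
    (extChartAt 𝓘(ℝ, E) x).map_source (by rwa [extChartAt_source])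
  constructor
  · intro h
    rw [← mdifferentiableAt_iff_differentiableAt]
    refine MDifferentiableAt.comp _ (by rwa [hs]) ?_
    have := mdifferentiableWithinAt_extChartAt_symm (I := 𝓘(ℝ, E)) hz
    rwa [modelWithCornersSelf_coe, Set.range_id, mdifferentiableWithinAt_univ] at this
  · intro h
    rw [← mdifferentiableAt_iff_differentiableAt] at h
    refine (h.comp y (mdifferentiableAt_extChartAt hy)).congr_of_eventuallyEq ?_
    filter_upwards [(chartAt E x).open_source.mem_nhds hy] with y' hy'
    simp only [Function.comp]
    rw [(extChartAt 𝓘(ℝ, E) x).left_inv (by rwa [extChartAt_source])]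

lemma mvfderiv_eq_fderiv_chart {F : Type*} [NormedAddCommGroup F] [NormedSpace ℝ F]
    {x y : M} (hy : y ∈ (chartAt E x).source) {f : M → F}
    (hf : MDifferentiableAt 𝓘(ℝ, E) 𝓘(ℝ, F) f y) (u : TangentSpace 𝓘(ℝ, E) y) :
    mvfderiv 𝓘(ℝ, E) f y u =
      fderiv ℝ (f ∘ (extChartAt 𝓘(ℝ, E) x).symm) (extChartAt 𝓘(ℝ, E) x y) (chartCoord x y u) := by
  have hd := (mdifferentiableAt_iff_chart hy f).1 hf
  have h : f =ᶠ[𝓝 y] (f ∘ (extChartAt 𝓘(ℝ, E) x).symm) ∘ (extChartAt 𝓘(ℝ, E) x) := by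
    filter_upwards [(chartAt E x).open_source.mem_nhds hy] with y' hy'
    simp only [Function.comp]
    rw [(extChartAt 𝓘(ℝ, E) x).left_inv (by rwa [extChartAt_source])]
  have h2 := h.mfderiv_eq (I := 𝓘(ℝ, E)) (I' := 𝓘(ℝ, F))
  rw [mfderiv_comp y hd.mdifferentiableAt (mdifferentiableAt_extChartAt hy),
    ← chartCoord_eq_mfderiv hy, mfderiv_eq_fderiv] at h2
  exact congrArg (fun L => L u) h2

/-- The vector field with constant coordinates `a` in the preferred chart at `x`. -/
def coordField (x : M) (a : E) (y : M) : TangentSpace 𝓘(ℝ, E) y := chartVector x y a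

lemma contMDiffAt_coordField {x y : M} (hy : y ∈ (chartAt E x).source) (a : E) :
    ContMDiffAt 𝓘(ℝ, E) (𝓘(ℝ, E).prod 𝓘(ℝ, E)) ∞
      (fun y => (⟨y, coordField x a y⟩ : TangentBundle 𝓘(ℝ, E) M)) y := by
  refine ((trivializationAt E (TangentSpace 𝓘(ℝ, E)) x).contMDiffAt_section_iff
    (mem_baseSet_of_mem_source hy)).2 ?_
  refine (contMDiffAt_const (c := a)).congr_of_eventuallyEq ?_
  filter_upwards [(chartAt E x).open_source.mem_nhds hy] with y' hy'
  exact (Trivialization.continuousLinearMapAt_apply_of_mem ℝ _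
    (mem_baseSet_of_mem_source hy') _).symm.trans (chartCoord_chartVector hy' a)

lemma mdifferentiableAt_coordField {x y : M} (hy : y ∈ (chartAt E x).source) (a : E) :
    MDiffAt (T% (coordField x a)) y :=
  (contMDiffAt_coordField hy a).mdifferentiableAt (by simp)

lemma mdifferentiableAt_section_iff_chartCoord {x y : M} (hy : y ∈ (chartAt E x).source)
    (σ : ∀ y : M, TangentSpace 𝓘(ℝ, E) y) :
    MDiffAt (T% σ) y ↔
      MDifferentiableAt 𝓘(ℝ, E) 𝓘(ℝ, E) (fun y' => chartCoord x y' (σ y')) y := by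
  rw [(trivializationAt E (TangentSpace 𝓘(ℝ, E)) x).mdifferentiableAt_section_iff _ _
    (mem_baseSet_of_mem_source hy)]
  refine Filter.EventuallyEq.mdifferentiableAt_iff ?_
  filter_upwards [(chartAt E x).open_source.mem_nhds hy] with y' hy'
  exact (Trivialization.continuousLinearMapAt_apply_of_mem ℝ _
    (mem_baseSet_of_mem_source hy') _).symm

/-- The constant vector field on a normed space. -/
def constVectorField (a : E) (z : E) : TangentSpace 𝓘(ℝ, E) z := a

lemma mlieBracket_constVectorField (a b z : E) :
    VectorField.mlieBracket 𝓘(ℝ, E) (constVectorField a) (constVectorField b) z = 0 := by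
  rw [← VectorField.mlieBracketWithin_univ, VectorField.mlieBracketWithin_eq_lieBracketWithin]
  change VectorField.lieBracketWithin ℝ (fun _ => a) (fun _ => b) _ z = 0
  simp [VectorField.lieBracketWithin]

/-- Coordinate fields are pullbacks of constant fields under the chart, and pullback commutes with
brackets. Unlike `mlieBracket_constField`, this is needed at every point of the chart domain, so
that the Koszul argument works away from the centre. -/
lemma mlieBracket_coordField [CompleteSpace E] {x y : M} (hy : y ∈ (chartAt E x).source)
    (a b : E) :
    VectorField.mlieBracket 𝓘(ℝ, E) (coordField x a) (coordField x b) y = 0 := by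
  have h : ∀ a : E, VectorField.mpullback 𝓘(ℝ, E) 𝓘(ℝ, E) (extChartAt 𝓘(ℝ, E) x)
      (constVectorField a) =ᶠ[𝓝 y] coordField x a := by
    intro a
    filter_upwards [(chartAt E x).open_source.mem_nhds hy] with y' hy'
    have hi := isInvertible_mfderiv_extChartAt (I := 𝓘(ℝ, E)) (x := x) (y := y')
      (by rwa [extChartAt_source])
    rw [VectorField.mpullback_apply]
    refine hi.inverse_apply_eq.2 ?_
    rw [← chartCoord_eq_mfderiv hy']
    exact (chartCoord_chartVector hy' a).symm
  rw [← (h a).mlieBracket_vectorField_eq (h b)]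
  have hc : ∀ a : E, MDiffAt (T% (constVectorField a)) (extChartAt 𝓘(ℝ, E) x y) := fun a =>
    (contMDiffAt_vectorSpace_iff_contDiffAt.2
      (contDiffAt_const (c := a) (n := 1))).mdifferentiableAt one_ne_zero
  have : IsManifold 𝓘(ℝ, E) (minSmoothness ℝ 3) M := by
    rw [minSmoothness_of_isRCLikeNormedField]
    exact IsManifold.of_le (n := ∞) ENat.LEInfty.out
  rw [← VectorField.mpullback_mlieBracket (n := ∞) (hc a) (hc b)
    (contMDiffAt_extChartAt' hy) (by simpa using ENat.LEInfty.out), VectorField.mpullback_apply,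
    mlieBracket_constVectorField]
  exact map_zero _

variable [RiemannianBundle (fun x : M => TangentSpace 𝓘(ℝ, E) x)]

/-- The metric in the coordinates of the preferred chart at `x`. -/
def metricCoord (x : M) (z : E) : E →L[ℝ] E →L[ℝ] ℝ :=
  (innerSL ℝ (E := TangentSpace 𝓘(ℝ, E) ((extChartAt 𝓘(ℝ, E) x).symm z))).bilinearComp
    (chartVector x _) (chartVector x _)

lemma metricCoord_apply (x : M) (z a b : E) :
    metricCoord x z a b = inner ℝ (coordField x a ((extChartAt 𝓘(ℝ, E) x).symm z))
      (coordField x b ((extChartAt 𝓘(ℝ, E) x).symm z)) :=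
  rfl

lemma metricCoord_comm (x : M) (z a b : E) : metricCoord x z a b = metricCoord x z b a := by
  rw [metricCoord_apply, metricCoord_apply, real_inner_comm]

lemma metricCoord_extChartAt {x y : M} (hy : y ∈ (chartAt E x).source) (a b : E) :
    metricCoord x (extChartAt 𝓘(ℝ, E) x y) a b =
      inner ℝ (coordField x a y) (coordField x b y) := by
  rw [metricCoord_apply, extChartAt_left_inv hy]

lemma inner_eq_metricCoord {x y : M} (hy : y ∈ (chartAt E x).source)
    (u v : TangentSpace 𝓘(ℝ, E) y) :
    inner ℝ u v =
      metricCoord x (extChartAt 𝓘(ℝ, E) x y) (chartCoord x y u) (chartCoord x y v) := by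
  rw [metricCoord_extChartAt hy, coordField, coordField, chartVector_chartCoord hy,
    chartVector_chartCoord hy]

variable [IsContMDiffRiemannianBundle 𝓘(ℝ, E) ∞ E (fun x : M => TangentSpace 𝓘(ℝ, E) x)]
  [FiniteDimensional ℝ E]

lemma contDiffOn_metricCoord (x : M) :
    ContDiffOn ℝ ∞ (metricCoord x) (extChartAt 𝓘(ℝ, E) x).target := by
  rw [contDiffOn_clm_apply]
  intro a
  rw [contDiffOn_clm_apply]
  intro b
  rw [← contMDiffOn_iff_contDiffOn]
  intro z hz
  have h := ContMDiffAt.inner_bundle (IB := 𝓘(ℝ, E)) (F := E)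
    (E := fun x : M => TangentSpace 𝓘(ℝ, E) x)
    (contMDiffAt_coordField (extChartAt_symm_mem_source hz) a)
    (contMDiffAt_coordField (extChartAt_symm_mem_source hz) b)
  exact h.comp_contMDiffWithinAt z (contMDiffOn_extChartAt_symm x z hz)

lemma contDiffAt_metricCoord {x : M} {z : E} (hz : z ∈ (extChartAt 𝓘(ℝ, E) x).target) :
    ContDiffAt ℝ ∞ (metricCoord x) z :=
  (contDiffOn_metricCoord x).contDiffAt ((isOpen_extChartAt_target x).mem_nhds hz)

/-- Positive definiteness gives injectivity, and `E` and its dual have equal finite dimension. -/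
lemma isInvertible_metricCoord {x : M} {z : E} (hz : z ∈ (extChartAt 𝓘(ℝ, E) x).target) :
    (metricCoord x z).IsInvertible := by
  have hinj : Function.Injective (metricCoord x z : E →ₗ[ℝ] E →L[ℝ] ℝ) := by
    rw [← LinearMap.ker_eq_bot, LinearMap.ker_eq_bot']
    intro a ha
    have h1 : metricCoord x z a a = 0 := by
      have : metricCoord x z a = 0 := ha
      rw [this]; rfl
    rw [metricCoord_apply, inner_self_eq_zero] at h1
    rw [← chartCoord_chartVector (extChartAt_symm_mem_source hz) a]
    change chartCoord x _ (coordField x a _) = 0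
    rw [h1, map_zero]
  have hfr : Module.finrank ℝ E = Module.finrank ℝ (E →L[ℝ] ℝ) := by
    rw [← (LinearMap.toContinuousLinearMap : (E →ₗ[ℝ] ℝ) ≃ₗ[ℝ] (E →L[ℝ] ℝ)).finrank_eq]
    exact Subspace.dual_finrank_eq.symm
  let e := LinearEquiv.ofBijective (metricCoord x z : E →ₗ[ℝ] E →L[ℝ] ℝ)
    ⟨hinj, (LinearMap.injective_iff_surjective_of_finrank_eq_finrank hfr).1 hinj⟩
  exact ⟨e.toContinuousLinearEquiv, by ext; rfl⟩

/-- The derivative in the direction `u` of the metric coefficient `g(v, w)` in the coordinates of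
the preferred chart at `x`. -/
def metricCoordDeriv (x : M) (z u v w : E) : ℝ := fderiv ℝ (metricCoord x) z u v w

lemma metricCoordDeriv_add_left (x : M) (z u u' v w : E) : metricCoordDeriv x z (u + u') v w =
    metricCoordDeriv x z u v w + metricCoordDeriv x z u' v w :=
  congrArg (fun L : E →L[ℝ] E →L[ℝ] ℝ => L v w) ((fderiv ℝ (metricCoord x) z).map_add u u')

lemma metricCoordDeriv_smul_left (x : M) (z : E) (a : ℝ) (u v w : E) :
    metricCoordDeriv x z (a • u) v w = a * metricCoordDeriv x z u v w :=
  congrArg (fun L : E →L[ℝ] E →L[ℝ] ℝ => L v w) ((fderiv ℝ (metricCoord x) z).map_smul a u)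

lemma metricCoordDeriv_add_middle (x : M) (z u v v' w : E) : metricCoordDeriv x z u (v + v') w =
    metricCoordDeriv x z u v w + metricCoordDeriv x z u v' w :=
  congrArg (fun L : E →L[ℝ] ℝ => L w) ((fderiv ℝ (metricCoord x) z u).map_add v v')

lemma metricCoordDeriv_smul_middle (x : M) (z : E) (a : ℝ) (u v w : E) :
    metricCoordDeriv x z u (a • v) w = a * metricCoordDeriv x z u v w :=
  congrArg (fun L : E →L[ℝ] ℝ => L w) ((fderiv ℝ (metricCoord x) z u).map_smul a v)

lemma metricCoordDeriv_add_right (x : M) (z u v w w' : E) : metricCoordDeriv x z u v (w + w') =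
    metricCoordDeriv x z u v w + metricCoordDeriv x z u v w' :=
  (fderiv ℝ (metricCoord x) z u v).map_add w w'

lemma metricCoordDeriv_smul_right (x : M) (z : E) (a : ℝ) (u v w : E) :
    metricCoordDeriv x z u v (a • w) = a * metricCoordDeriv x z u v w :=
  (fderiv ℝ (metricCoord x) z u v).map_smul a w

/-- The Koszul form `(∂_u g(v, w) + ∂_v g(u, w) - ∂_w g(u, v)) / 2` in the coordinates of the
preferred chart at `x`. -/
def koszulCoord (x : M) (z u v : E) : E →L[ℝ] ℝ :=
  LinearMap.toContinuousLinearMap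
    { toFun := fun w => (metricCoordDeriv x z u v w + metricCoordDeriv x z v u w -
        metricCoordDeriv x z w u v) / 2
      map_add' := fun w w' => by
        simp only [metricCoordDeriv_add_left, metricCoordDeriv_add_right]; ring
      map_smul' := fun a w => by
        simp only [metricCoordDeriv_smul_left, metricCoordDeriv_smul_right, smul_eq_mul,
          RingHom.id_apply]; ring }

lemma koszulCoord_apply (x : M) (z u v w : E) :
    koszulCoord x z u v w = (metricCoordDeriv x z u v w + metricCoordDeriv x z v u w -
      metricCoordDeriv x z w u v) / 2 :=
  rfl

/-- The Christoffel symbols of the preferred chart at `x`, as a function of the coordinates. -/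
def chartChristoffel (x : M) (z : E) : E →L[ℝ] E →L[ℝ] E :=
  LinearMap.toContinuousBilinearMap <| LinearMap.mk₂ ℝ
    (fun u v => (metricCoord x z).inverse (koszulCoord x z u v))
    (fun u u' v => by
      rw [← map_add]; congr 1; ext w
      simp only [koszulCoord_apply, add_apply, metricCoordDeriv_add_left,
        metricCoordDeriv_add_middle]; ring)
    (fun a u v => by
      rw [← map_smul]; congr 1; ext w
      simp only [koszulCoord_apply, smul_apply, smul_eq_mul, metricCoordDeriv_smul_left,
        metricCoordDeriv_smul_middle]; ring)
    (fun u v v' => by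
      rw [← map_add]; congr 1; ext w
      simp only [koszulCoord_apply, add_apply, metricCoordDeriv_add_left,
        metricCoordDeriv_add_middle, metricCoordDeriv_add_right]; ring)
    (fun a u v => by
      rw [← map_smul]; congr 1; ext w
      simp only [koszulCoord_apply, smul_apply, smul_eq_mul, metricCoordDeriv_smul_left,
        metricCoordDeriv_smul_middle, metricCoordDeriv_smul_right]; ring)

lemma chartChristoffel_apply (x : M) (z u v : E) :
    chartChristoffel x z u v = (metricCoord x z).inverse (koszulCoord x z u v) :=
  rfl

lemma metricCoord_chartChristoffel {x : M} {z : E} (hz : z ∈ (extChartAt 𝓘(ℝ, E) x).target)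
    (u v w : E) : metricCoord x z (chartChristoffel x z u v) w = koszulCoord x z u v w := by
  have := (isInvertible_metricCoord hz).self_comp_inverse
  have h := congrArg (fun L => L (koszulCoord x z u v) w) this
  exact h

lemma metricCoordDeriv_eq_fderiv {x : M} {z : E} (hz : z ∈ (extChartAt 𝓘(ℝ, E) x).target)
    (u v w : E) : metricCoordDeriv x z u v w =
      fderiv ℝ (fun z => metricCoord x z v w) z u := by
  have hd := (contDiffAt_metricCoord hz).differentiableAt (by simp)
  have := ((hd.hasFDerivAt.clm_apply (hasFDerivAt_const v z)).clm_apply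
    (hasFDerivAt_const w z)).fderiv
  rw [metricCoordDeriv, this]
  simp

lemma contDiffOn_metricCoordDeriv (x : M) (u v w : E) :
    ContDiffOn ℝ ∞ (fun z => metricCoordDeriv x z u v w)
      (extChartAt 𝓘(ℝ, E) x).target := by
  have h : ContDiffOn ℝ ∞ (fun z => metricCoord x z v w) (extChartAt 𝓘(ℝ, E) x).target :=
    contDiffOn_clm_apply.1 (contDiffOn_clm_apply.1 (contDiffOn_metricCoord x) v) w
  exact ((h.fderiv_of_isOpen (m := ∞) (isOpen_extChartAt_target x) (by simp)).clm_apply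
    contDiffOn_const).congr fun z hz => metricCoordDeriv_eq_fderiv hz u v w

/-- The Christoffel symbols are the inverse metric applied to first derivatives of the metric, and
inversion of operators is smooth at invertible ones. -/
lemma contDiffOn_chartChristoffel (x : M) :
    ContDiffOn ℝ ∞ (chartChristoffel x) (extChartAt 𝓘(ℝ, E) x).target := by
  have h1 : ContDiffOn ℝ ∞ (fun z => (metricCoord x z).inverse)
      (extChartAt 𝓘(ℝ, E) x).target := by
    intro z hz
    obtain ⟨e, he⟩ := isInvertible_metricCoord hz
    have := contDiffAt_map_inverse (n := ∞) e
    rw [he] at this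
    exact this.comp_contDiffWithinAt z (contDiffOn_metricCoord x z hz)
  refine contDiffOn_clm_apply.2 fun u => contDiffOn_clm_apply.2 fun v => ?_
  refine h1.clm_apply (contDiffOn_clm_apply.2 fun w => ?_)
  exact (((contDiffOn_metricCoordDeriv x u v w).add (contDiffOn_metricCoordDeriv x v u w)).sub
    (contDiffOn_metricCoordDeriv x w u v)).div_const 2

lemma contDiffAt_chartChristoffel {x : M} {z : E} (hz : z ∈ (extChartAt 𝓘(ℝ, E) x).target) :
    ContDiffAt ℝ ∞ (chartChristoffel x) z :=
  (contDiffOn_chartChristoffel x).contDiffAt ((isOpen_extChartAt_target x).mem_nhds hz)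

lemma metricCoordDeriv_symm {x : M} {z : E} (hz : z ∈ (extChartAt 𝓘(ℝ, E) x).target)
    (u v w : E) : metricCoordDeriv x z u v w = metricCoordDeriv x z u w v := by
  rw [metricCoordDeriv_eq_fderiv hz, metricCoordDeriv_eq_fderiv hz]
  simp only [metricCoord_comm x _ v w]

/-- `leviCivita` is defined at each point through the chart centred there. That the Christoffel
formula holds in every other chart is the uniqueness part of the Koszul formula: metric
compatibility and vanishing torsion determine the connection on commuting fields. -/
lemma leviCivita_coordField {x y : M} (hy : y ∈ (chartAt E x).source)
    (u : TangentSpace 𝓘(ℝ, E) y) (b : E) :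
    leviCivita E M (coordField x b) y u = chartVector x y
      (chartChristoffel x (extChartAt 𝓘(ℝ, E) x y) (chartCoord x y u) b) := by
  have hz := extChartAt_mem_target hy
  have hmet : ∀ a b c : E, metricCoordDeriv x (extChartAt 𝓘(ℝ, E) x y) a b c =
      inner ℝ (leviCivita E M (coordField x b) y (coordField x a y)) (coordField x c y) +
      inner ℝ (coordField x b y) (leviCivita E M (coordField x c) y (coordField x a y)) := by
    intro a b c
    rw [metricCoordDeriv_eq_fderiv hz, ← leviCivita_metric (mdifferentiableAt_coordField hy b)
      (mdifferentiableAt_coordField hy c), mvfderiv_eq_fderiv_chart hy (mdifferentiableAt_inner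
        (mdifferentiableAt_coordField hy b) (mdifferentiableAt_coordField hy c)), coordField,
      chartCoord_chartVector hy]
    rfl
  have htor : ∀ a b : E, leviCivita E M (coordField x b) y (coordField x a y) =
      leviCivita E M (coordField x a) y (coordField x b y) := by
    intro a b
    have h := (leviCivita E M).torsion_apply (mdifferentiableAt_coordField hy a)
      (mdifferentiableAt_coordField hy b)
    rw [leviCivita_torsion, mlieBracket_coordField hy, sub_zero] at h
    exact (sub_eq_zero.1 h.symm)
  set a := chartCoord x y u with ha
  have hu : u = coordField x a y := (chartVector_chartCoord hy u).symm
  refine ext_inner_right ℝ fun w => ?_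
  set c := chartCoord x y w with hc
  have hw : w = coordField x c y := (chartVector_chartCoord hy w).symm
  rw [hw]
  change _ = inner ℝ (coordField x _ y) (coordField x c y)
  rw [← metricCoord_extChartAt hy, metricCoord_chartChristoffel hz, koszulCoord_apply,
    hmet, hmet, hmet, hu, htor b a, htor c a, htor c b,
    real_inner_comm (coordField x b y) (leviCivita E M (coordField x c) y (coordField x a y))]
  ring

end ChartCalculus

/-! ### Covariant derivatives along curves, read in arbitrary charts. -/

section CovariantDerivativeInCharts

variable {E : Type*} [NormedAddCommGroup E] [NormedSpace ℝ E]
  {M : Type*} [TopologicalSpace M] [ChartedSpace E M] [IsManifold 𝓘(ℝ, E) ∞ M]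

/-- The change of coordinates of tangent vectors, from the preferred chart at `x'` to the preferred
chart at `x`, as a function of the coordinates at `x`. -/
def coordTransition (x x' : M) (z : E) : E →L[ℝ] E :=
  chartCoord x ((extChartAt 𝓘(ℝ, E) x).symm z) ∘L
    chartVector x' ((extChartAt 𝓘(ℝ, E) x).symm z)

lemma coordTransition_extChartAt {x x' y : M} (hy : y ∈ (chartAt E x).source) (a : E) :
    coordTransition x x' (extChartAt 𝓘(ℝ, E) x y) a = chartCoord x y (coordField x' a y) := by
  rw [coordTransition, ContinuousLinearMap.comp_apply, extChartAt_left_inv hy, coordField]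

lemma chartCoord_eq_coordTransition {x x' y : M} (hy : y ∈ (chartAt E x).source)
    (hy' : y ∈ (chartAt E x').source) (v : TangentSpace 𝓘(ℝ, E) y) :
    chartCoord x y v = coordTransition x x' (extChartAt 𝓘(ℝ, E) x y) (chartCoord x' y v) := by
  rw [coordTransition_extChartAt hy, coordField, chartVector_chartCoord hy']

lemma contMDiffAt_section_iff_chartCoord {x y : M} {n : WithTop ℕ∞}
    (hn : n ≤ ∞) (hy : y ∈ (chartAt E x).source) (σ : ∀ y : M, TangentSpace 𝓘(ℝ, E) y) :
    ContMDiffAt 𝓘(ℝ, E) (𝓘(ℝ, E).prod 𝓘(ℝ, E)) n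
      (fun y => (⟨y, σ y⟩ : TangentBundle 𝓘(ℝ, E) M)) y ↔
      ContMDiffAt 𝓘(ℝ, E) 𝓘(ℝ, E) n (fun y' => chartCoord x y' (σ y')) y := by
  have : ContMDiffVectorBundle n E (TangentSpace 𝓘(ℝ, E) : M → Type _) 𝓘(ℝ, E) :=
    ContMDiffVectorBundle.of_le hn
  rw [(trivializationAt E (TangentSpace 𝓘(ℝ, E)) x).contMDiffAt_section_iff
    (mem_baseSet_of_mem_source hy)]
  refine Filter.EventuallyEq.contMDiffAt_iff ?_
  filter_upwards [(chartAt E x).open_source.mem_nhds hy] with y' hy'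
  exact (Trivialization.continuousLinearMapAt_apply_of_mem ℝ _
    (mem_baseSet_of_mem_source hy') _).symm

variable [FiniteDimensional ℝ E]

lemma contDiffOn_coordTransition (x x' : M) :
    ContDiffOn ℝ ∞ (coordTransition x x')
      ((extChartAt 𝓘(ℝ, E) x).target ∩
        (extChartAt 𝓘(ℝ, E) x).symm ⁻¹' (chartAt E x').source) := by
  rw [contDiffOn_clm_apply]
  intro a
  rw [← contMDiffOn_iff_contDiffOn]
  rintro z ⟨hz, hz'⟩
  have h1 := (contMDiffAt_section_iff_chartCoord le_rfl (extChartAt_symm_mem_source hz) _).1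
    (contMDiffAt_coordField hz' a)
  exact h1.comp_contMDiffWithinAt z
    ((contMDiffOn_extChartAt_symm x z hz).mono Set.inter_subset_left)

lemma contDiffAt_coordTransition {x x' y : M} (hy : y ∈ (chartAt E x).source)
    (hy' : y ∈ (chartAt E x').source) :
    ContDiffAt ℝ ∞ (coordTransition x x') (extChartAt 𝓘(ℝ, E) x y) := by
  refine (contDiffOn_coordTransition x x').contDiffAt (Filter.inter_mem
    ((isOpen_extChartAt_target x).mem_nhds (extChartAt_mem_target hy)) ?_)
  refine (continuousAt_extChartAt_symm' (by rwa [extChartAt_source])).preimage_mem_nhds ?_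
  rw [extChartAt_left_inv hy]
  exact (chartAt E x').open_source.mem_nhds hy'

variable [RiemannianBundle (fun x : M => TangentSpace 𝓘(ℝ, E) x)]
  [IsContMDiffRiemannianBundle 𝓘(ℝ, E) ∞ E (fun x : M => TangentSpace 𝓘(ℝ, E) x)]

/-- The Levi-Civita connection in the coordinates of any preferred chart. -/
lemma leviCivita_eq_chart {x y : M} (hy : y ∈ (chartAt E x).source)
    {σ : ∀ y : M, TangentSpace 𝓘(ℝ, E) y} (hσ : MDiffAt (T% σ) y) (u : TangentSpace 𝓘(ℝ, E) y) :
    leviCivita E M σ y u = chartVector x y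
      (mvfderiv 𝓘(ℝ, E) (fun y' => chartCoord x y' (σ y')) y u +
        chartChristoffel x (extChartAt 𝓘(ℝ, E) x y) (chartCoord x y u) (chartCoord x y (σ y))) := by
  -- Subtracting the coordinate derivative leaves an expression tensorial in `σ`, so it may be
  -- evaluated on the coordinate field with the same value at `y`, whose coordinate derivative
  -- vanishes.
  let Φ (σ : ∀ y : M, TangentSpace 𝓘(ℝ, E) y) : TangentSpace 𝓘(ℝ, E) y :=
    leviCivita E M σ y u -
      chartVector x y (mvfderiv 𝓘(ℝ, E) (fun y' => chartCoord x y' (σ y')) y u)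
  have hΦ : TensorialAt 𝓘(ℝ, E) E Φ y :=
    { smul := by
        intro f σ hf hσ
        have h := (leviCivita E M).isCovariantDerivativeOnUniv.leibniz hσ hf
        have h2 : mvfderiv 𝓘(ℝ, E) (fun y' => chartCoord x y' ((f • σ) y')) y u =
            f y • mvfderiv 𝓘(ℝ, E) (fun y' => chartCoord x y' (σ y')) y u +
              mvfderiv 𝓘(ℝ, E) f y u • chartCoord x y (σ y) := by
          have := mvfderiv_fun_smul hf ((mdifferentiableAt_section_iff_chartCoord hy σ).1 hσ)
          simp only [Pi.smul_apply', map_smul]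
          rw [this]
          rfl
        simp only [Φ, h, h2, map_add, map_smul, chartVector_chartCoord hy]
        simp only [add_apply, smul_apply, ContinuousLinearMap.smulRight_apply, smul_sub]
        abel
      add := by
        intro σ σ' hσ hσ'
        have h := (leviCivita E M).isCovariantDerivativeOnUniv.add hσ hσ'
        have h2 : mvfderiv 𝓘(ℝ, E) (fun y' => chartCoord x y' ((σ + σ') y')) y =
            mvfderiv 𝓘(ℝ, E) (fun y' => chartCoord x y' (σ y')) y +
              mvfderiv 𝓘(ℝ, E) (fun y' => chartCoord x y' (σ' y')) y := by
          rw [← mvfderiv_fun_add ((mdifferentiableAt_section_iff_chartCoord hy σ).1 hσ)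
            ((mdifferentiableAt_section_iff_chartCoord hy σ').1 hσ')]
          simp only [Pi.add_apply, map_add]
        simp only [Φ, h, h2, add_apply, map_add]
        abel }
  have h := hΦ.pointwise hσ (mdifferentiableAt_coordField hy (chartCoord x y (σ y)))
    (chartVector_chartCoord hy _).symm
  have h3 : mvfderiv 𝓘(ℝ, E)
      (fun y' => chartCoord x y' (coordField x (chartCoord x y (σ y)) y')) y = 0 := by
    have : (fun y' => chartCoord x y' (coordField x (chartCoord x y (σ y)) y')) =ᶠ[𝓝 y]
        fun _ => chartCoord x y (σ y) := by
      filter_upwards [(chartAt E x).open_source.mem_nhds hy] with y' hy'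
      exact chartCoord_chartVector hy' _
    rw [mvfderiv, this.mfderiv_eq, mfderiv_const]
    exact ContinuousLinearMap.comp_zero _
  simp only [Φ, h3, leviCivita_coordField hy] at h
  rw [map_add, ← sub_eq_iff_eq_add', h]
  simp

lemma hasDerivWithinAt_extChartAt_comp {c : ℝ → M} {s : Set ℝ} {t : ℝ} {x : M}
    (hx : c t ∈ (chartAt E x).source) (hc : MDifferentiableWithinAt 𝓘(ℝ, ℝ) 𝓘(ℝ, E) c s t) :
    HasDerivWithinAt (fun r => extChartAt 𝓘(ℝ, E) x (c r))
      (chartCoord x (c t) (velocity c s t)) s t := by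
  have h : HasMFDerivWithinAt 𝓘(ℝ, ℝ) 𝓘(ℝ, E) (fun r => extChartAt 𝓘(ℝ, E) x (c r)) s t
      ((mfderiv 𝓘(ℝ, E) 𝓘(ℝ, E) (extChartAt 𝓘(ℝ, E) x) (c t)).comp
        (mfderivWithin 𝓘(ℝ, ℝ) 𝓘(ℝ, E) c s t)) :=
    (mdifferentiableAt_extChartAt hx).hasMFDerivAt.comp_hasMFDerivWithinAt t
      hc.hasMFDerivWithinAt
  let D : ℝ →L[ℝ] E := (mfderiv 𝓘(ℝ, E) 𝓘(ℝ, E) (extChartAt 𝓘(ℝ, E) x) (c t)).comp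
    (mfderivWithin 𝓘(ℝ, ℝ) 𝓘(ℝ, E) c s t)
  have h2 : HasFDerivWithinAt (fun r => extChartAt 𝓘(ℝ, E) x (c r)) D s t :=
    hasMFDerivWithinAt_iff_hasFDerivWithinAt.1 h
  rw [chartCoord_eq_mfderiv hx]
  exact h2.hasDerivWithinAt

lemma mdifferentiableWithinAt_of_chart {c : ℝ → M} {s : Set ℝ} {t : ℝ} {x : M} {v : E}
    (hx : c t ∈ (chartAt E x).source) (hc : ContinuousWithinAt c s t)
    (h : HasDerivWithinAt (fun r => extChartAt 𝓘(ℝ, E) x (c r)) v s t) :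
    MDifferentiableWithinAt 𝓘(ℝ, ℝ) 𝓘(ℝ, E) c s t := by
  have h1 : MDifferentiableAt 𝓘(ℝ, E) 𝓘(ℝ, E) (extChartAt 𝓘(ℝ, E) x).symm
      (extChartAt 𝓘(ℝ, E) x (c t)) :=
    ((contMDiffOn_extChartAt_symm (n := 1) x).contMDiffAt ((isOpen_extChartAt_target x).mem_nhds
      (extChartAt_mem_target hx))).mdifferentiableAt one_ne_zero
  refine (h1.comp_mdifferentiableWithinAt t
    h.differentiableWithinAt.mdifferentiableWithinAt).congr_of_eventuallyEq ?_
    (extChartAt_left_inv hx).symm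
  filter_upwards [hc.preimage_mem_nhdsWithin ((chartAt E x).open_source.mem_nhds hx)] with r hr
  exact (extChartAt_left_inv hr).symm

lemma chartCoord_velocity_of_chart {c : ℝ → M} {s : Set ℝ} {t : ℝ} {x : M} {v : E}
    (hs : UniqueDiffWithinAt ℝ s t) (hx : c t ∈ (chartAt E x).source)
    (hc : ContinuousWithinAt c s t)
    (h : HasDerivWithinAt (fun r => extChartAt 𝓘(ℝ, E) x (c r)) v s t) :
    chartCoord x (c t) (velocity c s t) = v :=
  hs.eq_deriv s (hasDerivWithinAt_extChartAt_comp hx (mdifferentiableWithinAt_of_chart hx hc h)) h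

/-- `constField v` is constant in the chart at `y`, not in the chart at `x`; there its coordinates
are the transition map applied to a fixed vector, which accounts for the extra derivative term. -/
lemma leviCivita_constField_eq_chart {x y : M} (hy : y ∈ (chartAt E x).source)
    (u v : TangentSpace 𝓘(ℝ, E) y) :
    chartCoord x y (leviCivita E M (constField v) y u) =
      fderiv ℝ (coordTransition x y) (extChartAt 𝓘(ℝ, E) x y) (chartCoord x y u)
        (chartCoord y y v) +
      chartChristoffel x (extChartAt 𝓘(ℝ, E) x y) (chartCoord x y u) (chartCoord x y v) := by
  rw [leviCivita_eq_chart hy (mdifferentiableAt_constField v), chartCoord_chartVector hy,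
    constField_self, mvfderiv_eq_fderiv_chart hy
    ((mdifferentiableAt_section_iff_chartCoord hy _).1 (mdifferentiableAt_constField v))]
  congr 1
  have hd := (contDiffAt_coordTransition hy (mem_chart_source E y)).differentiableAt (by simp)
  have h := (hd.hasFDerivAt.clm_apply
    (hasFDerivAt_const (chartCoord y y v) (extChartAt 𝓘(ℝ, E) x y))).fderiv
  simp only [Function.comp_def]
  change fderiv ℝ (fun z => coordTransition x y z (chartCoord y y v)) _ _ = _
  rw [h]
  simp

/-- Product rule for the transition map, evaluated along the curve, applied to the coordinates of
the field. -/
lemma hasDerivWithinAt_chartCoord_change {c : ℝ → M} {V : ∀ t, TangentSpace 𝓘(ℝ, E) (c t)}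
    {s : Set ℝ} {t : ℝ} {x x' : M} {a : E} (hx : c t ∈ (chartAt E x).source)
    (hx' : c t ∈ (chartAt E x').source) (hc : MDifferentiableWithinAt 𝓘(ℝ, ℝ) 𝓘(ℝ, E) c s t)
    (h : HasDerivWithinAt (fun r => chartCoord x' (c r) (V r)) a s t) :
    HasDerivWithinAt (fun r => chartCoord x (c r) (V r))
      (fderiv ℝ (coordTransition x x') (extChartAt 𝓘(ℝ, E) x (c t))
        (chartCoord x (c t) (velocity c s t)) (chartCoord x' (c t) (V t)) +
        chartCoord x (c t) (chartVector x' (c t) a)) s t := by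
  have hd := ((contDiffAt_coordTransition hx hx').differentiableAt (by simp)).hasFDerivAt
  have hv := hasDerivWithinAt_extChartAt_comp hx hc
  generalize chartCoord (E := E) x (c t) (velocity c s t) = v at hv ⊢
  have h0 : HasDerivWithinAt (fun r => coordTransition x x' (extChartAt 𝓘(ℝ, E) x (c r)))
      (fderiv ℝ (coordTransition x x') (extChartAt 𝓘(ℝ, E) x (c t)) v) s t :=
    HasFDerivAt.comp_hasDerivWithinAt (l := coordTransition x x') t hd hv
  have h1 : HasDerivWithinAt (fun r => coordTransition x x' (extChartAt 𝓘(ℝ, E) x (c r))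
      (chartCoord x' (c r) (V r))) (fderiv ℝ (coordTransition x x') (extChartAt 𝓘(ℝ, E) x (c t))
        v (chartCoord x' (c t) (V t)) +
        coordTransition x x' (extChartAt 𝓘(ℝ, E) x (c t)) a) s t := h0.clm_apply h
  rw [coordTransition_extChartAt hx a] at h1
  refine h1.congr_of_eventuallyEq ?_ (chartCoord_eq_coordTransition hx hx' _)
  filter_upwards [hc.continuousWithinAt.preimage_mem_nhdsWithin
    ((chartAt E x).open_source.mem_nhds hx), hc.continuousWithinAt.preimage_mem_nhdsWithin
    ((chartAt E x').open_source.mem_nhds hx')] with r hr hr'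
  exact chartCoord_eq_coordTransition hr hr' _

/-- The definition uses the chart centred at `c t`. In another chart the derivative of the
transition map enters twice, from the coordinates of `V` and from `constField`, and cancels. This
makes it possible to work in one fixed chart over a whole time interval. -/
lemma HasCovDerivWithinAt.hasDerivWithinAt_chartCoord {c : ℝ → M}
    {V : ∀ t, TangentSpace 𝓘(ℝ, E) (c t)}
    {s : Set ℝ} {t : ℝ} {W : TangentSpace 𝓘(ℝ, E) (c t)} (h : HasCovDerivWithinAt c V s t W)
    {x : M} (hx : c t ∈ (chartAt E x).source) :
    HasDerivWithinAt (fun r => chartCoord x (c r) (V r))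
      (chartCoord x (c t) W - chartChristoffel x (extChartAt 𝓘(ℝ, E) x (c t))
        (chartCoord x (c t) (velocity c s t)) (chartCoord x (c t) (V t))) s t := by
  obtain ⟨hc, a, ha, rfl⟩ := h
  convert hasDerivWithinAt_chartCoord_change hx (mem_chart_source E (c t)) hc ha using 1
  rw [map_add, leviCivita_constField_eq_chart hx]
  abel

/-- Some covariant derivative exists by changing charts; it equals `W` because derivatives within
`s` are unique at `t`. -/
lemma hasCovDerivWithinAt_of_chart {c : ℝ → M} {V : ∀ t, TangentSpace 𝓘(ℝ, E) (c t)}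
    {s : Set ℝ} {t : ℝ} {W : TangentSpace 𝓘(ℝ, E) (c t)} {x : M}
    (hs : UniqueDiffWithinAt ℝ s t) (hx : c t ∈ (chartAt E x).source)
    (hc : MDifferentiableWithinAt 𝓘(ℝ, ℝ) 𝓘(ℝ, E) c s t)
    (h : HasDerivWithinAt (fun r => chartCoord x (c r) (V r))
      (chartCoord x (c t) W - chartChristoffel x (extChartAt 𝓘(ℝ, E) x (c t))
        (chartCoord x (c t) (velocity c s t)) (chartCoord x (c t) (V t))) s t) :
    HasCovDerivWithinAt c V s t W := by
  have ha := hasDerivWithinAt_chartCoord_change (mem_chart_source E (c t)) hx hc h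
  have hW : HasCovDerivWithinAt c V s t _ := ⟨hc, _, ha, rfl⟩
  have h2 := hs.eq_deriv s (hW.hasDerivWithinAt_chartCoord hx) h
  rw [sub_left_inj] at h2
  have h3 := congrArg (chartVector x (c t)) h2
  rw [chartVector_chartCoord hx, chartVector_chartCoord hx] at h3
  rwa [h3] at hW

lemma HasCovDerivWithinAt.unique {c : ℝ → M} {V : ∀ t, TangentSpace 𝓘(ℝ, E) (c t)}
    {s : Set ℝ} {t : ℝ} {W W' : TangentSpace 𝓘(ℝ, E) (c t)}
    (hs : UniqueDiffWithinAt ℝ s t) (h : HasCovDerivWithinAt c V s t W)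
    (h' : HasCovDerivWithinAt c V s t W') : W = W' := by
  obtain ⟨_, a, ha, rfl⟩ := h
  obtain ⟨_, a', ha', rfl⟩ := h'
  rw [hs.eq_deriv s ha ha']

set_option synthInstance.maxHeartbeats 100000 in
lemma hasDerivWithinAt_metricCoord {x : M} {z : ℝ → E} {a b : ℝ → E} {s : Set ℝ} {t : ℝ}
    {z' a' b' : E} (hz : z t ∈ (extChartAt 𝓘(ℝ, E) x).target) (h : HasDerivWithinAt z z' s t)
    (ha : HasDerivWithinAt a a' s t) (hb : HasDerivWithinAt b b' s t) :
    HasDerivWithinAt (fun r => metricCoord x (z r) (a r) (b r))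
      (metricCoordDeriv x (z t) z' (a t) (b t) + metricCoord x (z t) a' (b t) +
        metricCoord x (z t) (a t) b') s t := by
  have hd := ((contDiffAt_metricCoord hz).differentiableAt (by simp)).hasFDerivAt
  have h0 : HasDerivWithinAt (fun r => metricCoord x (z r)) (fderiv ℝ (metricCoord x) (z t) z')
      s t := hd.comp_hasDerivWithinAt t h
  have h1 : HasDerivWithinAt (fun r => metricCoord x (z r) (a r))
      (fderiv ℝ (metricCoord x) (z t) z' (a t) + metricCoord x (z t) a') s t := h0.clm_apply ha
  exact h1.clm_apply hb

/-- Compatibility of the covariant derivative along a curve with the metric. -/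
lemma HasCovDerivWithinAt.inner {c : ℝ → M} {V V' : ∀ t, TangentSpace 𝓘(ℝ, E) (c t)}
    {s : Set ℝ} {t : ℝ} {W W' : TangentSpace 𝓘(ℝ, E) (c t)}
    (h : HasCovDerivWithinAt c V s t W) (h' : HasCovDerivWithinAt c V' s t W') :
    HasDerivWithinAt (fun r => (inner ℝ (V r) (V' r) : ℝ))
      (inner ℝ W (V' t) + inner ℝ (V t) W') s t := by
  obtain ⟨x, hx⟩ : ∃ x : M, c t ∈ (chartAt E x).source := ⟨c t, mem_chart_source E (c t)⟩
  have hz := extChartAt_mem_target hx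
  have h1 := hasDerivWithinAt_metricCoord hz (hasDerivWithinAt_extChartAt_comp hx h.1)
    (h.hasDerivWithinAt_chartCoord hx) (h'.hasDerivWithinAt_chartCoord hx)
  refine (h1.congr_deriv ?_).congr_of_eventuallyEq ?_ (inner_eq_metricCoord hx _ _)
  -- The two Koszul forms coming from the Christoffel terms add up to the derivative of the metric
  -- along the velocity; the remaining terms cancel by symmetry of the metric.
  · rw [inner_eq_metricCoord hx, inner_eq_metricCoord hx]
    simp only [map_sub, sub_apply]
    rw [metricCoord_chartChristoffel hz, metricCoord_comm x _ (chartCoord x (c t) (V t))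
      (chartChristoffel x _ _ _), metricCoord_chartChristoffel hz, koszulCoord_apply,
      koszulCoord_apply]
    rw [metricCoordDeriv_symm hz _ (chartCoord x (c t) (V' t)) (chartCoord x (c t) (V t)),
      metricCoordDeriv_symm hz (chartCoord x (c t) (V' t)) (chartCoord x (c t) (velocity c s t)),
      metricCoordDeriv_symm hz (chartCoord x (c t) (V t)) (chartCoord x (c t) (velocity c s t))]
    ring
  · filter_upwards [h.1.continuousWithinAt.preimage_mem_nhdsWithin
      ((chartAt E x).open_source.mem_nhds hx)] with r hr
    exact inner_eq_metricCoord hr _ _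

lemma HasCovDerivWithinAt.smul {c : ℝ → M} {V : ∀ t, TangentSpace 𝓘(ℝ, E) (c t)}
    {s : Set ℝ} {t : ℝ} {W : TangentSpace 𝓘(ℝ, E) (c t)} {f : ℝ → ℝ} {f' : ℝ}
    (hs : UniqueDiffWithinAt ℝ s t) (hf : HasDerivWithinAt f f' s t)
    (h : HasCovDerivWithinAt c V s t W) :
    HasCovDerivWithinAt c (fun r => f r • V r) s t (f t • W + f' • V t) := by
  have hx : c t ∈ (chartAt E (c t)).source := mem_chart_source E (c t)
  refine hasCovDerivWithinAt_of_chart hs hx h.1 ?_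
  simp only [map_smul, map_add]
  refine (hf.smul (h.hasDerivWithinAt_chartCoord hx)).congr_deriv ?_
  rw [smul_sub]
  abel

lemma HasCovDerivWithinAt.congr {c : ℝ → M} {V V' : ∀ t, TangentSpace 𝓘(ℝ, E) (c t)}
    {s : Set ℝ} {t : ℝ} {W : TangentSpace 𝓘(ℝ, E) (c t)}
    (h : HasCovDerivWithinAt c V s t W) (ht : t ∈ s) (hV : ∀ r ∈ s, V' r = V r) :
    HasCovDerivWithinAt c V' s t W := by
  obtain ⟨hc, a, ha, hW⟩ := h
  refine ⟨hc, a, ha.congr (fun r hr => by rw [hV r hr]) (by rw [hV t ht]), ?_⟩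
  rw [hW, hV t ht]

lemma HasCovDerivWithinAt.sum {ι : Type*} (u : Finset ι) {c : ℝ → M}
    {V : ι → ∀ t, TangentSpace 𝓘(ℝ, E) (c t)}
    {s : Set ℝ} {t : ℝ} {W : ι → TangentSpace 𝓘(ℝ, E) (c t)}
    (hs : UniqueDiffWithinAt ℝ s t) (hc : MDifferentiableWithinAt 𝓘(ℝ, ℝ) 𝓘(ℝ, E) c s t)
    (h : ∀ i ∈ u, HasCovDerivWithinAt c (V i) s t (W i)) :
    HasCovDerivWithinAt c (fun r => ∑ i ∈ u, V i r) s t (∑ i ∈ u, W i) := by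
  have hx : c t ∈ (chartAt E (c t)).source := mem_chart_source E (c t)
  refine hasCovDerivWithinAt_of_chart hs hx hc ?_
  simp only [map_sum]
  rw [← Finset.sum_sub_distrib]
  exact HasDerivWithinAt.fun_sum fun i hi => (h i hi).hasDerivWithinAt_chartCoord hx

end CovariantDerivativeInCharts

/-! ### The curvature tensor in charts. -/

section CurvatureInCharts

variable {E : Type*} [NormedAddCommGroup E] [NormedSpace ℝ E] [FiniteDimensional ℝ E]
  {M : Type*} [TopologicalSpace M] [ChartedSpace E M] [IsManifold 𝓘(ℝ, E) ∞ M]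
  [RiemannianBundle (fun x : M => TangentSpace 𝓘(ℝ, E) x)]
  [IsContMDiffRiemannianBundle 𝓘(ℝ, E) ∞ E (fun x : M => TangentSpace 𝓘(ℝ, E) x)]

lemma chartChristoffel_symm {x : M} {z : E} (hz : z ∈ (extChartAt 𝓘(ℝ, E) x).target) (u v : E) :
    chartChristoffel x z u v = chartChristoffel x z v u := by
  rw [chartChristoffel_apply, chartChristoffel_apply]
  congr 1
  ext w
  rw [koszulCoord_apply, koszulCoord_apply, metricCoordDeriv_symm hz w u v]
  ring

/-- The derivative of the Christoffel symbols `Γ(b, c)` in the direction `a`. -/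
def chartChristoffelDeriv (x : M) (z a b c : E) : E := fderiv ℝ (chartChristoffel x) z a b c

lemma chartChristoffelDeriv_add_left (x : M) (z a a' b c : E) :
    chartChristoffelDeriv x z (a + a') b c =
      chartChristoffelDeriv x z a b c + chartChristoffelDeriv x z a' b c :=
  congrArg (fun L : E →L[ℝ] E →L[ℝ] E => L b c) ((fderiv ℝ (chartChristoffel x) z).map_add a a')

lemma chartChristoffelDeriv_smul_left (x : M) (z : E) (r : ℝ) (a b c : E) :
    chartChristoffelDeriv x z (r • a) b c = r • chartChristoffelDeriv x z a b c :=
  congrArg (fun L : E →L[ℝ] E →L[ℝ] E => L b c) ((fderiv ℝ (chartChristoffel x) z).map_smul r a)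

-- The product rule for `Γ(a, b)` along maps. Only the values of the differential are specified,
-- which is all that later computations use.
set_option synthInstance.maxHeartbeats 100000 in
lemma hasFDerivAt_chartChristoffel_apply {F : Type*} [NormedAddCommGroup F] [NormedSpace ℝ F]
    {x : M} {f a b : F → E} {f' a' b' : F →L[ℝ] E} {p : F}
    (hf : f p ∈ (extChartAt 𝓘(ℝ, E) x).target) (h : HasFDerivAt f f' p)
    (ha : HasFDerivAt a a' p) (hb : HasFDerivAt b b' p) :
    ∃ D : F →L[ℝ] E, HasFDerivAt (fun q => chartChristoffel x (f q) (a q) (b q)) D p ∧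
      ∀ q, D q = chartChristoffelDeriv x (f p) (f' q) (a p) (b p) +
        chartChristoffel x (f p) (a' q) (b p) + chartChristoffel x (f p) (a p) (b' q) := by
  have hd := ((contDiffAt_chartChristoffel hf).differentiableAt (by simp)).hasFDerivAt
  have h0 : HasFDerivAt (fun q => chartChristoffel x (f q))
      ((fderiv ℝ (chartChristoffel x) (f p)).comp f') p := hd.comp p h
  refine ⟨_, (h0.clm_apply ha).clm_apply hb, fun q => ?_⟩
  simp only [add_apply, ContinuousLinearMap.comp_apply, ContinuousLinearMap.flip_apply,
    chartChristoffelDeriv]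
  abel

lemma hasDerivWithinAt_chartChristoffel {x : M} {z a b : ℝ → E} {z' a' b' : E} {s : Set ℝ} {t : ℝ}
    (hz : z t ∈ (extChartAt 𝓘(ℝ, E) x).target) (h : HasDerivWithinAt z z' s t)
    (ha : HasDerivWithinAt a a' s t) (hb : HasDerivWithinAt b b' s t) :
    HasDerivWithinAt (fun r => chartChristoffel x (z r) (a r) (b r))
      (chartChristoffelDeriv x (z t) z' (a t) (b t) + chartChristoffel x (z t) a' (b t) +
        chartChristoffel x (z t) (a t) b') s t := by
  obtain ⟨D, hD, hDe⟩ := hasFDerivAt_chartChristoffel_apply (x := x) (p := (z t, a t, b t))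
    (f := fun q : E × E × E => q.1) (a := fun q => q.2.1) (b := fun q => q.2.2)
    hz hasFDerivAt_fst (hasFDerivAt_fst.comp _ hasFDerivAt_snd)
    (hasFDerivAt_snd.comp _ hasFDerivAt_snd)
  have := hD.comp_hasDerivWithinAt t (h.prodMk (ha.prodMk hb))
  rw [hDe] at this
  exact this

/-- The curvature tensor in the coordinates of the preferred chart at `x`. -/
def curvatureCoord (x : M) (z a b c : E) : E :=
  chartChristoffelDeriv x z a b c - chartChristoffelDeriv x z b a c +
    chartChristoffel x z a (chartChristoffel x z b c) -
    chartChristoffel x z b (chartChristoffel x z a c)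

set_option synthInstance.maxHeartbeats 100000 in
/-- The second covariant derivative of fields with given coordinate representations. -/
lemma leviCivita_leviCivita_eq_chart {x y : M} (hy : y ∈ (chartAt E x).source)
    (u v w : TangentSpace 𝓘(ℝ, E) y) :
    chartCoord x y (leviCivita E M
      (fun y' => leviCivita E M (constField w) y' (constField v y')) y u) =
      fderiv ℝ (fderiv ℝ (fun z => coordTransition x y z (chartCoord y y w)))
        (extChartAt 𝓘(ℝ, E) x y) (chartCoord x y u) (chartCoord x y v) +
      fderiv ℝ (fun z => coordTransition x y z (chartCoord y y w)) (extChartAt 𝓘(ℝ, E) x y)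
        (fderiv ℝ (fun z => coordTransition x y z (chartCoord y y v)) (extChartAt 𝓘(ℝ, E) x y)
          (chartCoord x y u)) +
      (chartChristoffelDeriv x (extChartAt 𝓘(ℝ, E) x y) (chartCoord x y u)
          (chartCoord x y v) (chartCoord x y w) +
        chartChristoffel x (extChartAt 𝓘(ℝ, E) x y)
          (fderiv ℝ (fun z => coordTransition x y z (chartCoord y y v)) (extChartAt 𝓘(ℝ, E) x y)
            (chartCoord x y u)) (chartCoord x y w) +
        chartChristoffel x (extChartAt 𝓘(ℝ, E) x y) (chartCoord x y v)
          (fderiv ℝ (fun z => coordTransition x y z (chartCoord y y w)) (extChartAt 𝓘(ℝ, E) x y)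
            (chartCoord x y u))) +
      chartChristoffel x (extChartAt 𝓘(ℝ, E) x y) (chartCoord x y u)
        (fderiv ℝ (fun z => coordTransition x y z (chartCoord y y w)) (extChartAt 𝓘(ℝ, E) x y)
            (chartCoord x y v) +
          chartChristoffel x (extChartAt 𝓘(ℝ, E) x y) (chartCoord x y v) (chartCoord x y w)) := by
  set Z := extChartAt 𝓘(ℝ, E) x y with hZ
  have hz : Z ∈ (extChartAt 𝓘(ℝ, E) x).target := extChartAt_mem_target hy
  set fV : E → E := fun z => coordTransition x y z (chartCoord y y v) with hfV
  set fW : E → E := fun z => coordTransition x y z (chartCoord y y w) with hfW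
  have hTr := contDiffAt_coordTransition hy (mem_chart_source E y)
  have hV : ContDiffAt ℝ ∞ fV Z := hTr.clm_apply contDiffAt_const
  have hW : ContDiffAt ℝ ∞ fW Z := hTr.clm_apply contDiffAt_const
  have hVy : fV Z = chartCoord x y v :=
    (chartCoord_eq_coordTransition hy (mem_chart_source E y) v).symm
  have hWy : fW Z = chartCoord x y w :=
    (chartCoord_eq_coordTransition hy (mem_chart_source E y) w).symm
  set S : ∀ y' : M, TangentSpace 𝓘(ℝ, E) y' :=
    fun y' => leviCivita E M (constField w) y' (constField v y') with hS
  have hU : ∀ᶠ y' in 𝓝 y, y' ∈ (chartAt E x).source ∧ y' ∈ (chartAt E y).source :=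
    Filter.Eventually.and ((chartAt E x).open_source.mem_nhds hy)
      ((chartAt E y).open_source.mem_nhds (mem_chart_source E y))
  -- On a whole neighbourhood of `y` the inner covariant derivative is an explicit smooth function
  -- of the coordinates, so it can be differentiated once more.
  have hSc : (fun y' => chartCoord x y' (S y')) =ᶠ[𝓝 y]
      (fun z => fderiv ℝ fW z (fV z) + chartChristoffel x z (fV z) (fW z)) ∘
        extChartAt 𝓘(ℝ, E) x := by
    filter_upwards [hU] with y' hy'
    have hwd : MDiffAt (T% (constField w)) y' := mdifferentiableAt_coordField hy'.2 _
    have e1 : chartCoord x y' (constField v y') = fV (extChartAt 𝓘(ℝ, E) x y') :=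
      (coordTransition_extChartAt hy'.1 _).symm
    have e2 : chartCoord x y' (constField w y') = fW (extChartAt 𝓘(ℝ, E) x y') :=
      (coordTransition_extChartAt hy'.1 _).symm
    simp only [hS, Function.comp_apply]
    rw [leviCivita_eq_chart hy'.1 hwd, chartCoord_chartVector hy'.1, mvfderiv_eq_fderiv_chart hy'.1
      ((mdifferentiableAt_section_iff_chartCoord hy'.1 _).1 hwd), e1, e2]
    rfl
  set f : E → E := fun z => fderiv ℝ fW z (fV z) + chartChristoffel x z (fV z) (fW z) with hf
  have hfW2 : HasFDerivAt (fderiv ℝ fW) (fderiv ℝ (fderiv ℝ fW) Z) Z :=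
    ((hW.fderiv_right (m := ∞) (by simp)).differentiableAt
      (by simp)).hasFDerivAt
  have hV1 := (hV.differentiableAt (by simp)).hasFDerivAt
  have hW1 := (hW.differentiableAt (by simp)).hasFDerivAt
  obtain ⟨D, hD, hDe⟩ := hasFDerivAt_chartChristoffel_apply (f := id) (x := x) hz
    (hasFDerivAt_id Z) hV1 hW1
  have hfd := (hfW2.clm_apply hV1).add hD
  have hfd' : HasFDerivAt f _ Z := hfd
  have hSd : MDifferentiableAt 𝓘(ℝ, E) 𝓘(ℝ, E) (fun y' => chartCoord x y' (S y')) y :=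
    (hfd'.differentiableAt.mdifferentiableAt.comp y
      (mdifferentiableAt_extChartAt hy)).congr_of_eventuallyEq hSc
  have hSm := (mdifferentiableAt_section_iff_chartCoord hy S).2 hSd
  have hSy : chartCoord x y (S y) = f Z := hSc.eq_of_nhds
  have hfe : (fun y' => chartCoord x y' (S y')) ∘ (extChartAt 𝓘(ℝ, E) x).symm =ᶠ[𝓝 Z] f := by
    have hcont := continuousAt_extChartAt_symm'' (I := 𝓘(ℝ, E)) hz
    have hl : (extChartAt 𝓘(ℝ, E) x).symm Z = y := extChartAt_left_inv hy
    have := hcont.eventually (hl.symm ▸ hSc)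
    filter_upwards [this, (isOpen_extChartAt_target x).mem_nhds hz] with z hz1 hz2
    simp only [Function.comp_apply] at hz1 ⊢
    rw [hz1, (extChartAt 𝓘(ℝ, E) x).right_inv hz2]
  rw [leviCivita_eq_chart hy hSm, chartCoord_chartVector hy, mvfderiv_eq_fderiv_chart hy hSd,
    hfe.fderiv_eq, hfd'.fderiv, hSy]
  simp only [add_apply, hDe, hf, hVy, hWy, map_add, ContinuousLinearMap.coe_id', id]
  congr 1
  congr 1
  · rw [add_comm]
    simp
  · rw [← hZ, hVy, hWy]

/-- After antisymmetrizing in `u` and `v` every term that depends on the extensions drops out: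
second derivatives of the transition map by their symmetry, first derivatives by torsion-freeness
(`htor`). What remains is the classical expression in the Christoffel symbols. -/
lemma chartCoord_curvature {x y : M} (hy : y ∈ (chartAt E x).source)
    (u v w : TangentSpace 𝓘(ℝ, E) y) :
    chartCoord x y (curvature y u v w) = curvatureCoord x (extChartAt 𝓘(ℝ, E) x y)
      (chartCoord x y u) (chartCoord x y v) (chartCoord x y w) := by
  have hz : extChartAt 𝓘(ℝ, E) x y ∈ (extChartAt 𝓘(ℝ, E) x).target := extChartAt_mem_target hy
  have hTr := contDiffAt_coordTransition hy (mem_chart_source E y)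
  have hW : ContDiffAt ℝ ∞ (fun z => coordTransition x y z (chartCoord y y w))
    (extChartAt 𝓘(ℝ, E) x y) := hTr.clm_apply contDiffAt_const
  have hsym := (hW.isSymmSndFDerivAt (by simpa using ENat.LEInfty.out)).eq (chartCoord x y u)
    (chartCoord x y v)
  have hfd : ∀ (a : TangentSpace 𝓘(ℝ, E) y) (b : E),
      fderiv ℝ (fun z => coordTransition x y z (chartCoord y y a)) (extChartAt 𝓘(ℝ, E) x y) b =
      fderiv ℝ (coordTransition x y) (extChartAt 𝓘(ℝ, E) x y) b (chartCoord y y a) := by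
    intro a b
    rw [((hTr.differentiableAt (by simp)).hasFDerivAt.clm_apply
      (hasFDerivAt_const (chartCoord y y a) _)).fderiv]
    simp
  have htor : fderiv ℝ (fun z => coordTransition x y z (chartCoord y y v))
      (extChartAt 𝓘(ℝ, E) x y) (chartCoord x y u) =
      fderiv ℝ (fun z => coordTransition x y z (chartCoord y y u))
      (extChartAt 𝓘(ℝ, E) x y) (chartCoord x y v) := by
    have h : leviCivita E M (constField v) y u = leviCivita E M (constField u) y v := by
      rw [leviCivita_constField, leviCivita_constField, christoffel_comm]
    have h2 := congrArg (chartCoord x y) h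
    rw [leviCivita_constField_eq_chart hy, leviCivita_constField_eq_chart hy,
      chartChristoffel_symm hz (chartCoord x y u), add_left_inj] at h2
    rw [hfd, hfd, h2]
  rw [curvature, mlieBracket_constField, map_zero, sub_zero, map_sub,
    leviCivita_leviCivita_eq_chart hy, leviCivita_leviCivita_eq_chart hy, htor, hsym,
    curvatureCoord, map_add, map_add]
  abel

end CurvatureInCharts

/-! ### Ordinary differential equations: existence, uniqueness, dependence on a parameter. -/

section OrdinaryDifferentialEquations

open Set Metric
open scoped NNReal

variable {S : Type*} [NormedAddCommGroup S] [NormedSpace ℝ S]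

/-- A time-dependent vector field `f` on `I × B` with derivative `f'` in the space direction, with
uniform bounds of the first and second order. -/
structure RegularField (f : ℝ → S → S) (f' : ℝ → S → S →L[ℝ] S) (I : Set ℝ) (B : Set S)
    (K : ℝ≥0) : Prop where
  lipschitzOnWith : ∀ t ∈ I, LipschitzOnWith K (f t) B
  continuousOn : ∀ w ∈ B, ContinuousOn (f · w) I
  norm_le : ∀ t ∈ I, ∀ w ∈ B, ‖f t w‖ ≤ K
  norm_deriv_le : ∀ t ∈ I, ∀ w ∈ B, ‖f' t w‖ ≤ K
  continuousOn_deriv : ContinuousOn (Function.uncurry f') (I ×ˢ B)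
  taylor_le : ∀ t ∈ I, ∀ w ∈ B, ∀ w' ∈ B,
    ‖f t w' - f t w - f' t w (w' - w)‖ ≤ K * ‖w' - w‖ ^ 2

variable {f : ℝ → S → S} {f' : ℝ → S → S →L[ℝ] S} {K : ℝ≥0}

lemma RegularField.mono {I J : Set ℝ} {B : Set S} (h : RegularField f f' I B K) (hJ : J ⊆ I) :
    RegularField f f' J B K where
  lipschitzOnWith t ht := h.lipschitzOnWith t (hJ ht)
  continuousOn w hw := (h.continuousOn w hw).mono hJ
  norm_le t ht := h.norm_le t (hJ ht)
  norm_deriv_le t ht := h.norm_deriv_le t (hJ ht)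
  continuousOn_deriv := h.continuousOn_deriv.mono (prod_mono hJ subset_rfl)
  taylor_le t ht := h.taylor_le t (hJ ht)

/-- Time enters only through the continuous coefficient path `κ`; all smoothness is in `F`.
Lipschitz bounds for `F` and `fderiv ℝ F` on one small ball give every estimate, and `δ` is then
shrunk so that solutions cannot leave the ball within the window. -/
lemma exists_regularField {P : Type*} [NormedAddCommGroup P] [NormedSpace ℝ P] {F : P × S → S}
    {κ : ℝ → P} (hκ : Continuous κ) {t₀ : ℝ} {w₀ : S} (hF : ContDiffAt ℝ 2 F (κ t₀, w₀))
    {U : Set S} (hU : U ∈ 𝓝 w₀) :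
    ∃ δ > 0, ∃ a > 0, ∃ K : ℝ≥0, closedBall w₀ a ⊆ U ∧ K * (2 * δ) ≤ a / 2 ∧ K * (2 * δ) ≤ 1 / 2 ∧
      RegularField (fun t w => F (κ t, w))
        (fun t w => (fderiv ℝ F (κ t, w)).comp (ContinuousLinearMap.inr ℝ P S))
        (Icc (t₀ - δ) (t₀ + δ)) (closedBall w₀ a) K := by
  have hG : ContDiffAt ℝ 1 (fderiv ℝ F) (κ t₀, w₀) := hF.fderiv_right (by norm_num)
  obtain ⟨K₁, V₁, hV₁, hK₁⟩ := (hF.of_le (by norm_num)).exists_lipschitzOnWith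
  obtain ⟨K₂, V₂, hV₂, hK₂⟩ := hG.exists_lipschitzOnWith
  have hev := (hF.eventually (by simp)).and (Filter.Eventually.and hV₁
    (Filter.Eventually.and hV₂ (prod_mem_nhds Filter.univ_mem hU)))
  obtain ⟨ρ, hρ, hball⟩ := Metric.eventually_nhds_iff_ball.1 hev
  set a := min (ρ / 2) 1 with ha
  have ha0 : 0 < a := by positivity
  have haρ : a < ρ := (min_le_left _ _).trans_lt (by linarith)
  set p₀ : P × S := (κ t₀, w₀) with hp₀
  -- One constant for all bounds: `K₁` for the Lipschitz bound, `K₂` for the Taylor remainder, the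
  -- norms at the centre plus `(K₁ + K₂) ρ` for the sup bounds, and `1` so that the quotient
  -- defining `δ` makes sense.
  set K : ℝ≥0 := K₁ + K₂ + ‖F p₀‖₊ + ‖fderiv ℝ F p₀‖₊ + (K₁ + K₂) * ρ.toNNReal + 1 with hK
  obtain ⟨δ₁, hδ₁, hκδ⟩ := Metric.continuous_iff.1 hκ t₀ ρ hρ
  have hKpos : (0 : ℝ) < K := by
    have : (0 : ℝ≥0) < K := by positivity
    exact_mod_cast this
  set δ := min (δ₁ / 2) (a / (4 * K)) with hδ
  have hδ0 : 0 < δ := by positivity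
  have hmem : ∀ t ∈ Icc (t₀ - δ) (t₀ + δ), ∀ w ∈ closedBall w₀ a, (κ t, w) ∈ ball p₀ ρ := by
    intro t ht w hw
    rw [← ball_prod_same]
    refine ⟨hκδ t ?_, (mem_closedBall.1 hw).trans_lt haρ⟩
    rw [Real.dist_eq, abs_lt]
    have : δ < δ₁ := (min_le_left _ _).trans_lt (by linarith)
    constructor <;> linarith [ht.1, ht.2]
  have hKδ : K * (2 * δ) ≤ a / 2 := by
    have : δ ≤ a / (4 * K) := min_le_right _ _
    rw [le_div_iff₀ (by positivity)] at this
    linarith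
  have hp₀b : p₀ ∈ ball p₀ ρ := mem_ball_self hρ
  have hKr : (K : ℝ) = K₁ + K₂ + ‖F p₀‖ + ‖fderiv ℝ F p₀‖ + (K₁ + K₂) * ρ + 1 := by
    simp [hK, hρ.le]
  have hK₁0 : (0 : ℝ) ≤ K₁ := K₁.2
  have hK₂0 : (0 : ℝ) ≤ K₂ := K₂.2
  have hK₁ρ : (0 : ℝ) ≤ K₁ * ρ := by positivity
  have hK₂ρ : (0 : ℝ) ≤ K₂ * ρ := by positivity
  have n1 := norm_nonneg (F p₀)
  have n2 := norm_nonneg (fderiv ℝ F p₀)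
  have hinr : ‖ContinuousLinearMap.inr ℝ P S‖ ≤ 1 :=
    ContinuousLinearMap.opNorm_le_bound _ zero_le_one fun x => by simp [Prod.norm_def]
  have hdlip : ∀ p ∈ ball p₀ ρ, ∀ q ∈ ball p₀ ρ,
      ‖fderiv ℝ F p - fderiv ℝ F q‖ ≤ K₂ * ‖p - q‖ := fun p hp q hq =>
    hK₂.norm_sub_le (hball p hp).2.2.1 (hball q hq).2.2.1
  refine ⟨δ, hδ0, a, ha0, K, ?_, hKδ, hKδ.trans ?_, ?_⟩
  · intro w hw
    have := hmem t₀ (by constructor <;> linarith) w hw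
    exact (hball _ this).2.2.2.2
  · have : a ≤ 1 := min_le_right _ _
    linarith
  refine ⟨?_, ?_, ?_, ?_, ?_, ?_⟩
  · intro t ht
    refine LipschitzOnWith.of_dist_le_mul fun w hw w' hw' => ?_
    refine (hK₁.dist_le_mul _ (hball _ (hmem t ht w hw)).2.1 _
      (hball _ (hmem t ht w' hw')).2.1).trans ?_
    rw [Prod.dist_eq, dist_self, max_eq_right dist_nonneg]
    gcongr
    exact_mod_cast (show (K₁ : ℝ) ≤ K by rw [hKr]; nlinarith)
  · intro w hw t ht
    exact ((hball _ (hmem t ht w hw)).1.continuousAt.comp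
      (f := fun t => (κ t, w)) (by fun_prop)).continuousWithinAt
  · intro t ht w hw
    have h1 := hK₁.norm_sub_le (hball _ (hmem t ht w hw)).2.1 (hball _ hp₀b).2.1
    have h2 : ‖(κ t, w) - p₀‖ ≤ ρ := by
      rw [← dist_eq_norm]; exact (mem_ball.1 (hmem t ht w hw)).le
    have h3 := norm_le_norm_add_norm_sub' (F (κ t, w)) (F p₀)
    have h4 : (K₁ : ℝ) * ‖(κ t, w) - p₀‖ ≤ K₁ * ρ := by gcongr
    rw [hKr]
    nlinarith
  · intro t ht w hw
    have h1 := hdlip _ (hmem t ht w hw) _ hp₀b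
    have h2 : ‖(κ t, w) - p₀‖ ≤ ρ := by
      rw [← dist_eq_norm]; exact (mem_ball.1 (hmem t ht w hw)).le
    have h3 := norm_le_norm_add_norm_sub' (fderiv ℝ F (κ t, w)) (fderiv ℝ F p₀)
    have h4 : (K₂ : ℝ) * ‖(κ t, w) - p₀‖ ≤ K₂ * ρ := by gcongr
    have h5 := (fderiv ℝ F (κ t, w)).opNorm_comp_le (ContinuousLinearMap.inr ℝ P S)
    have h6 : ‖fderiv ℝ F (κ t, w)‖ * ‖ContinuousLinearMap.inr ℝ P S‖ ≤
      ‖fderiv ℝ F (κ t, w)‖ * 1 := by gcongr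
    rw [hKr]
    nlinarith
  · rintro ⟨t, w⟩ ⟨ht, hw⟩
    have h1 : ContinuousAt (fderiv ℝ F) (κ t, w) :=
      ((hball _ (hmem t ht w hw)).1.fderiv_right (m := 1) (by norm_num)).continuousAt
    have h2 : ContinuousAt (fun q : ℝ × S => fderiv ℝ F (κ q.1, q.2)) (t, w) :=
      h1.comp (f := fun q : ℝ × S => (κ q.1, q.2)) (by fun_prop)
    exact (h2.clm_comp continuousAt_const).continuousWithinAt
  · intro t ht w hw w' hw'
    -- Intersecting with the ball of radius `‖w' - w‖` about `w` keeps the derivative within `K₂ *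
    -- ‖w' - w‖` of its value at `w`; the mean value inequality then gives a quadratic remainder.
    have hconv : Convex ℝ (closedBall w₀ a ∩ closedBall w ‖w' - w‖) :=
      (convex_closedBall _ _).inter (convex_closedBall _ _)
    have hder : ∀ v ∈ closedBall w₀ a ∩ closedBall w ‖w' - w‖,
        HasFDerivWithinAt (fun v => F (κ t, v))
          ((fderiv ℝ F (κ t, v)).comp (ContinuousLinearMap.inr ℝ P S))
          (closedBall w₀ a ∩ closedBall w ‖w' - w‖) v := by
      intro v hv
      have h1 := ((hball _ (hmem t ht v hv.1)).1.differentiableAt (by norm_num)).hasFDerivAt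
      have h2 : HasFDerivAt (fun v : S => (κ t, v)) (ContinuousLinearMap.inr ℝ P S) v :=
        hasFDerivAt_prodMk_right _ _
      exact (h1.comp v h2).hasFDerivWithinAt
    have hbound : ∀ v ∈ closedBall w₀ a ∩ closedBall w ‖w' - w‖,
        ‖(fderiv ℝ F (κ t, v)).comp (ContinuousLinearMap.inr ℝ P S) -
          (fderiv ℝ F (κ t, w)).comp (ContinuousLinearMap.inr ℝ P S)‖ ≤ K₂ * ‖w' - w‖ := by
      intro v hv
      rw [← ContinuousLinearMap.sub_comp]
      refine (ContinuousLinearMap.opNorm_comp_le _ _).trans ?_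
      have h1 := hdlip _ (hmem t ht v hv.1) _ (hmem t ht w hw)
      have h2 : ‖(κ t, v) - (κ t, w)‖ ≤ ‖w' - w‖ := by
        rw [Prod.mk_sub_mk, sub_self, Prod.norm_def, norm_zero,
          max_eq_right (norm_nonneg _), ← dist_eq_norm]
        exact mem_closedBall.1 hv.2
      calc _ ≤ ‖fderiv ℝ F (κ t, v) - fderiv ℝ F (κ t, w)‖ * 1 := by gcongr
        _ ≤ K₂ * ‖w' - w‖ := by
          rw [mul_one]
          exact h1.trans (by gcongr)
    have h := hconv.norm_image_sub_le_of_norm_hasFDerivWithin_le' hder hbound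
      ⟨hw, mem_closedBall_self (norm_nonneg _)⟩ ⟨hw', by rw [mem_closedBall, dist_eq_norm]⟩
    refine h.trans ?_
    rw [pow_two, mul_assoc]
    gcongr
    exact_mod_cast (show (K₂ : ℝ) ≤ K by rw [hKr]; nlinarith)

/-- Picard–Lindelöf: with speed at most `K` and `K * (b - a) ≤ r / 2`, a solution started in the
half ball stays in the ball. The fixed point of the Picard map is used directly because its
membership in the ball is part of the conclusion. -/
lemma RegularField.exists_solution [CompleteSpace S] {a b r : ℝ} {w₀ w : S} {s : ℝ}
    (h : RegularField f f' (Icc a b) (closedBall w₀ r) K) (hK : K * (b - a) ≤ r / 2) (hr : 0 ≤ r)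
    (hs : s ∈ Icc a b) (hw : w ∈ closedBall w₀ (r / 2)) :
    ∃ y : ℝ → S, y s = w ∧ ∀ t ∈ Icc a b,
      HasDerivWithinAt y (f t (y t)) (Icc a b) t ∧ y t ∈ closedBall w₀ r := by
  lift r to ℝ≥0 using hr
  replace hw : w ∈ closedBall w₀ ((r / 2 : ℝ≥0) : ℝ) := by
    rwa [NNReal.coe_div, NNReal.coe_ofNat]
  have hpl : IsPicardLindelof f (⟨s, hs⟩ : Icc a b) w₀ r (r / 2) K K :=
    { lipschitzOnWith := h.lipschitzOnWith
      continuousOn := h.continuousOn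
      norm_le := h.norm_le
      mul_max_le := by
        have : max (b - s) (s - a) ≤ b - a := max_le (by linarith [hs.1]) (by linarith [hs.2])
        have h2 : (K : ℝ) * max (b - s) (s - a) ≤ K * (b - a) := by gcongr
        rw [NNReal.coe_div, NNReal.coe_ofNat]
        linarith }
  obtain ⟨α, hα⟩ := ODE.FunSpace.exists_isFixedPt_next hpl hw
  have hmem : ∀ t, α.compProj t ∈ closedBall w₀ r := fun t =>
    α.compProj_mem_closedBall hpl.mul_max_le
  refine ⟨α.compProj, ?_, fun t ht => ⟨?_, hmem t⟩⟩
  · rw [ODE.FunSpace.compProj_val (t := ⟨s, hs⟩), ← hα, ODE.FunSpace.next_apply₀]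
  · refine (ODE.hasDerivWithinAt_picard_Icc hs hpl.continuousOn_uncurry
      α.continuous_compProj.continuousOn (fun t' _ => hmem t') w ht).congr_of_mem ?_ ht
    intro t' ht'
    nth_rw 1 [← hα]
    rw [ODE.FunSpace.compProj_of_mem ht', ODE.FunSpace.next_apply]

/-- Linear differential equations have solutions on short intervals. -/
lemma exists_linear_solution [CompleteSpace S] {A : ℝ → S →L[ℝ] S} {a b : ℝ} (hab : a ≤ b)
    (hA : ContinuousOn A (Icc a b)) (hAK : ∀ t ∈ Icc a b, ‖A t‖ ≤ K)
    (hK : K * (b - a) ≤ 1 / 2) (z₀ : S) :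
    ∃ z : ℝ → S, z a = z₀ ∧ ∀ t ∈ Icc a b, HasDerivWithinAt z (A t (z t)) (Icc a b) t := by
  -- On the ball of radius `‖z₀‖` about `z₀` the speed is at most `2 K ‖z₀‖`, so `K * (b - a) ≤ 1 /
  -- 2` confines the solution to it. A bound on the length independent of `z₀` is possible because
  -- the equation is linear.
  have hpl : IsPicardLindelof (fun t w => A t w) (⟨a, left_mem_Icc.2 hab⟩ : Icc a b) z₀ ‖z₀‖₊ 0
      (K * (2 * ‖z₀‖₊)) K :=
    { lipschitzOnWith := fun t ht =>
        ((A t).lipschitz.weaken (by exact_mod_cast hAK t ht)).lipschitzOnWith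
      continuousOn := fun w _ => hA.clm_apply continuousOn_const
      norm_le := fun t ht w hw => by
        have h1 : ‖w‖ ≤ 2 * ‖z₀‖ := by
          have := norm_le_norm_add_norm_sub' w z₀
          rw [mem_closedBall, dist_eq_norm] at hw
          have hw' : ‖w - z₀‖ ≤ ‖z₀‖ := hw
          linarith
        refine ((A t).le_opNorm w).trans ?_
        push_cast
        gcongr
        exact hAK t ht
      mul_max_le := by
        have h1 : max (b - a) (a - a) = b - a := max_eq_left (by linarith)
        simp only [h1, NNReal.coe_mul, NNReal.coe_ofNat, coe_nnnorm, NNReal.coe_zero, sub_zero]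
        nlinarith [norm_nonneg z₀] }
  exact hpl.exists_eq_forall_mem_Icc_hasDerivWithinAt₀

lemma eq_zero_of_norm_deriv_le_right {z z' : ℝ → S} {a b C : ℝ}
    (hz : ∀ t ∈ Icc a b, HasDerivWithinAt z (z' t) (Icc a b) t)
    (hC : ∀ t ∈ Icc a b, ‖z' t‖ ≤ C * ‖z t‖) (h0 : z a = 0) : ∀ t ∈ Icc a b, z t = 0 :=
  eq_zero_of_abs_deriv_le_mul_abs_self_of_eq_zero_right
    (fun t ht => (hz t ht).continuousWithinAt)
    (fun t ht => ((hz t (Ico_subset_Icc_self ht)).mono_of_mem_nhdsWithin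
      (Icc_mem_nhdsGE_of_mem ht))) h0 fun t ht => hC t (Ico_subset_Icc_self ht)

/-- Times before `s` are reduced to times after it by reflecting the time axis. -/
lemma eq_zero_of_norm_deriv_le {z z' : ℝ → S} {a b s C : ℝ} (hs : s ∈ Icc a b)
    (hz : ∀ t ∈ Icc a b, HasDerivWithinAt z (z' t) (Icc a b) t)
    (hC : ∀ t ∈ Icc a b, ‖z' t‖ ≤ C * ‖z t‖) (h0 : z s = 0) : ∀ t ∈ Icc a b, z t = 0 := by
  intro t ht
  rcases le_total s t with hst | hst
  · have hsub : Icc s b ⊆ Icc a b := Icc_subset_Icc_left hs.1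
    exact eq_zero_of_norm_deriv_le_right (fun r hr => (hz r (hsub hr)).mono hsub)
      (fun r hr => hC r (hsub hr)) h0 t ⟨hst, ht.2⟩
  · have hsub : ∀ r ∈ Icc (-s) (-a), -r ∈ Icc a b := fun r hr =>
      ⟨by linarith [hr.2], by linarith [hr.1, hs.2]⟩
    have h := eq_zero_of_norm_deriv_le_right (z := fun r => z (-r)) (z' := fun r => -z' (-r))
      (a := -s) (b := -a) (C := C) (fun r hr => by
        have h1 := (hz (-r) (hsub r hr)).scomp r
          (hasDerivAt_neg r).hasDerivWithinAt (s := Icc (-s) (-a)) hsub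
        simp only [neg_smul, one_smul] at h1
        exact h1)
      (fun r hr => by simpa using hC (-r) (hsub r hr)) (by simpa using h0) (-t)
      ⟨by linarith, by linarith [ht.1]⟩
    simpa using h

/-- Solutions of a differential equation depend differentiably on a parameter at `0` if their
initial values do. -/
lemma RegularField.hasDerivAt_parameter {a b : ℝ} {B : Set S}
    (h : RegularField f f' (Icc a b) B K) {y : ℝ → ℝ → S} {z : ℝ → S}
    (hy : ∀ᶠ τ in 𝓝 (0 : ℝ), ∀ t ∈ Icc a b,
      HasDerivWithinAt (y τ) (f t (y τ t)) (Icc a b) t ∧ y τ t ∈ B)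
    (hz : ∀ t ∈ Icc a b, HasDerivWithinAt z (f' t (y 0 t) (z t)) (Icc a b) t)
    (h0 : HasDerivAt (fun τ => y τ a) (z a) 0) :
    ∀ t ∈ Icc a b, HasDerivAt (fun τ => y τ t) (z t) 0 := by
  intro t ht
  have hab : a ≤ b := ht.1.trans ht.2
  have hy0 := hy.self_of_nhds
  -- A strictly positive rate selects the exponential form of the Gronwall bound without a separate
  -- case for `K = 0`.
  set κ : ℝ := K + 1 with hκ
  have hκ0 : 0 < κ := by positivity
  set c := Real.exp (κ * (b - a)) with hc
  have hgr : ∀ {g : ℝ → S} {g' : ℝ → S} {d e : ℝ}, 0 ≤ d → 0 ≤ e →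
      (∀ r ∈ Icc a b, HasDerivWithinAt g (g' r) (Icc a b) r) → ‖g a‖ ≤ d →
      (∀ r ∈ Icc a b, ‖g' r‖ ≤ κ * ‖g r‖ + e) → ∀ r ∈ Icc a b, ‖g r‖ ≤ d * c + e / κ * c := by
    intro g g' d e hd he hg hga hb r hr
    have h1 := norm_le_gronwallBound_of_norm_deriv_right_le
      (fun r hr => (hg r hr).continuousWithinAt)
      (fun r hr => ((hg r (Ico_subset_Icc_self hr)).mono_of_mem_nhdsWithin
        (Icc_mem_nhdsGE_of_mem hr))) hga (fun r hr => hb r (Ico_subset_Icc_self hr)) r hr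
    rw [gronwallBound_of_K_ne_0 hκ0.ne'] at h1
    have h2 : Real.exp (κ * (r - a)) ≤ c := by
      rw [hc]; gcongr; exact hr.2
    have h3 : e / κ * (Real.exp (κ * (r - a)) - 1) ≤ e / κ * c := by
      have : 0 ≤ e / κ := by positivity
      nlinarith
    have h4 : d * Real.exp (κ * (r - a)) ≤ d * c := by gcongr
    linarith
  have hc0 : 0 < c := Real.exp_pos _
  rw [hasDerivAt_iff_isLittleO] at h0 ⊢
  simp only [sub_zero] at h0 ⊢
  have hd : (fun τ => y τ a - y 0 a) =O[𝓝 0] fun τ : ℝ => τ := by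
    have h1 : (fun τ : ℝ => τ • z a) =O[𝓝 0] fun τ : ℝ => τ :=
      Asymptotics.IsBigO.of_bound ‖z a‖ (by
        filter_upwards with τ
        rw [norm_smul, mul_comm])
    simpa using h0.isBigO.add h1
  have hd2 : (fun τ => ‖y τ a - y 0 a‖ ^ 2) =o[𝓝 0] fun τ : ℝ => τ := by
    have h1 : (fun τ => ‖y τ a - y 0 a‖ * ‖y τ a - y 0 a‖) =O[𝓝 0] fun τ : ℝ => τ * τ :=
      hd.norm_left.mul hd.norm_left
    have h2 : (fun τ : ℝ => τ * τ) =o[𝓝 0] fun τ : ℝ => τ := by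
      have : (fun τ : ℝ => τ) =o[𝓝 0] fun _ : ℝ => (1 : ℝ) := by
        rw [Asymptotics.isLittleO_one_iff]
        exact Filter.tendsto_id
      simpa using this.mul_isBigO (Asymptotics.isBigO_refl (fun τ : ℝ => τ) (𝓝 0))
    simpa only [pow_two] using h1.trans_isLittleO h2
  -- The error at time `t` is controlled by the initial error, which is `o(τ)` by hypothesis, and
  -- the square of the initial displacement, which is `O(τ²)`.
  refine Asymptotics.IsBigO.trans_isLittleO (g := fun τ =>
    ‖y τ a - y 0 a - τ • z a‖ + ‖y τ a - y 0 a‖ ^ 2) ?_ (h0.norm_left.add hd2)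
  refine Asymptotics.IsBigO.of_bound (c + K * c ^ 2 / κ * c) ?_
  filter_upwards [hy] with τ hτ
  have hdist : ∀ r ∈ Icc a b, ‖y τ r - y 0 r‖ ≤ ‖y τ a - y 0 a‖ * c := by
    intro r hr
    have := hgr (norm_nonneg (y τ a - y 0 a)) le_rfl
      (fun r hr => (hτ r hr).1.sub (hy0 r hr).1) le_rfl (fun r hr => by
        have h1 := (h.lipschitzOnWith r hr).norm_sub_le (hτ r hr).2 (hy0 r hr).2
        have h2 := norm_nonneg (y τ r - y 0 r)
        simp only [Pi.sub_apply]
        rw [hκ]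
        nlinarith) r hr
    simpa using this
  have hmain := hgr (g := fun r => y τ r - y 0 r - τ • z r)
    (norm_nonneg (y τ a - y 0 a - τ • z a))
    (e := K * (‖y τ a - y 0 a‖ * c) ^ 2) (by positivity)
    (fun r hr => ((hτ r hr).1.sub (hy0 r hr).1).sub ((hz r hr).const_smul τ)) le_rfl
    (fun r hr => by
      have h1 := h.taylor_le r hr _ (hy0 r hr).2 _ (hτ r hr).2
      have h2 := (f' r (y 0 r)).le_opNorm (y τ r - y 0 r - τ • z r)
      have h3 := h.norm_deriv_le r hr _ (hy0 r hr).2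
      have h4 := norm_nonneg (y τ r - y 0 r - τ • z r)
      have h5 : ‖y τ r - y 0 r‖ ^ 2 ≤ (‖y τ a - y 0 a‖ * c) ^ 2 := by
        gcongr
        exact hdist r hr
      -- The error satisfies the linearized equation up to the Taylor remainder, which `hdist`
      -- bounds by the squared initial displacement.
      have h6 : f r (y τ r) - f r (y 0 r) - τ • f' r (y 0 r) (z r) =
          (f r (y τ r) - f r (y 0 r) - f' r (y 0 r) (y τ r - y 0 r)) +
            f' r (y 0 r) (y τ r - y 0 r - τ • z r) := by
        rw [map_sub _ _ (τ • z r), map_smul]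
        abel
      rw [h6]
      refine (norm_add_le _ _).trans ?_
      have h7 : ‖f' r (y 0 r)‖ * ‖y τ r - y 0 r - τ • z r‖ ≤
          K * ‖y τ r - y 0 r - τ • z r‖ := by gcongr
      have h8 : (K : ℝ) * ‖y τ r - y 0 r‖ ^ 2 ≤ K * (‖y τ a - y 0 a‖ * c) ^ 2 := by gcongr
      rw [hκ]
      linarith) t ht
  refine hmain.trans ?_
  have h1 : 0 ≤ ‖y τ a - y 0 a - τ • z a‖ := norm_nonneg _
  have h2 : 0 ≤ ‖y τ a - y 0 a‖ ^ 2 := by positivity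
  rw [Real.norm_of_nonneg (by positivity)]
  have h3 : (0 : ℝ) ≤ K * c ^ 2 / κ * c := by positivity
  have h4 : K * (‖y τ a - y 0 a‖ * c) ^ 2 / κ * c =
      K * c ^ 2 / κ * c * ‖y τ a - y 0 a‖ ^ 2 := by ring
  rw [h4]
  nlinarith

end OrdinaryDifferentialEquations

/-! ### Moving families of tangent vectors and the frame equations. -/

section Frames

open Set

variable {E : Type*} [NormedAddCommGroup E] [NormedSpace ℝ E] [FiniteDimensional ℝ E]
  {M : Type*} [TopologicalSpace M] [ChartedSpace E M] [IsManifold 𝓘(ℝ, E) ∞ M]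
  {ι : Type*} [Fintype ι]

variable (E M ι) in
/-- Families of tangent vectors, indexed by `ι`, at the points of `M`. -/
abbrev FrameSpace := Σ p : M, ι → TangentSpace 𝓘(ℝ, E) p

/-- The coordinates of a family of tangent vectors in the preferred chart at `x`. -/
def frameCoord (x : M) (Y : FrameSpace E M ι) : E × (ι → E) :=
  (extChartAt 𝓘(ℝ, E) x Y.1, fun i => chartCoord x Y.1 (Y.2 i))

/-- The family of tangent vectors with given coordinates in the preferred chart at `x`. -/
def frameOfCoord (x : M) (w : E × (ι → E)) : FrameSpace E M ι :=
  ⟨(extChartAt 𝓘(ℝ, E) x).symm w.1, fun i => chartVector x _ (w.2 i)⟩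

lemma frameCoord_frameOfCoord {x : M} {w : E × (ι → E)}
    (hw : w.1 ∈ (extChartAt 𝓘(ℝ, E) x).target) : frameCoord x (frameOfCoord x w) = w := by
  refine Prod.ext ((extChartAt 𝓘(ℝ, E) x).right_inv hw) (funext fun i => ?_)
  exact chartCoord_chartVector (extChartAt_symm_mem_source hw) _

lemma frameOfCoord_frameCoord {x : M} {Y : FrameSpace E M ι} (hY : Y.1 ∈ (chartAt E x).source) :
    frameOfCoord x (frameCoord x Y) = Y := by
  obtain ⟨p, e⟩ := Y
  -- The base point is generalized so that the equality of points can be substituted in the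
  -- dependent pair.
  have h : ∀ q : M, q = p → (⟨q, fun i => chartVector x q (chartCoord x p (e i))⟩ :
      FrameSpace E M ι) = ⟨p, e⟩ := by
    rintro q rfl
    exact congrArg (Sigma.mk q) (funext fun i => chartVector_chartCoord hY _)
  exact h _ (extChartAt_left_inv hY)

variable [RiemannianBundle (fun x : M => TangentSpace 𝓘(ℝ, E) x)]
  [IsContMDiffRiemannianBundle 𝓘(ℝ, E) ∞ E (fun x : M => TangentSpace 𝓘(ℝ, E) x)]

/-- The coordinate derivative of a family of tangent vectors which moves with velocity `v` and
covariant derivatives `W i`. -/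
def frameCoordDeriv (x : M) (Y : FrameSpace E M ι) (v : TangentSpace 𝓘(ℝ, E) Y.1)
    (W : ι → TangentSpace 𝓘(ℝ, E) Y.1) : E × (ι → E) :=
  (chartCoord x Y.1 v, fun i => chartCoord x Y.1 (W i) -
    chartChristoffel x (extChartAt 𝓘(ℝ, E) x Y.1) (chartCoord x Y.1 v) (chartCoord x Y.1 (Y.2 i)))

/-- The moving family of tangent vectors `Y` has velocity `v` and covariant derivatives `W i` at
`t` within `s`. -/
def HasFrameDerivWithinAt (Y : ℝ → FrameSpace E M ι) (s : Set ℝ) (t : ℝ)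
    (v : TangentSpace 𝓘(ℝ, E) (Y t).1) (W : ι → TangentSpace 𝓘(ℝ, E) (Y t).1) : Prop :=
  ContinuousWithinAt (fun r => (Y r).1) s t ∧
    HasDerivWithinAt (fun r => frameCoord (Y t).1 (Y r)) (frameCoordDeriv (Y t).1 (Y t) v W) s t

/-- At a point that is not an accumulation point of `s` every vector is a derivative. This covers
the degenerate interval `[0, 0]` at the start of the propagation arguments. -/
lemma hasDerivWithinAt_of_not_uniqueDiffWithinAt {F : Type*} [NormedAddCommGroup F]
    [NormedSpace ℝ F] {f : ℝ → F} {s : Set ℝ} {t : ℝ} (hs : ¬UniqueDiffWithinAt ℝ s t) (f' : F) :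
    HasDerivWithinAt f f' s t := by
  rw [uniqueDiffWithinAt_iff_accPt] at hs
  exact HasFDerivWithinAt.of_not_accPt hs

lemma hasDerivWithinAt_fst {F G : Type*} [NormedAddCommGroup F] [NormedSpace ℝ F]
    [NormedAddCommGroup G] [NormedSpace ℝ G] {f : ℝ → F × G} {f' : F × G} {s : Set ℝ} {t : ℝ}
    (h : HasDerivWithinAt f f' s t) : HasDerivWithinAt (fun r => (f r).1) f'.1 s t := by
  simpa using h.hasFDerivWithinAt.fst.hasDerivWithinAt

lemma hasDerivWithinAt_snd {F G : Type*} [NormedAddCommGroup F] [NormedSpace ℝ F]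
    [NormedAddCommGroup G] [NormedSpace ℝ G] {f : ℝ → F × G} {f' : F × G} {s : Set ℝ} {t : ℝ}
    (h : HasDerivWithinAt f f' s t) : HasDerivWithinAt (fun r => (f r).2) f'.2 s t := by
  simpa using h.hasFDerivWithinAt.snd.hasDerivWithinAt

variable {Y : ℝ → FrameSpace E M ι} {s : Set ℝ} {t : ℝ} {v : TangentSpace 𝓘(ℝ, E) (Y t).1}
  {W : ι → TangentSpace 𝓘(ℝ, E) (Y t).1} {x : M}

lemma hasDerivWithinAt_frameCoord (hx : (Y t).1 ∈ (chartAt E x).source)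
    (hc : MDifferentiableWithinAt 𝓘(ℝ, ℝ) 𝓘(ℝ, E) (fun r => (Y r).1) s t)
    (hv : velocity (fun r => (Y r).1) s t = v)
    (hW : ∀ i, HasCovDerivWithinAt (fun r => (Y r).1) (fun r => (Y r).2 i) s t (W i)) :
    HasDerivWithinAt (fun r => frameCoord x (Y r)) (frameCoordDeriv x (Y t) v W) s t := by
  have h1 := hasDerivWithinAt_extChartAt_comp hx hc
  rw [hv] at h1
  refine h1.prodMk (hasDerivWithinAt_pi.2 fun i => ?_)
  have h2 := (hW i).hasDerivWithinAt_chartCoord hx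
  rwa [hv] at h2

lemma geometric_of_hasDerivWithinAt_frameCoord (hs : UniqueDiffWithinAt ℝ s t)
    (hx : (Y t).1 ∈ (chartAt E x).source) (hc : ContinuousWithinAt (fun r => (Y r).1) s t)
    (h : HasDerivWithinAt (fun r => frameCoord x (Y r)) (frameCoordDeriv x (Y t) v W) s t) :
    MDifferentiableWithinAt 𝓘(ℝ, ℝ) 𝓘(ℝ, E) (fun r => (Y r).1) s t ∧
      velocity (fun r => (Y r).1) s t = v ∧
      ∀ i, HasCovDerivWithinAt (fun r => (Y r).1) (fun r => (Y r).2 i) s t (W i) := by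
  have h1 : HasDerivWithinAt (fun r => extChartAt 𝓘(ℝ, E) x (Y r).1) (chartCoord x (Y t).1 v) s t :=
    hasDerivWithinAt_fst h
  have h2 : ∀ i, HasDerivWithinAt (fun r => chartCoord x (Y r).1 ((Y r).2 i))
      ((frameCoordDeriv x (Y t) v W).2 i) s t :=
    hasDerivWithinAt_pi.1 (hasDerivWithinAt_snd h)
  have hd := mdifferentiableWithinAt_of_chart hx hc h1
  have hv : velocity (fun r => (Y r).1) s t = v := by
    have h3 := chartCoord_velocity_of_chart hs hx hc h1
    rw [← chartVector_chartCoord hx v, ← h3, chartVector_chartCoord hx]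
  refine ⟨hd, hv, fun i => hasCovDerivWithinAt_of_chart hs hx hd ?_⟩
  rw [hv]
  exact h2 i

lemma hasFrameDerivWithinAt_iff (hs : UniqueDiffWithinAt ℝ s t) :
    HasFrameDerivWithinAt Y s t v W ↔
      MDifferentiableWithinAt 𝓘(ℝ, ℝ) 𝓘(ℝ, E) (fun r => (Y r).1) s t ∧
      velocity (fun r => (Y r).1) s t = v ∧
      ∀ i, HasCovDerivWithinAt (fun r => (Y r).1) (fun r => (Y r).2 i) s t (W i) :=
  ⟨fun h => geometric_of_hasDerivWithinAt_frameCoord hs (mem_chart_source E (Y t).1) h.1 h.2,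
    fun h => ⟨h.1.continuousWithinAt,
      hasDerivWithinAt_frameCoord (mem_chart_source E (Y t).1) h.1 h.2.1 h.2.2⟩⟩

/-- Where derivatives are unique, the chart is changed by passing through the invariant description;
otherwise both sides are automatic. Hence no uniqueness hypothesis is needed. -/
lemma hasFrameDerivWithinAt_iff_chart (hx : (Y t).1 ∈ (chartAt E x).source) :
    HasFrameDerivWithinAt Y s t v W ↔ ContinuousWithinAt (fun r => (Y r).1) s t ∧
      HasDerivWithinAt (fun r => frameCoord x (Y r)) (frameCoordDeriv x (Y t) v W) s t := by
  refine and_congr_right fun hc => ?_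
  by_cases hs : UniqueDiffWithinAt ℝ s t
  · refine ⟨fun h => ?_, fun h => ?_⟩
    · obtain ⟨h1, h2, h3⟩ :=
        geometric_of_hasDerivWithinAt_frameCoord hs (mem_chart_source E (Y t).1) hc h
      exact hasDerivWithinAt_frameCoord hx h1 h2 h3
    · obtain ⟨h1, h2, h3⟩ := geometric_of_hasDerivWithinAt_frameCoord hs hx hc h
      exact hasDerivWithinAt_frameCoord (mem_chart_source E (Y t).1) h1 h2 h3
  · exact ⟨fun _ => hasDerivWithinAt_of_not_uniqueDiffWithinAt hs _,
      fun _ => hasDerivWithinAt_of_not_uniqueDiffWithinAt hs _⟩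

lemma HasFrameDerivWithinAt.mono {s' : Set ℝ} (h : HasFrameDerivWithinAt Y s t v W)
    (hs : s' ⊆ s) : HasFrameDerivWithinAt Y s' t v W :=
  ⟨h.1.mono hs, h.2.mono hs⟩

lemma HasFrameDerivWithinAt.mono_of_mem {s' : Set ℝ} (h : HasFrameDerivWithinAt Y s t v W)
    (hs : s ∈ 𝓝[s'] t) : HasFrameDerivWithinAt Y s' t v W :=
  ⟨h.1.mono_of_mem_nhdsWithin hs, h.2.mono_of_mem_nhdsWithin hs⟩

lemma HasFrameDerivWithinAt.union {s' : Set ℝ} (h : HasFrameDerivWithinAt Y s t v W)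
    (h' : HasFrameDerivWithinAt Y s' t v W) : HasFrameDerivWithinAt Y (s ∪ s') t v W :=
  ⟨h.1.union h'.1, h.2.union h'.2⟩

/-- The moving family of tangent vectors `Y` solves, at `t` within `s`, the equations
`c' = ∑ bⱼ eⱼ` and `∇eᵢ = ∑ kᵢⱼ eⱼ` with coefficients `p = (b, k)`. -/
def FrameEquationAt (p : (ι → ℝ) × (ι → ι → ℝ)) (Y : ℝ → FrameSpace E M ι) (s : Set ℝ) (t : ℝ) :
    Prop :=
  HasFrameDerivWithinAt Y s t (∑ j, p.1 j • (Y t).2 j) (fun i => ∑ j, p.2 i j • (Y t).2 j)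

/-- The frame equations in the preferred chart at `x`. -/
def frameField (x : M) (q : ((ι → ℝ) × (ι → ι → ℝ)) × (E × (ι → E))) : E × (ι → E) :=
  (∑ j, q.1.1 j • q.2.2 j, fun i => ∑ j, q.1.2 i j • q.2.2 j -
    chartChristoffel x q.2.1 (∑ j, q.1.1 j • q.2.2 j) (q.2.2 i))

lemma frameCoordDeriv_eq_frameField (x : M) (Y : FrameSpace E M ι)
    (p : (ι → ℝ) × (ι → ι → ℝ)) :
    frameCoordDeriv x Y (∑ j, p.1 j • Y.2 j) (fun i => ∑ j, p.2 i j • Y.2 j) =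
      frameField x (p, frameCoord x Y) := by
  simp only [frameCoordDeriv, frameField, frameCoord, map_sum, map_smul]

lemma frameEquationAt_iff_chart {p : (ι → ℝ) × (ι → ι → ℝ)}
    (hx : (Y t).1 ∈ (chartAt E x).source) :
    FrameEquationAt p Y s t ↔ ContinuousWithinAt (fun r => (Y r).1) s t ∧
      HasDerivWithinAt (fun r => frameCoord x (Y r)) (frameField x (p, frameCoord x (Y t))) s t :=
    by
  rw [FrameEquationAt, hasFrameDerivWithinAt_iff_chart hx, frameCoordDeriv_eq_frameField]

lemma FrameEquationAt.mono {p : (ι → ℝ) × (ι → ι → ℝ)} {s' : Set ℝ}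
    (h : FrameEquationAt p Y s t) (hs : s' ⊆ s) : FrameEquationAt p Y s' t :=
  HasFrameDerivWithinAt.mono h hs

lemma FrameEquationAt.congr {p : (ι → ℝ) × (ι → ι → ℝ)} {Y' : ℝ → FrameSpace E M ι}
    (h : FrameEquationAt p Y s t) (ht : t ∈ s) (hY : ∀ r ∈ s, Y' r = Y r) :
    FrameEquationAt p Y' s t := by
  have hx : (Y' t).1 ∈ (chartAt E (Y t).1).source := by
    rw [hY t ht]; exact mem_chart_source E _
  obtain ⟨h1, h2⟩ := (frameEquationAt_iff_chart (mem_chart_source E (Y t).1)).1 h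
  refine (frameEquationAt_iff_chart hx).2 ⟨h1.congr (fun r hr => by rw [hY r hr])
    (by rw [hY t ht]), ?_⟩
  rw [hY t ht]
  exact h2.congr (fun r hr => by rw [hY r hr]) (by rw [hY t ht])

/-- Concatenation of solutions of the frame equations. -/
lemma FrameEquationAt.concat {p : ℝ → (ι → ℝ) × (ι → ι → ℝ)} {Y Y' : ℝ → FrameSpace E M ι}
    {a b c : ℝ} (hb : b ∈ Icc a c) (h : ∀ t ∈ Icc a b, FrameEquationAt (p t) Y (Icc a b) t)
    (h' : ∀ t ∈ Icc b c, FrameEquationAt (p t) Y' (Icc b c) t) (hY : Y b = Y' b) :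
    ∀ t ∈ Icc a c, FrameEquationAt (p t) (fun t => if t ≤ b then Y t else Y' t) (Icc a c) t := by
  set Z : ℝ → FrameSpace E M ι := fun t => if t ≤ b then Y t else Y' t with hZ
  have h1 : ∀ t ∈ Icc a b, FrameEquationAt (p t) Z (Icc a b) t := fun t ht =>
    (h t ht).congr ht fun r hr => if_pos hr.2
  have h2 : ∀ t ∈ Icc b c, FrameEquationAt (p t) Z (Icc b c) t := fun t ht =>
    (h' t ht).congr ht fun r hr => by
      rcases eq_or_lt_of_le hr.1 with rfl | hlt
      · simp [hZ, hY]
      · exact if_neg (not_le.2 hlt)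
  intro t ht
  rcases lt_trichotomy t b with hlt | rfl | hlt
  · refine HasFrameDerivWithinAt.mono_of_mem (h1 t ⟨ht.1, hlt.le⟩) ?_
    filter_upwards [self_mem_nhdsWithin, mem_nhdsWithin_of_mem_nhds (Iio_mem_nhds hlt)]
      with r hr hr'
    exact ⟨hr.1, le_of_lt hr'⟩
  -- At the junction the one-sided equations combine to an equation within the union: the values
  -- agree, so both prescribe the same derivative.
  · rw [← Icc_union_Icc_eq_Icc hb.1 hb.2]
    exact HasFrameDerivWithinAt.union (h1 t (right_mem_Icc.2 hb.1)) (h2 t (left_mem_Icc.2 hb.2))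
  · refine HasFrameDerivWithinAt.mono_of_mem (h2 t ⟨hlt.le, ht.2⟩) ?_
    filter_upwards [self_mem_nhdsWithin, mem_nhdsWithin_of_mem_nhds (Ioi_mem_nhds hlt)]
      with r hr hr'
    exact ⟨le_of_lt hr', hr.2⟩

lemma contDiffAt_frameField {x : M} {p : (ι → ℝ) × (ι → ι → ℝ)} {w : E × (ι → E)}
    (hw : w.1 ∈ (extChartAt 𝓘(ℝ, E) x).target) :
    ContDiffAt ℝ ∞ (frameField (ι := ι) x) (p, w) := by
  have h1 : ContDiffAt ℝ ∞ (fun q : ((ι → ℝ) × (ι → ι → ℝ)) × (E × (ι → E)) =>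
      ∑ j, q.1.1 j • q.2.2 j) (p, w) := by fun_prop
  have h2 : ContDiffAt ℝ ∞ (fun q : ((ι → ℝ) × (ι → ι → ℝ)) × (E × (ι → E)) =>
      chartChristoffel x q.2.1) (p, w) :=
    (contDiffAt_chartChristoffel hw).comp (p, w) (f := fun q :
      ((ι → ℝ) × (ι → ι → ℝ)) × (E × (ι → E)) => q.2.1) (by fun_prop)
  refine h1.prodMk (contDiffAt_pi.2 fun i => ContDiffAt.sub (by fun_prop) ?_)
  exact (h2.clm_apply h1).clm_apply (by fun_prop)

/-- Solutions of the frame equations in a chart yield solutions on the manifold. -/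
lemma frameEquationAt_frameOfCoord {p : (ι → ℝ) × (ι → ι → ℝ)} {y : ℝ → E × (ι → E)}
    (hy : ∀ r ∈ s, (y r).1 ∈ (extChartAt 𝓘(ℝ, E) x).target) (ht : t ∈ s)
    (h : HasDerivWithinAt y (frameField x (p, y t)) s t) :
    FrameEquationAt p (fun r => frameOfCoord x (y r)) s t := by
  refine (frameEquationAt_iff_chart (x := x) (extChartAt_symm_mem_source (hy t ht))).2 ⟨?_, ?_⟩
  · refine ContinuousAt.comp_continuousWithinAt (f := fun r => (y r).1)
      (g := (extChartAt 𝓘(ℝ, E) x).symm) ?_ h.continuousWithinAt.fst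
    exact continuousAt_extChartAt_symm'' (hy t ht)
  · rw [frameCoord_frameOfCoord (hy t ht)]
    exact h.congr (fun r hr => frameCoord_frameOfCoord (hy r hr))
      (frameCoord_frameOfCoord (hy t ht))

end Frames

/-! ### Uniform time windows in a chart, and propagation over the interval. -/

section FrameWindows

open Set Metric
open scoped NNReal

/-- Continuous induction without closedness or openness hypotheses. The window about the supremum of
the good times reaches back to a good time and forward past the supremum, so the supremum is `L` and
is attained. -/
lemma forall_mem_Icc_of_local_propagation {L : ℝ} {P : ℝ → Prop} (h0 : P 0)
    (step : ∀ t₀ ∈ Icc 0 L, ∃ δ > 0, ∀ s ∈ Icc 0 t₀, t₀ - δ ≤ s → P s →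
      ∀ t ∈ Icc s L, t ≤ t₀ + δ → P t) : ∀ t ∈ Icc 0 L, P t := by
  intro t₁ ht₁
  set T : Set ℝ := {t | t ∈ Icc 0 L ∧ ∀ r ∈ Icc 0 t, P r} with hT
  have hL : 0 ≤ L := ht₁.1.trans ht₁.2
  have h0T : (0 : ℝ) ∈ T := ⟨⟨le_rfl, hL⟩, fun r hr => by rwa [le_antisymm hr.2 hr.1]⟩
  have hbdd : BddAbove T := ⟨L, fun t ht => ht.1.2⟩
  have hsup : sSup T ∈ Icc 0 L := ⟨le_csSup hbdd h0T, csSup_le ⟨0, h0T⟩ fun t ht => ht.1.2⟩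
  obtain ⟨δ, hδ, h⟩ := step _ hsup
  -- A good time inside the window, at most `δ` before the supremum, from which to propagate.
  obtain ⟨s, hs, hlt⟩ := exists_lt_of_lt_csSup ⟨0, h0T⟩ (show sSup T - δ < sSup T by linarith)
  have hs' : s ≤ sSup T := le_csSup hbdd hs
  have hP : ∀ r ∈ Icc 0 (min (sSup T + δ) L), P r := by
    intro r hr
    rcases le_total r s with hrs | hrs
    · exact hs.2 r ⟨hr.1, hrs⟩
    · exact h s ⟨hs.1.1, hs'⟩ hlt.le (hs.2 s ⟨hs.1.1, le_rfl⟩) r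
        ⟨hrs, hr.2.trans (min_le_right _ _)⟩ (hr.2.trans (min_le_left _ _))
  have hmem : min (sSup T + δ) L ∈ T :=
    ⟨⟨le_min (by linarith [hsup.1]) hL, min_le_right _ _⟩, hP⟩
  have hle := le_csSup hbdd hmem
  refine hP t₁ ⟨ht₁.1, ht₁.2.trans (le_min ?_ le_rfl)⟩
  rcases min_le_iff.1 hle with h1 | h1 <;> linarith

variable {E : Type*} [NormedAddCommGroup E] [NormedSpace ℝ E] [FiniteDimensional ℝ E]
  {M : Type*} [TopologicalSpace M] [ChartedSpace E M] [IsManifold 𝓘(ℝ, E) ∞ M]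
  {ι : Type*} [Fintype ι]
  [RiemannianBundle (fun x : M => TangentSpace 𝓘(ℝ, E) x)]
  [IsContMDiffRiemannianBundle 𝓘(ℝ, E) ∞ E (fun x : M => TangentSpace 𝓘(ℝ, E) x)]

/-- The derivative of the frame equations, in the chart at `x`, with respect to the coordinates. -/
def frameFieldDeriv (x : M) (p : (ι → ℝ) × (ι → ι → ℝ)) (w : E × (ι → E)) :
    E × (ι → E) →L[ℝ] E × (ι → E) :=
  (fderiv ℝ (frameField x) (p, w)).comp
    (ContinuousLinearMap.inr ℝ ((ι → ℝ) × (ι → ι → ℝ)) (E × (ι → E)))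

/-- The frame equations with coefficients `p` are uniformly regular for times in
`[t₀ - δ, t₀ + δ]` and coordinates, in the chart at `x`, in the closed ball of radius `a`. -/
structure FrameWindow (p : ℝ → (ι → ℝ) × (ι → ι → ℝ)) (x : M) (w₀ : E × (ι → E)) (t₀ δ a : ℝ)
    (K : ℝ≥0) : Prop where
  pos : 0 < δ
  radius_pos : 0 < a
  mem_target : ∀ w ∈ closedBall w₀ a, w.1 ∈ (extChartAt 𝓘(ℝ, E) x).target
  mul_le : K * (2 * δ) ≤ a / 2
  mul_le_half : K * (2 * δ) ≤ 1 / 2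
  regular : RegularField (fun t w => frameField x (p t, w)) (fun t w => frameFieldDeriv x (p t) w)
    (Icc (t₀ - δ) (t₀ + δ)) (closedBall w₀ a) K

lemma exists_frameWindow {p : ℝ → (ι → ℝ) × (ι → ι → ℝ)} (hp : Continuous p) (x : M)
    {w₀ : E × (ι → E)} (hw : w₀.1 ∈ (extChartAt 𝓘(ℝ, E) x).target) (t₀ : ℝ) :
    ∃ δ a K, FrameWindow p x w₀ t₀ δ a K := by
  have hF : ContDiffAt ℝ 2 (frameField (ι := ι) x) (p t₀, w₀) :=
    (contDiffAt_frameField hw).of_le ENat.LEInfty.out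
  have hU : {w : E × (ι → E) | w.1 ∈ (extChartAt 𝓘(ℝ, E) x).target} ∈ 𝓝 w₀ :=
    continuous_fst.continuousAt.preimage_mem_nhds ((isOpen_extChartAt_target x).mem_nhds hw)
  obtain ⟨δ, hδ, a, ha, K, h1, h2, h3, h4⟩ := exists_regularField hp hF hU
  exact ⟨δ, a, K, hδ, ha, h1, h2, h3, h4⟩

/-- Needed because the window must also be short enough for a given solution to remain in the half
ball, while the radius and the constant are kept. -/
lemma FrameWindow.shrink {p : ℝ → (ι → ℝ) × (ι → ι → ℝ)} {x : M} {w₀ : E × (ι → E)}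
    {t₀ δ a : ℝ} {K : ℝ≥0} (h : FrameWindow p x w₀ t₀ δ a K) {δ' : ℝ} (hδ' : 0 < δ')
    (hle : δ' ≤ δ) : FrameWindow p x w₀ t₀ δ' a K where
  pos := hδ'
  radius_pos := h.radius_pos
  mem_target := h.mem_target
  mul_le := le_trans (by gcongr) h.mul_le
  mul_le_half := le_trans (by gcongr) h.mul_le_half
  regular := h.regular.mono (Icc_subset_Icc (by linarith) (by linarith))

variable {p : ℝ → (ι → ℝ) × (ι → ι → ℝ)} {x : M} {w₀ : E × (ι → E)} {t₀ δ a : ℝ} {K : ℝ≥0}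

lemma FrameWindow.exists_solution (h : FrameWindow p x w₀ t₀ δ a K) {s : ℝ}
    (hs : s ∈ Icc (t₀ - δ) (t₀ + δ)) {w : E × (ι → E)} (hw : w ∈ closedBall w₀ (a / 2)) :
    ∃ Y : ℝ → FrameSpace E M ι, Y s = frameOfCoord x w ∧ ∀ t ∈ Icc (t₀ - δ) (t₀ + δ),
      FrameEquationAt (p t) Y (Icc (t₀ - δ) (t₀ + δ)) t := by
  obtain ⟨y, hy, hsol⟩ := h.regular.exists_solution
    (by convert h.mul_le using 2; ring) h.radius_pos.le hs hw
  exact ⟨fun r => frameOfCoord x (y r), congrArg (frameOfCoord x) hy, fun t ht =>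
    frameEquationAt_frameOfCoord (fun r hr => h.mem_target _ (hsol r hr).2) ht (hsol t ht).1⟩

/-- Solutions of the frame equations which start near the centre of the window stay in it. -/
lemma FrameWindow.stays [T2Space M] (h : FrameWindow p x w₀ t₀ δ a K) {Y : ℝ → FrameSpace E M ι}
    {s b : ℝ} (hsb : Icc s b ⊆ Icc (t₀ - δ) (t₀ + δ))
    (hY : ∀ t ∈ Icc s b, FrameEquationAt (p t) Y (Icc s b) t)
    (hx : (Y s).1 ∈ (chartAt E x).source) (hw : frameCoord x (Y s) ∈ ball w₀ (a / 2)) :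
    ∀ t ∈ Icc s b, (Y t).1 ∈ (chartAt E x).source ∧ frameCoord x (Y t) ∈ closedBall w₀ a := by
  rcases lt_or_ge b s with hbs | hle
  · intro t ht; exact absurd (ht.1.trans ht.2) (not_le.2 hbs)
  have hKbs : K * (b - s) ≤ a / 2 := by
    refine le_trans ?_ h.mul_le
    gcongr
    linarith [(hsb (left_mem_Icc.2 hle)).1, (hsb (right_mem_Icc.2 hle)).2]
  -- Closed-open argument. The speed bound `K` is built into the set, so that at its points the
  -- solution lies in the open ball of radius `a`, which leaves room to continue.
  set S : Set ℝ := {t | (Y t).1 ∈ (chartAt E x).source ∧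
    dist (frameCoord x (Y t)) (frameCoord x (Y s)) ≤ K * (t - s)} with hS
  have hball : ∀ t ∈ S ∩ Icc s b, frameCoord x (Y t) ∈ ball w₀ a := by
    intro t ht
    rw [mem_ball] at hw ⊢
    have h1 := dist_triangle (frameCoord x (Y t)) (frameCoord x (Y s)) w₀
    have h2 : (K : ℝ) * (t - s) ≤ K * (b - s) := by gcongr; exact ht.2.2
    linarith [ht.1.2]
  have hcont : ∀ t ∈ Icc s b, (Y t).1 ∈ (chartAt E x).source →
      ContinuousWithinAt (fun r => frameCoord x (Y r)) (Icc s b) t := fun t ht hxt =>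
    ((frameEquationAt_iff_chart hxt).1 (hY t ht)).2.continuousWithinAt
  have hclosed : IsClosed (S ∩ Icc s b) := by
    refine isClosed_of_closure_subset fun t ht => ?_
    have htI : t ∈ Icc s b := closure_minimal inter_subset_right isClosed_Icc ht
    -- The only way to leave the chart is for the base point to leave the chart domain. It remains
    -- in the compact image of a closed coordinate ball, which is closed since `M` is Hausdorff, so
    -- limits stay in the domain.
    have hcomp : IsCompact ((extChartAt 𝓘(ℝ, E) x).symm '' (closedBall w₀.1 a)) := by
      refine (isCompact_closedBall _ _).image_of_continuousOn
        ((continuousOn_extChartAt_symm x).mono fun z hz => ?_)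
      refine h.mem_target (z, w₀.2) ?_
      rw [mem_closedBall, Prod.dist_eq, dist_self]
      exact max_le hz h.radius_pos.le
    have hxt : (Y t).1 ∈ (chartAt E x).source := by
      have h1 := ((hY t htI).1.mono inter_subset_right).mem_closure ht
        (t := (extChartAt 𝓘(ℝ, E) x).symm '' (closedBall w₀.1 a)) (fun r hr => by
          refine ⟨(frameCoord x (Y r)).1, ?_, extChartAt_left_inv hr.1.1⟩
          have h2 := ball_subset_closedBall (hball r hr)
          rw [mem_closedBall, Prod.dist_eq] at h2
          exact (le_max_left _ _).trans h2)
      rw [hcomp.isClosed.closure_eq] at h1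
      obtain ⟨z, hz, hzt⟩ := h1
      rw [← hzt]
      refine extChartAt_symm_mem_source (h.mem_target (z, w₀.2) ?_)
      rw [mem_closedBall, Prod.dist_eq, dist_self]
      exact max_le hz h.radius_pos.le
    refine ⟨⟨hxt, ?_⟩, htI⟩
    have h1 : ContinuousWithinAt (fun r => dist (frameCoord x (Y r)) (frameCoord x (Y s)) -
        K * (r - s)) (S ∩ Icc s b) t :=
      (((hcont t htI hxt).mono inter_subset_right).dist continuousWithinAt_const).sub
        (Continuous.continuousWithinAt (by fun_prop))
    have h2 := h1.mem_closure ht (t := Iic 0) fun r hr => by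
      rw [mem_Iic]; linarith [hr.1.2]
    rw [isClosed_Iic.closure_eq, mem_Iic] at h2
    linarith
  have hsub : Icc s b ⊆ S := by
    refine hclosed.Icc_subset_of_forall_exists_gt ⟨hx, by simp⟩ ?_
    intro t ht r hr
    have htI : t ∈ Icc s b := Ico_subset_Icc_self ht.2
    have hev : ∀ᶠ r in 𝓝[Icc s b] t, (Y r).1 ∈ (chartAt E x).source ∧
        frameCoord x (Y r) ∈ ball w₀ a :=
      Filter.Eventually.and
        ((hY t htI).1.preimage_mem_nhdsWithin ((chartAt E x).open_source.mem_nhds ht.1.1))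
        ((hcont t htI ht.1.1).preimage_mem_nhdsWithin (isOpen_ball.mem_nhds (hball t ⟨ht.1, htI⟩)))
    have hev' : ∀ᶠ r in 𝓝[≥] t, (Y r).1 ∈ (chartAt E x).source ∧
        frameCoord x (Y r) ∈ ball w₀ a := by
      refine hev.filter_mono ?_
      rw [← nhdsWithin_Icc_eq_nhdsGE ht.2.2]
      exact nhdsWithin_mono _ (Icc_subset_Icc_left ht.2.1)
    obtain ⟨u, hu, hsubu⟩ := mem_nhdsGE_iff_exists_Icc_subset.1 hev'
    set q := min (min u b) r with hq
    have htq : t < q := lt_min (lt_min hu ht.2.2) hr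
    have hqu : q ≤ u := (min_le_left _ _).trans (min_le_left _ _)
    have hqb : q ≤ b := (min_le_left _ _).trans (min_le_right _ _)
    have hIq : Icc t q ⊆ Icc s b := Icc_subset_Icc ht.2.1 hqb
    have hin : ∀ r ∈ Icc t q, (Y r).1 ∈ (chartAt E x).source ∧ frameCoord x (Y r) ∈ ball w₀ a :=
      fun r hr => hsubu ⟨hr.1, hr.2.trans hqu⟩
    -- On a short interval to the right the equation holds in the chart, so the mean value
    -- inequality extends the bound `K * (t - s)`.
    have hmv := (convex_Icc t q).norm_image_sub_le_of_norm_hasDerivWithin_le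
      (f := fun r => frameCoord x (Y r)) (C := K)
      (fun r hr => ((frameEquationAt_iff_chart (hin r hr).1).1 (hY r (hIq hr))).2.mono hIq)
      (fun r hr => h.regular.norm_le r (hsb (hIq hr)) _ (ball_subset_closedBall (hin r hr).2))
      (left_mem_Icc.2 htq.le) (right_mem_Icc.2 htq.le)
    refine ⟨q, ⟨(hin q (right_mem_Icc.2 htq.le)).1, ?_⟩, htq, min_le_right _ _⟩
    refine (dist_triangle _ (frameCoord x (Y t)) _).trans ?_
    rw [← dist_eq_norm, Real.norm_of_nonneg (by linarith)] at hmv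
    linarith [ht.1.2]
  exact fun t ht => ⟨(hsub ht).1, ball_subset_closedBall (hball t ⟨hsub ht, ht⟩)⟩

/-- Solutions of the frame equations depend differentiably on a parameter at `0` if their initial
values do, and the derivative solves the linearized equations. -/
lemma FrameWindow.hasDerivAt_parameter [T2Space M] (h : FrameWindow p x w₀ t₀ δ a K)
    {Y : ℝ → ℝ → FrameSpace E M ι} {s b : ℝ} (hle : s ≤ b)
    (hsb : Icc s b ⊆ Icc (t₀ - δ) (t₀ + δ))
    (hY : ∀ᶠ τ in 𝓝 (0 : ℝ), ∀ t ∈ Icc s b, FrameEquationAt (p t) (Y τ) (Icc s b) t)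
    (hx : (Y 0 s).1 ∈ (chartAt E x).source) (hw : frameCoord x (Y 0 s) ∈ ball w₀ (a / 2))
    {ζ : E × (ι → E)} (hc : ContinuousAt (fun τ => (Y τ s).1) 0)
    (hζ : HasDerivAt (fun τ => frameCoord x (Y τ s)) ζ 0) :
    ∃ z : ℝ → E × (ι → E), z s = ζ ∧ (∀ t ∈ Icc s b, HasDerivWithinAt z
      (frameFieldDeriv x (p t) (frameCoord x (Y 0 t)) (z t)) (Icc s b) t) ∧
      ∀ t ∈ Icc s b, (Y 0 t).1 ∈ (chartAt E x).source ∧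
        ContinuousAt (fun τ => (Y τ t).1) 0 ∧ HasDerivAt (fun τ => frameCoord x (Y τ t)) (z t) 0 :=
    by
  have hreg := h.regular.mono hsb
  -- For small `τ` the initial values lie in the half ball, so all these solutions share one chart
  -- and one set of estimates up to `b`.
  have hstays : ∀ᶠ τ in 𝓝 (0 : ℝ), ∀ t ∈ Icc s b, (Y τ t).1 ∈ (chartAt E x).source ∧
      frameCoord x (Y τ t) ∈ closedBall w₀ a := by
    filter_upwards [hY, hc.preimage_mem_nhds ((chartAt E x).open_source.mem_nhds hx),
      hζ.continuousAt.preimage_mem_nhds (isOpen_ball.mem_nhds hw)] with τ h1 h2 h3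
    exact h.stays hsb h1 h2 h3
  have hsol : ∀ᶠ τ in 𝓝 (0 : ℝ), ∀ t ∈ Icc s b, HasDerivWithinAt (fun t => frameCoord x (Y τ t))
      (frameField x (p t, frameCoord x (Y τ t))) (Icc s b) t ∧
      frameCoord x (Y τ t) ∈ closedBall w₀ a := by
    filter_upwards [hY, hstays] with τ h1 h2 t ht
    exact ⟨((frameEquationAt_iff_chart (h2 t ht).1).1 (h1 t ht)).2, (h2 t ht).2⟩
  have hsol0 := hsol.self_of_nhds
  have hA : ContinuousOn (fun t => frameFieldDeriv x (p t) (frameCoord x (Y 0 t))) (Icc s b) :=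
    hreg.continuousOn_deriv.comp
      (f := fun t => (t, frameCoord x (Y 0 t)))
      (continuousOn_id.prodMk fun t ht => (hsol0 t ht).1.continuousWithinAt)
      fun t ht => ⟨ht, (hsol0 t ht).2⟩
  obtain ⟨z, hz0, hz⟩ := exists_linear_solution (K := K) hle hA
    (fun t ht => hreg.norm_deriv_le t ht _ (hsol0 t ht).2)
    (le_trans (by
      gcongr
      linarith [(hsb (left_mem_Icc.2 hle)).1, (hsb (right_mem_Icc.2 hle)).2]) h.mul_le_half) ζ
  have hd := hreg.hasDerivAt_parameter hsol hz (by rw [hz0]; exact hζ)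
  refine ⟨z, hz0, hz, fun t ht => ⟨(hstays.self_of_nhds t ht).1, ?_, hd t ht⟩⟩
  -- Continuity of the base point in `M` is recovered from its coordinates through the inverse
  -- chart; it is needed to restart in the next chart.
  have h1 : ContinuousAt (fun τ => (extChartAt 𝓘(ℝ, E) x).symm (frameCoord x (Y τ t)).1) 0 :=
    ContinuousAt.comp (f := fun τ => (frameCoord x (Y τ t)).1)
      (g := (extChartAt 𝓘(ℝ, E) x).symm)
      (continuousAt_extChartAt_symm'' (h.mem_target _ (hsol0 t ht).2)) (hd t ht).continuousAt.fst
  refine h1.congr ?_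
  filter_upwards [hstays] with τ hτ
  exact extChartAt_left_inv (hτ t ht).1

/-- Near each time there is a window around a given solution. -/
lemma exists_frameWindow_of_solution (hp : Continuous p) {Y : ℝ → FrameSpace E M ι} {s : Set ℝ}
    {t₀ : ℝ} (h : FrameEquationAt (p t₀) Y s t₀) :
    ∃ δ a K, FrameWindow p (Y t₀).1 (frameCoord (Y t₀).1 (Y t₀)) t₀ δ a K ∧
      ∀ t ∈ Icc (t₀ - δ) (t₀ + δ) ∩ s, (Y t).1 ∈ (chartAt E (Y t₀).1).source ∧
        frameCoord (Y t₀).1 (Y t) ∈ ball (frameCoord (Y t₀).1 (Y t₀)) (a / 2) := by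
  obtain ⟨δ, a, K, hwin⟩ := exists_frameWindow hp (Y t₀).1
    (w₀ := frameCoord (Y t₀).1 (Y t₀)) (extChartAt_mem_target (mem_chart_source E _)) t₀
  have hev : ∀ᶠ t in 𝓝[s] t₀, (Y t).1 ∈ (chartAt E (Y t₀).1).source ∧
      frameCoord (Y t₀).1 (Y t) ∈ ball (frameCoord (Y t₀).1 (Y t₀)) (a / 2) :=
    Filter.Eventually.and
      (h.1.preimage_mem_nhdsWithin ((chartAt E _).open_source.mem_nhds (mem_chart_source E _)))
      (h.2.continuousWithinAt.preimage_mem_nhdsWithin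
        (ball_mem_nhds _ (half_pos hwin.radius_pos)))
  obtain ⟨ε, hε, hball⟩ := Metric.mem_nhdsWithin_iff.1 hev
  refine ⟨min δ (ε / 2), a, K, hwin.shrink (lt_min hwin.pos (half_pos hε)) (min_le_left _ _),
    fun t ht => hball ⟨?_, ht.2⟩⟩
  have h1 : min δ (ε / 2) ≤ ε / 2 := min_le_right _ _
  rw [mem_ball, Real.dist_eq, abs_lt]
  constructor <;> linarith [ht.1.1, ht.1.2]

end FrameWindows

/-! ### The linearized frame equations in invariant form. -/

section FrameVariations

open Set Metric
open scoped NNReal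

variable {E : Type*} [NormedAddCommGroup E] [NormedSpace ℝ E] [FiniteDimensional ℝ E]
  {M : Type*} [TopologicalSpace M] [ChartedSpace E M] [IsManifold 𝓘(ℝ, E) ∞ M]
  {ι : Type*} [Fintype ι]
  [RiemannianBundle (fun x : M => TangentSpace 𝓘(ℝ, E) x)]
  [IsContMDiffRiemannianBundle 𝓘(ℝ, E) ∞ E (fun x : M => TangentSpace 𝓘(ℝ, E) x)]

/-- Both sides are the derivative at `0` of the field along the line `w + r • u`. -/
lemma frameFieldDeriv_apply {x : M} (p : (ι → ℝ) × (ι → ι → ℝ)) {w : E × (ι → E)}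
    (hw : w.1 ∈ (extChartAt 𝓘(ℝ, E) x).target) (u : E × (ι → E)) :
    frameFieldDeriv x p w u = (∑ j, p.1 j • u.2 j, fun i => ∑ j, p.2 i j • u.2 j -
      (chartChristoffelDeriv x w.1 u.1 (∑ j, p.1 j • w.2 j) (w.2 i) +
        chartChristoffel x w.1 (∑ j, p.1 j • u.2 j) (w.2 i) +
        chartChristoffel x w.1 (∑ j, p.1 j • w.2 j) (u.2 i))) := by
  have hl : HasDerivWithinAt (fun r : ℝ => w + r • u) u univ 0 := by
    simpa using ((hasDerivAt_id (0 : ℝ)).smul_const u).const_add w |>.hasDerivWithinAt (s := univ)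
  have hl1 := hasDerivWithinAt_fst hl
  have hl2 := hasDerivWithinAt_pi.1 (hasDerivWithinAt_snd hl)
  have h0 : w + (0 : ℝ) • u = w := by simp
  have hsum : ∀ c : ι → ℝ, HasDerivWithinAt (fun r : ℝ => ∑ j, c j • (w + r • u).2 j)
      (∑ j, c j • u.2 j) univ 0 := fun c =>
    HasDerivWithinAt.fun_sum fun j _ => (hl2 j).const_smul (c j)
  have h1 : HasDerivWithinAt (fun r : ℝ => frameField x (p, w + r • u))
      (∑ j, p.1 j • u.2 j, fun i => ∑ j, p.2 i j • u.2 j -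
      (chartChristoffelDeriv x w.1 u.1 (∑ j, p.1 j • w.2 j) (w.2 i) +
        chartChristoffel x w.1 (∑ j, p.1 j • u.2 j) (w.2 i) +
        chartChristoffel x w.1 (∑ j, p.1 j • w.2 j) (u.2 i))) univ 0 := by
    refine (hsum p.1).prodMk (hasDerivWithinAt_pi.2 fun i => (hsum (p.2 i)).sub ?_)
    have h2 := hasDerivWithinAt_chartChristoffel (x := x) (by rw [h0]; exact hw) hl1 (hsum p.1)
      (hl2 i)
    simpa only [h0] using h2
  have h2 : HasDerivWithinAt (fun r : ℝ => frameField x (p, w + r • u))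
      (frameFieldDeriv x p w u) univ 0 := by
    have hd := ((contDiffAt_frameField (x := x) (p := p) hw).differentiableAt
      (by simp)).hasFDerivAt
    have h3 : HasFDerivAt (fun w => frameField x (p, w)) (frameFieldDeriv x p w) w :=
      hd.comp w (hasFDerivAt_prodMk_right p w)
    rw [← h0] at h3
    have h4 := h3.comp_hasDerivWithinAt (l := fun w => frameField x (p, w)) (0 : ℝ) hl
    rwa [h0] at h4
  exact uniqueDiffWithinAt_univ.eq_deriv _ h2 h1

/-- The velocity of a moving family of tangent vectors with coordinate derivative `z`. -/
def frameVelocity (x : M) (Y : FrameSpace E M ι) (z : E × (ι → E)) : TangentSpace 𝓘(ℝ, E) Y.1 :=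
  chartVector x Y.1 z.1

/-- The covariant derivatives of a moving family of tangent vectors with coordinate derivative
`z`. -/
def frameCovDeriv (x : M) (Y : FrameSpace E M ι) (z : E × (ι → E)) (i : ι) :
    TangentSpace 𝓘(ℝ, E) Y.1 :=
  chartVector x Y.1 (z.2 i +
    chartChristoffel x (extChartAt 𝓘(ℝ, E) x Y.1) z.1 (chartCoord x Y.1 (Y.2 i)))

lemma frameCoordDeriv_frameVelocity {x : M} {Y : FrameSpace E M ι}
    (hx : Y.1 ∈ (chartAt E x).source) (z : E × (ι → E)) :
    frameCoordDeriv x Y (frameVelocity x Y z) (frameCovDeriv x Y z) = z := by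
  refine Prod.ext (chartCoord_chartVector hx _) (funext fun i => ?_)
  simp only [frameCoordDeriv, frameVelocity, frameCovDeriv, chartCoord_chartVector hx,
    add_sub_cancel_right]

lemma HasFrameDerivWithinAt.unique {Y : ℝ → FrameSpace E M ι} {s : Set ℝ} {t : ℝ}
    {v v' : TangentSpace 𝓘(ℝ, E) (Y t).1} {W W' : ι → TangentSpace 𝓘(ℝ, E) (Y t).1}
    (hs : UniqueDiffWithinAt ℝ s t) (h : HasFrameDerivWithinAt Y s t v W)
    (h' : HasFrameDerivWithinAt Y s t v' W') : v = v' ∧ W = W' := by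
  obtain ⟨_, h1, h2⟩ := (hasFrameDerivWithinAt_iff hs).1 h
  obtain ⟨_, h3, h4⟩ := (hasFrameDerivWithinAt_iff hs).1 h'
  exact ⟨h1.symm.trans h3, funext fun i => (h2 i).unique hs (h4 i)⟩

section Linearization

variable {p : (ι → ℝ) × (ι → ι → ℝ)} {Y : ℝ → FrameSpace E M ι} {J : Set ℝ} {t : ℝ} {x : M}
  {z : ℝ → E × (ι → E)}

/-- This is `∇_T X = ∇_τ c'`: since the coefficients do not depend on `τ`, the right side is the
same combination of the transverse derivatives. The identity is the first component of the
linearized equation, and torsion-freeness enters as symmetry of the Christoffel symbols. -/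
lemma hasCovDerivWithinAt_frameVelocity (hJ : UniqueDiffWithinAt ℝ J t) (ht : t ∈ J)
    (hx : ∀ r ∈ J, (Y r).1 ∈ (chartAt E x).source) (hY : FrameEquationAt p Y J t)
    (hz : HasDerivWithinAt z (frameFieldDeriv x p (frameCoord x (Y t)) (z t)) J t) :
    HasCovDerivWithinAt (fun r => (Y r).1) (fun r => frameVelocity x (Y r) (z r)) J t
      (∑ j, p.1 j • frameCovDeriv x (Y t) (z t) j) := by
  have hxt := hx t ht
  have htar := extChartAt_mem_target hxt
  obtain ⟨hd, hv, -⟩ := (hasFrameDerivWithinAt_iff hJ).1 hY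
  refine hasCovDerivWithinAt_of_chart hJ hxt hd ?_
  rw [hv]
  have h1 := hasDerivWithinAt_fst hz
  rw [frameFieldDeriv_apply p (by exact htar)] at h1
  have hcv : ∀ r ∈ J, chartCoord x (Y r).1 (frameVelocity x (Y r) (z r)) = (z r).1 :=
    fun r hr => chartCoord_chartVector (hx r hr) _
  refine (h1.congr hcv (hcv t ht)).congr_deriv ?_
  rw [hcv t ht]
  simp only [frameCovDeriv, map_sum, map_smul, chartCoord_chartVector hxt, smul_add,
    Finset.sum_add_distrib]
  simp only [← map_smul, ← map_sum]
  rw [chartChristoffel_symm htar (z t).1]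
  simp

/-- This is `∇_T ∇_τ eᵢ = R(T, X) eᵢ + ∇_τ ∇_T eᵢ`, obtained without mixed derivatives.
Differentiating the Christoffel term of the transverse derivative along the curve and inserting the
linearized equation leaves exactly the curvature in coordinates. -/
lemma hasCovDerivWithinAt_frameCovDeriv (hJ : UniqueDiffWithinAt ℝ J t) (ht : t ∈ J)
    (hx : ∀ r ∈ J, (Y r).1 ∈ (chartAt E x).source) (hY : FrameEquationAt p Y J t)
    (hz : HasDerivWithinAt z (frameFieldDeriv x p (frameCoord x (Y t)) (z t)) J t) (i : ι) :
    HasCovDerivWithinAt (fun r => (Y r).1) (fun r => frameCovDeriv x (Y r) (z r) i) J t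
      (curvature (Y t).1 (∑ j, p.1 j • (Y t).2 j) (frameVelocity x (Y t) (z t)) ((Y t).2 i) +
        ∑ j, p.2 i j • frameCovDeriv x (Y t) (z t) j) := by
  have hxt := hx t ht
  have htar := extChartAt_mem_target hxt
  obtain ⟨hd, hv, -⟩ := (hasFrameDerivWithinAt_iff hJ).1 hY
  refine hasCovDerivWithinAt_of_chart hJ hxt hd ?_
  rw [hv]
  have hf := ((frameEquationAt_iff_chart hxt).1 hY).2
  have hf1 := hasDerivWithinAt_fst hf
  have hf2 := hasDerivWithinAt_pi.1 (hasDerivWithinAt_snd hf) i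
  have h1 := hasDerivWithinAt_fst hz
  have h2 := hasDerivWithinAt_pi.1 (hasDerivWithinAt_snd hz) i
  rw [frameFieldDeriv_apply p (by exact htar)] at h1 h2
  have hcv : ∀ r ∈ J, chartCoord x (Y r).1 (frameCovDeriv x (Y r) (z r) i) = (z r).2 i +
      chartChristoffel x (extChartAt 𝓘(ℝ, E) x (Y r).1) (z r).1
        (chartCoord x (Y r).1 ((Y r).2 i)) :=
    fun r hr => chartCoord_chartVector (hx r hr) _
  have h3 := h2.add (hasDerivWithinAt_chartChristoffel (x := x) htar hf1 h1 hf2)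
  refine (h3.congr hcv (hcv t ht)).congr_deriv ?_
  rw [hcv t ht, map_add, chartCoord_curvature hxt, curvatureCoord]
  have hvel : chartCoord x (Y t).1 (frameVelocity x (Y t) (z t)) = (z t).1 :=
    chartCoord_chartVector hxt _
  have hsum : ∀ c : ι → ℝ, chartCoord x (Y t).1 (∑ j, c j • (Y t).2 j) =
      ∑ j, c j • chartCoord x (Y t).1 ((Y t).2 j) := fun c => by simp only [map_sum, map_smul]
  have hsum' : chartCoord x (Y t).1 (∑ j, p.2 i j • frameCovDeriv x (Y t) (z t) j) =
      ∑ j, p.2 i j • (z t).2 j + chartChristoffel x (extChartAt 𝓘(ℝ, E) x (Y t).1) (z t).1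
        (∑ j, p.2 i j • chartCoord x (Y t).1 ((Y t).2 j)) := by
    simp only [frameCovDeriv, map_sum, map_smul, chartCoord_chartVector hxt, smul_add,
      Finset.sum_add_distrib]
  rw [hsum', hvel, hsum]
  simp only [frameField, frameCoord, map_sub, map_add]
  abel

end Linearization

variable {p : ℝ → (ι → ℝ) × (ι → ι → ℝ)} {Y : ℝ → ℝ → FrameSpace E M ι}

lemma hasFrameDerivWithinAt_of_hasDerivAt {Y : ℝ → FrameSpace E M ι} {x : M} {z : E × (ι → E)}
    {t : ℝ} (hx : (Y t).1 ∈ (chartAt E x).source) (hc : ContinuousAt (fun r => (Y r).1) t)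
    (hz : HasDerivAt (fun r => frameCoord x (Y r)) z t) :
    HasFrameDerivWithinAt Y univ t (frameVelocity x (Y t) z) (frameCovDeriv x (Y t) z) := by
  refine (hasFrameDerivWithinAt_iff_chart hx).2 ⟨hc.continuousWithinAt, ?_⟩
  rw [frameCoordDeriv_frameVelocity hx]
  exact hz.hasDerivWithinAt

lemma HasFrameDerivWithinAt.hasDerivAt {Y : ℝ → FrameSpace E M ι} {x : M} {t : ℝ}
    {v : TangentSpace 𝓘(ℝ, E) (Y t).1} {W : ι → TangentSpace 𝓘(ℝ, E) (Y t).1}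
    (h : HasFrameDerivWithinAt Y univ t v W) (hx : (Y t).1 ∈ (chartAt E x).source) :
    ContinuousAt (fun r => (Y r).1) t ∧
      HasDerivAt (fun r => frameCoord x (Y r)) (frameCoordDeriv x (Y t) v W) t := by
  have := (hasFrameDerivWithinAt_iff_chart hx).1 h
  rwa [continuousWithinAt_univ, hasDerivWithinAt_univ] at this

/-- The variation field and the transverse derivatives of a family of solutions of the frame
equations exist if they exist initially, and satisfy the linearized equations. -/
theorem exists_frameVariation [T2Space M] {L : ℝ} (hL : 0 < L) (hp : Continuous p)
    (hY : ∀ᶠ τ in 𝓝 (0 : ℝ), ∀ t ∈ Icc 0 L, FrameEquationAt (p t) (Y τ) (Icc 0 L) t)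
    {v : TangentSpace 𝓘(ℝ, E) (Y 0 0).1} {W : ι → TangentSpace 𝓘(ℝ, E) (Y 0 0).1}
    (h0 : HasFrameDerivWithinAt (fun τ => Y τ 0) univ 0 v W) :
    ∃ (X : ∀ t, TangentSpace 𝓘(ℝ, E) (Y 0 t).1) (D : ∀ t, ι → TangentSpace 𝓘(ℝ, E) (Y 0 t).1),
      ∀ t ∈ Icc 0 L, HasFrameDerivWithinAt (fun τ => Y τ t) univ 0 (X t) (D t) ∧
        HasCovDerivWithinAt (fun r => (Y 0 r).1) X (Icc 0 L) t (∑ j, (p t).1 j • D t j) ∧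
        ∀ i, HasCovDerivWithinAt (fun r => (Y 0 r).1) (fun r => D r i) (Icc 0 L) t
          (curvature (Y 0 t).1 (∑ j, (p t).1 j • (Y 0 t).2 j) (X t) ((Y 0 t).2 i) +
            ∑ j, (p t).2 i j • D t j) := by
  classical
  have hY0 := hY.self_of_nhds
  let P (t : ℝ) : Prop := ∃ (v : TangentSpace 𝓘(ℝ, E) (Y 0 t).1)
    (W : ι → TangentSpace 𝓘(ℝ, E) (Y 0 t).1), HasFrameDerivWithinAt (fun τ => Y τ t) univ 0 v W
  -- Differentiability in `τ` at one time of a window spreads to later times of the window, and the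
  -- derivative is represented there by a solution `z` of the linearized equation in one chart.
  have hlocal : ∀ t₀ ∈ Icc 0 L, ∃ δ > 0, ∀ s ∈ Icc 0 t₀, t₀ - δ ≤ s → P s →
      ∃ z : ℝ → E × (ι → E), ∀ t ∈ Icc s (min (t₀ + δ) L),
        (Y 0 t).1 ∈ (chartAt E (Y 0 t₀).1).source ∧ HasDerivWithinAt z
          (frameFieldDeriv (Y 0 t₀).1 (p t) (frameCoord (Y 0 t₀).1 (Y 0 t)) (z t))
          (Icc s (min (t₀ + δ) L)) t ∧
        HasFrameDerivWithinAt (fun τ => Y τ t) univ 0 (frameVelocity (Y 0 t₀).1 (Y 0 t) (z t))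
          (frameCovDeriv (Y 0 t₀).1 (Y 0 t) (z t)) := by
    intro t₀ ht₀
    obtain ⟨δ, a, K, hwin, hnear⟩ := exists_frameWindow_of_solution hp (hY0 t₀ ht₀)
    refine ⟨δ, hwin.pos, fun s hs hδs ⟨v, W, hvW⟩ => ?_⟩
    have hδ := hwin.pos
    have hle : s ≤ min (t₀ + δ) L := le_min (by linarith [hs.2]) (hs.2.trans ht₀.2)
    have hsub : Icc s (min (t₀ + δ) L) ⊆ Icc 0 L := Icc_subset_Icc hs.1 (min_le_right _ _)
    obtain ⟨hsx, hsw⟩ := hnear s ⟨⟨hδs, by linarith [hs.2]⟩, hsub (left_mem_Icc.2 hle)⟩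
    obtain ⟨hc, hζ⟩ := hvW.hasDerivAt hsx
    obtain ⟨z, -, hz, hall⟩ := hwin.hasDerivAt_parameter (Y := Y) hle
      (Icc_subset_Icc hδs (min_le_left _ _))
      (hY.mono fun τ hτ t ht => (hτ t (hsub ht)).mono hsub) hsx hsw hc hζ
    exact ⟨z, fun t ht => ⟨(hall t ht).1, hz t ht,
      hasFrameDerivWithinAt_of_hasDerivAt (hall t ht).1 (hall t ht).2.1 (hall t ht).2.2⟩⟩
  have hP : ∀ t ∈ Icc 0 L, P t := by
    refine forall_mem_Icc_of_local_propagation ⟨v, W, h0⟩ fun t₀ ht₀ => ?_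
    obtain ⟨δ, hδ, h⟩ := hlocal t₀ ht₀
    refine ⟨δ, hδ, fun s hs hδs hPs t ht htδ => ?_⟩
    obtain ⟨z, hz⟩ := h s hs hδs hPs
    exact ⟨_, _, (hz t ⟨ht.1, le_min htδ ht.2⟩).2.2⟩
  -- The derivatives in `τ` are chosen time by time; uniqueness below identifies them near each time
  -- with a local linearized solution. The value `0` occurs only where no derivative exists.
  let X (t : ℝ) : TangentSpace 𝓘(ℝ, E) (Y 0 t).1 := if h : P t then h.choose else 0
  let D (t : ℝ) : ι → TangentSpace 𝓘(ℝ, E) (Y 0 t).1 :=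
    if h : P t then h.choose_spec.choose else 0
  have hXD : ∀ t ∈ Icc 0 L, HasFrameDerivWithinAt (fun τ => Y τ t) univ 0 (X t) (D t) := by
    intro t ht
    have h := hP t ht
    simp only [X, D, dif_pos h]
    exact h.choose_spec.choose_spec
  refine ⟨X, D, fun t ht => ⟨hXD t ht, ?_⟩⟩
  obtain ⟨δ, hδ, h⟩ := hlocal t ht
  set s := max 0 (t - δ) with hs
  have hst : s ≤ t := max_le ht.1 (by linarith)
  have hs0 : 0 ≤ s := le_max_left _ _
  obtain ⟨z, hz⟩ := h s ⟨hs0, hst⟩ (le_max_right _ _)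
    (hP s ⟨hs0, hst.trans ht.2⟩)
  set J := Icc s (min (t + δ) L) with hJdef
  have hJL : J ⊆ Icc 0 L := Icc_subset_Icc hs0 (min_le_right _ _)
  have htJ : t ∈ J := ⟨hst, le_min (by linarith) ht.2⟩
  have hJnhds : J ∈ 𝓝[Icc 0 L] t := by
    filter_upwards [self_mem_nhdsWithin, mem_nhdsWithin_of_mem_nhds
      (Ioo_mem_nhds (show t - δ < t by linarith) (show t < t + δ by linarith))] with r hr hr'
    exact ⟨max_le hr.1 hr'.1.le, le_min hr'.2.le hr.2⟩
  have hJu : UniqueDiffWithinAt ℝ J t :=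
    (uniqueDiffOn_Icc hL t ht).mono_nhds (le_inf inf_le_left (by simpa using hJnhds))
  have hfield : FrameEquationAt (p t) (Y 0) J t := (hY0 t ht).mono hJL
  have hsrc : ∀ r ∈ J, (Y 0 r).1 ∈ (chartAt E (Y 0 t).1).source := fun r hr => (hz r hr).1
  have huniq : ∀ r ∈ J, X r = frameVelocity (Y 0 t).1 (Y 0 r) (z r) ∧
      D r = frameCovDeriv (Y 0 t).1 (Y 0 r) (z r) := fun r hr =>
    HasFrameDerivWithinAt.unique (Y := fun τ => Y τ r) uniqueDiffWithinAt_univ (hXD r (hJL hr))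
      (hz r hr).2.2
  have hextend : ∀ {V : ∀ r, TangentSpace 𝓘(ℝ, E) (Y 0 r).1} {U : TangentSpace 𝓘(ℝ, E) (Y 0 t).1},
      HasCovDerivWithinAt (fun r => (Y 0 r).1) V J t U →
        HasCovDerivWithinAt (fun r => (Y 0 r).1) V (Icc 0 L) t U := by
    intro V U hV
    -- A single vector field is viewed as a family with one member in order to use the locality of
    -- frame derivatives.
    have h1 : HasFrameDerivWithinAt (ι := Unit) (fun r => ⟨(Y 0 r).1, fun _ => V r⟩) J t
        (velocity (fun r => (Y 0 r).1) J t) (fun _ => U) :=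
      (hasFrameDerivWithinAt_iff hJu).2 ⟨hV.1, rfl, fun _ => hV⟩
    exact ((hasFrameDerivWithinAt_iff (uniqueDiffOn_Icc hL t ht)).1
      (h1.mono_of_mem hJnhds)).2.2 ()
  refine ⟨hextend ?_, fun i => hextend ?_⟩
  · rw [(huniq t htJ).2]
    exact (hasCovDerivWithinAt_frameVelocity hJu htJ hsrc hfield (hz t htJ).2.1).congr htJ
      fun r hr => (huniq r hr).1
  · rw [(huniq t htJ).1, (huniq t htJ).2]
    exact (hasCovDerivWithinAt_frameCovDeriv hJu htJ hsrc hfield (hz t htJ).2.1 i).congr htJ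
      fun r hr => congrFun (huniq r hr).2 i

end FrameVariations

/-! ### From the derivatives of a frame to a tensor. -/

section FrameTensors

open Set
open scoped InnerProductSpace

section InnerProductSpace

variable {V : Type*} [NormedAddCommGroup V] [InnerProductSpace ℝ V]
  {ι : Type*} [Fintype ι] [Nonempty ι]

lemma Orthonormal.sum_inner_smul {e : ι → V} (he : Orthonormal ℝ e)
    (hcard : Module.finrank ℝ V = Fintype.card ι) (v : V) : ∑ i, ⟪e i, v⟫_ℝ • e i = v := by
  have h1 := ((basisOfOrthonormalOfCardEqFinrank he hcard.symm).toOrthonormalBasis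
    (by rwa [coe_basisOfOrthonormalOfCardEqFinrank])).sum_repr' v
  simpa only [Module.Basis.coe_toOrthonormalBasis, coe_basisOfOrthonormalOfCardEqFinrank] using h1

/-- The linear map which sends the orthonormal basis `e` to the family `D`. -/
def frameTensor (e D : ι → V) : V →L[ℝ] V := ∑ i, (innerSL ℝ (e i)).smulRight (D i)

lemma frameTensor_apply (e D : ι → V) (v : V) : frameTensor e D v = ∑ i, ⟪e i, v⟫_ℝ • D i := by
  simp [frameTensor]

lemma frameTensor_frame {e : ι → V} (he : Orthonormal ℝ e) (D : ι → V) (i : ι) :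
    frameTensor e D (e i) = D i := by
  classical
  rw [frameTensor_apply, Finset.sum_eq_single i]
  · rw [real_inner_self_eq_norm_sq, he.1 i]; simp
  · intro j _ hj
    rw [he.2 hj, zero_smul]
  · simp

/-- Skewness is bilinear, so it suffices to check it on the orthonormal basis, where it is the
hypothesis on `D`. -/
lemma inner_frameTensor_eq_neg {e D : ι → V} (he : Orthonormal ℝ e)
    (hcard : Module.finrank ℝ V = Fintype.card ι)
    (hD : ∀ i j, ⟪D i, e j⟫_ℝ + ⟪e i, D j⟫_ℝ = 0) (u v : V) :
    ⟪frameTensor e D u, v⟫_ℝ = -⟪u, frameTensor e D v⟫_ℝ := by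
  have h1 : ⟪frameTensor e D u, v⟫_ℝ = ∑ i, ∑ j, ⟪e i, u⟫_ℝ * ⟪e j, v⟫_ℝ * ⟪D i, e j⟫_ℝ := by
    rw [frameTensor_apply, sum_inner]
    refine Finset.sum_congr rfl fun i _ => ?_
    conv_lhs => rw [← he.sum_inner_smul hcard v]
    rw [inner_sum]
    refine Finset.sum_congr rfl fun j _ => ?_
    rw [real_inner_smul_left, real_inner_smul_right]
    ring
  have h2 : ⟪u, frameTensor e D v⟫_ℝ = ∑ i, ∑ j, ⟪e i, u⟫_ℝ * ⟪e j, v⟫_ℝ * ⟪e i, D j⟫_ℝ := by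
    conv_lhs => rw [← he.sum_inner_smul hcard u]
    rw [frameTensor_apply, sum_inner]
    refine Finset.sum_congr rfl fun i _ => ?_
    rw [inner_sum]
    refine Finset.sum_congr rfl fun j _ => ?_
    rw [real_inner_smul_left, real_inner_smul_right]
    ring
  rw [h1, h2, eq_neg_iff_add_eq_zero, ← Finset.sum_add_distrib]
  refine Finset.sum_eq_zero fun i _ => ?_
  rw [← Finset.sum_add_distrib]
  refine Finset.sum_eq_zero fun j _ => ?_
  rw [← mul_add, hD, mul_zero]

end InnerProductSpace

variable {E : Type*} [NormedAddCommGroup E] [NormedSpace ℝ E] [FiniteDimensional ℝ E]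
  {M : Type*} [TopologicalSpace M] [ChartedSpace E M] [IsManifold 𝓘(ℝ, E) ∞ M]
 
  {ι : Type*} [Fintype ι] [Nonempty ι]
  [RiemannianBundle (fun x : M => TangentSpace 𝓘(ℝ, E) x)]
  [IsContMDiffRiemannianBundle 𝓘(ℝ, E) ∞ E (fun x : M => TangentSpace 𝓘(ℝ, E) x)]

lemma chartCoord_injective {x y : M} (hy : y ∈ (chartAt E x).source) :
    Function.Injective (chartCoord (E := E) x y) := fun u v h => by
  rw [← chartVector_chartCoord hy u, h, chartVector_chartCoord hy]

/-- Linearity is not evident from the definition, which extends its arguments to fields; in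
coordinates each term of `curvatureCoord` is linear. -/
lemma curvature_sum_smul (y : M) (u v : TangentSpace 𝓘(ℝ, E) y) (c : ι → ℝ)
    (w : ι → TangentSpace 𝓘(ℝ, E) y) :
    curvature y u v (∑ i, c i • w i) = ∑ i, c i • curvature y u v (w i) := by
  have hy := mem_chart_source E y
  apply chartCoord_injective hy
  have hsum : ∀ a b : E, chartChristoffelDeriv y (extChartAt 𝓘(ℝ, E) y y) a b
      (∑ i, c i • chartCoord y y (w i)) = ∑ i, c i • chartChristoffelDeriv y
        (extChartAt 𝓘(ℝ, E) y y) a b (chartCoord y y (w i)) := fun a b => by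
    simp only [chartChristoffelDeriv, map_sum, map_smul]
  simp only [map_sum, map_smul, chartCoord_curvature hy, curvatureCoord]
  rw [hsum, hsum]
  simp only [← Finset.sum_sub_distrib, ← Finset.sum_add_distrib, smul_sub, smul_add]

lemma curvature_sum_smul_middle (y : M) (u : TangentSpace 𝓘(ℝ, E) y) (c : ι → ℝ)
    (v : ι → TangentSpace 𝓘(ℝ, E) y) (w : TangentSpace 𝓘(ℝ, E) y) :
    curvature y u (∑ i, c i • v i) w = ∑ i, c i • curvature y u (v i) w := by
  have hy := mem_chart_source E y
  apply chartCoord_injective hy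
  have hsum : ∀ a b : E, chartChristoffelDeriv y (extChartAt 𝓘(ℝ, E) y y) a
      (∑ i, c i • chartCoord y y (v i)) b = ∑ i, c i • chartChristoffelDeriv y
        (extChartAt 𝓘(ℝ, E) y y) a (chartCoord y y (v i)) b := fun a b => by
    simp only [chartChristoffelDeriv, map_sum, map_smul, sum_apply,
      smul_apply]
  have hsum' : ∀ a b : E, chartChristoffelDeriv y (extChartAt 𝓘(ℝ, E) y y)
      (∑ i, c i • chartCoord y y (v i)) a b = ∑ i, c i • chartChristoffelDeriv y
        (extChartAt 𝓘(ℝ, E) y y) (chartCoord y y (v i)) a b := fun a b => by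
    let L : E →ₗ[ℝ] E :=
      { toFun := fun a' => chartChristoffelDeriv y (extChartAt 𝓘(ℝ, E) y y) a' a b
        map_add' := fun a' a'' => chartChristoffelDeriv_add_left _ _ _ _ _ _
        map_smul' := fun r a' => chartChristoffelDeriv_smul_left _ _ _ _ _ _ }
    change L _ = ∑ i, c i • L _
    simp only [map_sum, map_smul]
  simp only [map_sum, map_smul, chartCoord_curvature hy, curvatureCoord]
  rw [hsum, hsum']
  simp only [map_sum, map_smul, sum_apply, smul_apply,
    ← Finset.sum_sub_distrib, ← Finset.sum_add_distrib, smul_sub, smul_add]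

variable {c : ℝ → M} {e D : ∀ t, ι → TangentSpace 𝓘(ℝ, E) (c t)} {s : Set ℝ} {t : ℝ}
  {k : ι → ι → ℝ}

/-- Apply the Leibniz rule to `A V = ∑ ⟪eᵢ, V⟫ Dᵢ`. The rotation `k` of the frame enters through
`eᵢ` and through `Dᵢ`, and the two contributions cancel since `k` is skew; only the curvature and `A
(∇V)` survive. -/
lemma hasTensorCovDerivWithinAt_frameTensor (hs : UniqueDiffWithinAt ℝ s t)
    (hcard : Module.finrank ℝ E = Fintype.card ι) (he : Orthonormal ℝ (e t))
    (hk : ∀ i j, k i j = -k j i)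
    (hde : ∀ i, HasCovDerivWithinAt c (fun r => e r i) s t (∑ j, k i j • e t j))
    {u v : TangentSpace 𝓘(ℝ, E) (c t)}
    (hdD : ∀ i, HasCovDerivWithinAt c (fun r => D r i) s t
      (curvature (c t) u v (e t i) + ∑ j, k i j • D t j)) :
    HasTensorCovDerivWithinAt c (fun r => frameTensor (e r) (D r)) s t
      (curvature (c t) u v) := by
  intro V W hV
  have h1 : HasCovDerivWithinAt c (fun r => ∑ i, ⟪e r i, V r⟫_ℝ • D r i) s t
      (∑ i, (⟪e t i, V t⟫_ℝ • (curvature (c t) u v (e t i) + ∑ j, k i j • D t j) +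
        (⟪∑ j, k i j • e t j, V t⟫_ℝ + ⟪e t i, W⟫_ℝ) • D t i)) :=
    HasCovDerivWithinAt.sum _ hs hV.1 fun i _ => (hdD i).smul hs ((hde i).inner hV)
  have h2 : (∑ i, (⟪e t i, V t⟫_ℝ • (curvature (c t) u v (e t i) + ∑ j, k i j • D t j) +
        (⟪∑ j, k i j • e t j, V t⟫_ℝ + ⟪e t i, W⟫_ℝ) • D t i)) =
      curvature (c t) u v (V t) + frameTensor (e t) (D t) W := by
    have h3 : curvature (c t) u v (V t) = ∑ i, ⟪e t i, V t⟫_ℝ • curvature (c t) u v (e t i) := by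
      rw [← curvature_sum_smul, he.sum_inner_smul hcard]
    have h4 : ∑ i, ⟪e t i, V t⟫_ℝ • ∑ j, k i j • D t j +
        ∑ i, ⟪∑ j, k i j • e t j, V t⟫_ℝ • D t i = 0 := by
      simp only [sum_inner, real_inner_smul_left, Finset.smul_sum, Finset.sum_smul]
      rw [Finset.sum_comm, ← Finset.sum_add_distrib]
      refine Finset.sum_eq_zero fun i _ => ?_
      rw [← Finset.sum_add_distrib]
      refine Finset.sum_eq_zero fun j _ => ?_
      rw [smul_smul, ← add_smul, hk j i]
      ring_nf
      simp
    simp only [smul_add, add_smul, Finset.sum_add_distrib]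
    rw [h3, frameTensor_apply, ← add_assoc, add_assoc (∑ i, _) (∑ i, _) (∑ i, _), h4, add_zero]
  rw [h2] at h1
  have h5 : ∀ r, frameTensor (e r) (D r) (V r) = ∑ i, ⟪e r i, V r⟫_ℝ • D r i :=
    fun r => frameTensor_apply _ _ _
  simp only [h5]
  exact h1

/-- The covariant derivatives of an orthonormal moving frame are skew. -/
lemma inner_covDeriv_add_eq_zero {c : ℝ → M} {e : ∀ t, ι → TangentSpace 𝓘(ℝ, E) (c t)}
    {t : ℝ} {W : ι → TangentSpace 𝓘(ℝ, E) (c t)}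
    (he : ∀ᶠ r in 𝓝 t, Orthonormal ℝ (e r))
    (hW : ∀ i, HasCovDerivWithinAt c (fun r => e r i) univ t (W i)) (i j : ι) :
    ⟪W i, e t j⟫_ℝ + ⟪e t i, W j⟫_ℝ = 0 := by
  classical
  have h1 := (hW i).inner (hW j)
  have h2 : HasDerivWithinAt (fun r => ⟪e r i, e r j⟫_ℝ) 0 univ t := by
    refine (hasDerivWithinAt_const t univ (if i = j then (1 : ℝ) else 0)).congr_of_eventuallyEq
      ?_ (orthonormal_iff_ite.1 he.self_of_nhds i j)
    rw [nhdsWithin_univ]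
    filter_upwards [he] with r hr
    exact orthonormal_iff_ite.1 hr i j
  exact uniqueDiffWithinAt_univ.eq_deriv _ h1 h2

end FrameTensors

/-! ### Bishop frames as solutions of the frame equations; proof of part (1). -/

section BishopFrames

open Set
open scoped InnerProductSpace

/-- The coefficients of the frame equations `c' = T`, `∇T = ∑ κᵢ Nᵢ`, `∇Nᵢ = -κᵢ T` of a Bishop
frame. -/
def bishopCoeff {m : ℕ} (κ : Fin m → ℝ) : (Fin (m + 1) → ℝ) × (Fin (m + 1) → Fin (m + 1) → ℝ) :=
  (Fin.cons 1 0, Fin.cons (Fin.cons 0 κ) fun i => Fin.cons (-κ i) 0)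

section Coefficients

variable {m : ℕ} {V : Type*} [AddCommGroup V] [Module ℝ V]

lemma sum_bishopCoeff_fst (κ : Fin m → ℝ) (e : Fin (m + 1) → V) :
    ∑ j, (bishopCoeff κ).1 j • e j = e 0 := by
  simp [bishopCoeff, Fin.sum_univ_succ]

lemma sum_bishopCoeff_zero (κ : Fin m → ℝ) (e : Fin (m + 1) → V) :
    ∑ j, (bishopCoeff κ).2 0 j • e j = ∑ i, κ i • e i.succ := by
  simp [bishopCoeff, Fin.sum_univ_succ]

lemma sum_bishopCoeff_succ (κ : Fin m → ℝ) (e : Fin (m + 1) → V) (i : Fin m) :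
    ∑ j, (bishopCoeff κ).2 i.succ j • e j = -κ i • e 0 := by
  simp [bishopCoeff, Fin.sum_univ_succ]

lemma bishopCoeff_skew (κ : Fin m → ℝ) (i j : Fin (m + 1)) :
    (bishopCoeff κ).2 i j = -(bishopCoeff κ).2 j i := by
  refine Fin.cases ?_ (fun i => ?_) i <;> refine Fin.cases ?_ (fun j => ?_) j <;>
    simp [bishopCoeff]

lemma continuous_bishopCoeff {κ : ℝ → Fin m → ℝ} (hκ : ∀ i, Continuous fun t => κ t i) :
    Continuous fun t => bishopCoeff (κ t) := by
  refine continuous_const.prodMk (continuous_pi fun i => continuous_pi fun j => ?_)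
  refine Fin.cases ?_ (fun i => ?_) i <;> refine Fin.cases ?_ (fun j => ?_) j
  · simpa using continuous_const
  · simpa using hκ j
  · exact (hκ i).neg
  · simpa using continuous_const

end Coefficients

variable {E : Type*} [NormedAddCommGroup E] [NormedSpace ℝ E] [FiniteDimensional ℝ E]
  {M : Type*} [TopologicalSpace M] [ChartedSpace E M] [IsManifold 𝓘(ℝ, E) ∞ M]

lemma contMDiffWithinAt_curve_iff {c : ℝ → M} {s : Set ℝ} {t : ℝ} {n : WithTop ℕ∞} :
    ContMDiffWithinAt 𝓘(ℝ, ℝ) 𝓘(ℝ, E) n c s t ↔ ContinuousWithinAt c s t ∧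
      ContDiffWithinAt ℝ n (fun r => extChartAt 𝓘(ℝ, E) (c t) (c r)) s t := by
  rw [contMDiffWithinAt_iff_target, contMDiffWithinAt_iff_contDiffWithinAt]
  rfl

lemma contMDiffWithinAt_field_iff {c : ℝ → M} {V : ∀ t, TangentSpace 𝓘(ℝ, E) (c t)} {s : Set ℝ}
    {t : ℝ} : ContMDiffWithinAt 𝓘(ℝ, ℝ) (𝓘(ℝ, E).prod 𝓘(ℝ, E)) 1
      (fun t => (⟨c t, V t⟩ : TangentBundle 𝓘(ℝ, E) M)) s t ↔
      ContMDiffWithinAt 𝓘(ℝ, ℝ) 𝓘(ℝ, E) 1 c s t ∧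
        ContDiffWithinAt ℝ 1 (fun r => chartCoord (c t) (c r) (V r)) s t := by
  rw [contMDiffWithinAt_totalSpace, contMDiffWithinAt_iff_contDiffWithinAt]
  refine and_congr_right fun hc => ?_
  have hev : ∀ᶠ r in 𝓝[s] t, c r ∈ (chartAt E (c t)).source :=
    hc.continuousWithinAt.preimage_mem_nhdsWithin
      ((chartAt E (c t)).open_source.mem_nhds (mem_chart_source E (c t)))
  have heq : ∀ r, c r ∈ (chartAt E (c t)).source → chartCoord (c t) (c r) (V r) =
      (trivializationAt E (TangentSpace 𝓘(ℝ, E)) (c t)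
        (⟨c r, V r⟩ : TangentBundle 𝓘(ℝ, E) M)).2 := fun r hr =>
    Trivialization.continuousLinearMapAt_apply_of_mem ℝ _ (mem_baseSet_of_mem_source hr) _
  exact ⟨fun h => h.congr_of_eventuallyEq (by filter_upwards [hev] with r hr using heq r hr)
    (heq t (mem_chart_source E (c t))), fun h => h.congr_of_eventuallyEq
    (by filter_upwards [hev] with r hr using (heq r hr).symm)
    (heq t (mem_chart_source E (c t))).symm⟩

variable [RiemannianBundle (fun x : M => TangentSpace 𝓘(ℝ, E) x)]
  [IsContMDiffRiemannianBundle 𝓘(ℝ, E) ∞ E (fun x : M => TangentSpace 𝓘(ℝ, E) x)]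
  {m : ℕ} {L : ℝ} {γ : ℝ → M} {N : Fin m → ∀ t, TangentSpace 𝓘(ℝ, E) (γ t)} {κ : Fin m → ℝ → ℝ}

variable (L γ N) in
/-- The frame `T, N₀, …, N_{m-1}` along `γ`, as a curve of families of tangent vectors. -/
def bishopFrame (t : ℝ) : FrameSpace E M (Fin (m + 1)) :=
  ⟨γ t, Fin.cons (velocity γ (Icc 0 L) t) (fun i => N i t)⟩

/-- The multiple of `T` is found by differentiating `⟪Nᵢ, T⟫ = 0`. -/
lemma IsBishopFrame.hasCovDerivWithinAt_normal (hL : 0 < L) (h : IsBishopFrame L γ N)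
    (hκ : HasGeodesicCurvatures L γ N κ) (i : Fin m) {t : ℝ} (ht : t ∈ Icc 0 L) :
    HasCovDerivWithinAt γ (N i) (Icc 0 L) t (-κ i t • velocity γ (Icc 0 L) t) := by
  have hu := uniqueDiffOn_Icc hL t ht
  obtain ⟨a, ha⟩ := h.normalParallel i t ht
  have ho := h.orthonormal t ht
  have hT : ⟪velocity (E := E) γ (Icc 0 L) t, velocity γ (Icc 0 L) t⟫_ℝ = 1 := by
    have := ho.1 0
    rw [Fin.cons_zero] at this
    rw [real_inner_self_eq_norm_sq, this, one_pow]
  have hNN : ∀ i j, ⟪N i t, N j t⟫_ℝ = if i = j then 1 else 0 := fun i j => by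
    have := orthonormal_iff_ite.1 ho i.succ j.succ
    simpa only [Fin.cons_succ, Fin.succ_inj] using this
  have h1 := ha.inner (hκ t ht)
  have h2 : HasDerivWithinAt (fun r => ⟪N i r, velocity γ (Icc 0 L) r⟫_ℝ) 0 (Icc 0 L) t := by
    have h0 : ∀ r ∈ Icc 0 L, ⟪N i r, velocity γ (Icc 0 L) r⟫_ℝ = 0 := fun r hr => by
      have := (h.orthonormal r hr).2 (Fin.succ_ne_zero i)
      simpa only [Fin.cons_succ, Fin.cons_zero] using this
    exact (hasDerivWithinAt_const t (Icc 0 L) (0 : ℝ)).congr h0 (h0 t ht)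
  have h3 := hu.eq_deriv _ h1 h2
  rw [real_inner_smul_left, hT, inner_sum] at h3
  simp only [real_inner_smul_right, hNN] at h3
  simp only [mul_ite, mul_one, mul_zero, Finset.sum_ite_eq, Finset.mem_univ, if_true] at h3
  have h4 : a = -κ i t := by linarith
  rwa [h4] at ha

/-- The bridge from geometry to the differential equation: its coefficients involve only the
curvature functions, hence are common to all curves of a rigid variation. -/
lemma frameEquationAt_bishopFrame (hL : 0 < L) (h : IsBishopFrame L γ N)
    (hκ : HasGeodesicCurvatures L γ N κ) {t : ℝ} (ht : t ∈ Icc 0 L) :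
    FrameEquationAt (bishopCoeff fun i => κ i t) (bishopFrame L γ N) (Icc 0 L) t := by
  refine (hasFrameDerivWithinAt_iff (uniqueDiffOn_Icc hL t ht)).2 ⟨(hκ t ht).1, ?_, ?_⟩
  · rw [sum_bishopCoeff_fst]; rfl
  · refine Fin.cases ?_ fun i => ?_
    · rw [sum_bishopCoeff_zero]
      exact hκ t ht
    · rw [sum_bishopCoeff_succ]
      exact h.hasCovDerivWithinAt_normal hL hκ i ht

/-- Continuity is not assumed in a rigid variation. It follows from `κᵢ = -⟪∇_T Nᵢ, T⟫`, whose right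
side is continuous because `Nᵢ` is `C¹` and the curve is `C²`. -/
lemma IsBishopFrame.continuousOn_curvature (hL : 0 < L) (h : IsBishopFrame L γ N)
    (hκ : HasGeodesicCurvatures L γ N κ) (i : Fin m) : ContinuousOn (κ i) (Icc 0 L) := by
  intro t ht
  have huo := uniqueDiffOn_Icc hL
  have hxt := mem_chart_source E (γ t)
  have hz := extChartAt_mem_target hxt
  obtain ⟨hcc, hcs⟩ := contMDiffWithinAt_curve_iff.1 (h.isArcLengthCurve.contMDiffOn t ht)
  obtain ⟨-, hns⟩ := contMDiffWithinAt_field_iff.1 (h.contMDiffOn i t ht)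
  have hd1 : ContinuousWithinAt (derivWithin (fun r => extChartAt 𝓘(ℝ, E) (γ t) (γ r)) (Icc 0 L))
      (Icc 0 L) t := by
    have := (hcs.fderivWithin_right_apply (k := fun _ => (1 : ℝ)) (m := 1) contDiffWithinAt_const
      huo (by norm_num) ht).continuousWithinAt
    exact this
  have hd2 : ContinuousWithinAt (derivWithin (fun r => chartCoord (γ t) (γ r) (N i r)) (Icc 0 L))
      (Icc 0 L) t :=
    (hns.fderivWithin_right_apply (k := fun _ => (1 : ℝ)) (m := 0) contDiffWithinAt_const
      huo (by norm_num) ht).continuousWithinAt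
  set φ : ℝ → E := fun r => extChartAt 𝓘(ℝ, E) (γ t) (γ r) with hφ
  set n : ℝ → E := fun r => chartCoord (γ t) (γ r) (N i r) with hn
  have hΓ : ContinuousWithinAt (fun r => chartChristoffel (γ t) (φ r)) (Icc 0 L) t :=
    ContinuousAt.comp_continuousWithinAt (f := φ) (contDiffAt_chartChristoffel hz).continuousAt
      hcs.continuousWithinAt
  have hg : ContinuousWithinAt (fun r => metricCoord (γ t) (φ r)) (Icc 0 L) t :=
    ContinuousAt.comp_continuousWithinAt (f := φ) (contDiffAt_metricCoord hz).continuousAt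
      hcs.continuousWithinAt
  have hcont : ContinuousWithinAt (fun r => -metricCoord (γ t) (φ r)
      (derivWithin n (Icc 0 L) r + chartChristoffel (γ t) (φ r) (derivWithin φ (Icc 0 L) r) (n r))
      (derivWithin φ (Icc 0 L) r)) (Icc 0 L) t :=
    ((hg.clm_apply (hd2.add ((hΓ.clm_apply hd1).clm_apply hns.continuousWithinAt))).clm_apply
      hd1).neg
  have heq : ∀ r ∈ Icc 0 L, γ r ∈ (chartAt E (γ t)).source → κ i r = -metricCoord (γ t) (φ r)
      (derivWithin n (Icc 0 L) r + chartChristoffel (γ t) (φ r) (derivWithin φ (Icc 0 L) r) (n r))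
      (derivWithin φ (Icc 0 L) r) := by
    intro r hr hxr
    have hur := huo r hr
    have hN := h.hasCovDerivWithinAt_normal hL hκ i hr
    have h1 := (hasDerivWithinAt_extChartAt_comp hxr hN.1).derivWithin hur
    have h2 := (hN.hasDerivWithinAt_chartCoord hxr).derivWithin hur
    have h3 : ⟪velocity (E := E) γ (Icc 0 L) r, velocity γ (Icc 0 L) r⟫_ℝ = 1 := by
      have := (h.orthonormal r hr).1 0
      rw [Fin.cons_zero] at this
      rw [real_inner_self_eq_norm_sq, this, one_pow]
    rw [inner_eq_metricCoord hxr] at h3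
    rw [hφ, hn, h1, h2]
    simp only [sub_add_cancel, map_smul, smul_apply, smul_eq_mul]
    rw [h3]
    ring
  refine hcont.congr_of_eventuallyEq ?_ (heq t ht hxt)
  filter_upwards [self_mem_nhdsWithin, hcc.preimage_mem_nhdsWithin
    ((chartAt E (γ t)).open_source.mem_nhds hxt)] with r hr hxr
  exact heq r hr hxr

lemma HasCovDerivWithinAt.congr_deriv {c : ℝ → M} {V : ∀ t, TangentSpace 𝓘(ℝ, E) (c t)}
    {s : Set ℝ} {t : ℝ} {W W' : TangentSpace 𝓘(ℝ, E) (c t)} (h : HasCovDerivWithinAt c V s t W)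
    (hW : W = W') : HasCovDerivWithinAt c V s t W' :=
  hW ▸ h

/-- The variation field and the transverse derivative of the frame of a rigid variation exist and
satisfy the generalized Jacobi equations. -/
theorem RigidVariation.exists_generates [T2Space M] (hm : Module.finrank ℝ E = m + 1) (hL : 0 < L)
    (R : RigidVariation E M m L) :
    ∃ (X : ∀ t, TangentSpace 𝓘(ℝ, E) (R.curve 0 t))
      (A : ∀ t, TangentSpace 𝓘(ℝ, E) (R.curve 0 t) →L[ℝ] TangentSpace 𝓘(ℝ, E) (R.curve 0 t)),
      R.Generates X A ∧ IsSkewAlong L (R.curve 0) A ∧ GeneralizedJacobi L (R.curve 0) X A := by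
  have hcard : Module.finrank ℝ E = Fintype.card (Fin (m + 1)) := by rw [hm, Fintype.card_fin]
  have h0mem : (0 : ℝ) ∈ Ioo (-R.ε) R.ε := ⟨by linarith [R.ε_pos], R.ε_pos⟩
  have hnhds : Ioo (-R.ε) R.ε ∈ 𝓝 (0 : ℝ) := isOpen_Ioo.mem_nhds h0mem
  have h0L : (0 : ℝ) ∈ Icc 0 L := ⟨le_rfl, hL.le⟩
  have hB := R.isBishopFrame 0 h0mem
  have hproj : ∀ t ∈ Icc 0 L, (projIcc 0 L hL.le t : ℝ) = t := fun t ht => by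
    rw [projIcc_of_mem hL.le ht]
  -- The curvature functions are made constant outside `[0, L]`, so that the coefficients are
  -- continuous on all of `ℝ`.
  set p : ℝ → (Fin (m + 1) → ℝ) × (Fin (m + 1) → Fin (m + 1) → ℝ) :=
    fun t => bishopCoeff fun i => R.κ i (projIcc 0 L hL.le t) with hp
  have hpc : Continuous p := continuous_bishopCoeff fun i =>
    (hB.continuousOn_curvature hL (R.hasGeodesicCurvatures 0 h0mem) i).comp_continuous
      (continuous_subtype_val.comp continuous_projIcc) fun t => Subtype.coe_prop _
  set Y : ℝ → ℝ → FrameSpace E M (Fin (m + 1)) :=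
    fun τ => bishopFrame L (R.curve τ) (R.normal τ) with hYdef
  have hY : ∀ᶠ τ in 𝓝 (0 : ℝ), ∀ t ∈ Icc 0 L, FrameEquationAt (p t) (Y τ) (Icc 0 L) t := by
    filter_upwards [hnhds] with τ hτ t ht
    have := frameEquationAt_bishopFrame hL (R.isBishopFrame τ hτ) (R.hasGeodesicCurvatures τ hτ) ht
    simp only [hp, hproj t ht]
    exact this
  have hmd : MDifferentiableWithinAt 𝓘(ℝ, ℝ) 𝓘(ℝ, E) (fun τ => R.curve τ 0) univ 0 := by
    rw [mdifferentiableWithinAt_univ]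
    exact (R.contMDiffOn_point.contMDiffAt hnhds).mdifferentiableAt (by norm_num)
  -- Of the `C¹` dependence of the initial frame, only the covariant derivative at `τ = 0` is used.
  have hinit : ∀ V : ∀ τ, TangentSpace 𝓘(ℝ, E) (R.curve τ 0),
      ContMDiffOn 𝓘(ℝ, ℝ) (𝓘(ℝ, E).prod 𝓘(ℝ, E)) 1
        (fun τ => (⟨R.curve τ 0, V τ⟩ : TangentBundle 𝓘(ℝ, E) M)) (Ioo (-R.ε) R.ε) →
      ∃ W, HasCovDerivWithinAt (fun τ => R.curve τ 0) V univ 0 W := by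
    intro V hV
    have h1 := (hV.contMDiffAt hnhds).contMDiffWithinAt (s := univ)
    have h2 := ((contMDiffWithinAt_field_iff.1 h1).2.differentiableWithinAt
      (by norm_num)).hasDerivWithinAt
    exact ⟨_, hmd, _, h2, rfl⟩
  obtain ⟨W, hW⟩ : ∃ W : Fin (m + 1) → TangentSpace 𝓘(ℝ, E) (Y 0 0).1, ∀ i,
      HasCovDerivWithinAt (fun τ => (Y τ 0).1) (fun τ => (Y τ 0).2 i) univ 0 (W i) := by
    refine Classical.skolem.1 (Fin.cases ?_ fun i => ?_)
    · exact hinit _ R.contMDiffOn_tangent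
    · exact hinit _ (R.contMDiffOn_normal i)
  have h0 : HasFrameDerivWithinAt (fun τ => Y τ 0) univ 0
      (velocity (fun τ => R.curve τ 0) univ 0) W :=
    (hasFrameDerivWithinAt_iff uniqueDiffWithinAt_univ).2 ⟨hmd, rfl, hW⟩
  obtain ⟨X, D, hXD⟩ := exists_frameVariation hL hpc hY h0
  have hvar : ∀ t ∈ Icc 0 L, MDifferentiableWithinAt 𝓘(ℝ, ℝ) 𝓘(ℝ, E)
      (fun τ => R.curve τ t) univ 0 ∧ velocity (fun τ => R.curve τ t) univ 0 = X t ∧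
      ∀ i, HasCovDerivWithinAt (fun τ => R.curve τ t) (fun τ => (Y τ t).2 i) univ 0 (D t i) :=
    fun t ht => (hasFrameDerivWithinAt_iff (Y := fun τ => Y τ t) uniqueDiffWithinAt_univ).1
      (hXD t ht).1
  have hon : ∀ t ∈ Icc 0 L, Orthonormal ℝ (Y 0 t).2 := fun t ht => hB.orthonormal t ht
  have hA : ∀ t ∈ Icc 0 L, ∀ i, frameTensor (Y 0 t).2 (D t) ((Y 0 t).2 i) = D t i :=
    fun t ht i => frameTensor_frame (hon t ht) _ i
  have hA0 : ∀ t ∈ Icc 0 L, frameTensor (Y 0 t).2 (D t) (velocity (R.curve 0) (Icc 0 L) t) =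
    D t 0 := fun t ht => hA t ht 0
  refine ⟨X, fun t => frameTensor (Y 0 t).2 (D t), ⟨?_, ?_, ?_, ?_⟩, ?_, ⟨?_, ?_⟩⟩
  · intro t ht
    have := (hvar t ht).1
    rwa [mdifferentiableWithinAt_univ] at this
  · exact fun t ht => (hvar t ht).2.1
  · exact fun t ht => HasCovDerivWithinAt.congr_deriv ((hvar t ht).2.2 0) (hA0 t ht).symm
  · intro i t ht
    have h1 : frameTensor (Y 0 t).2 (D t) (R.normal 0 i t) = D t i.succ := hA t ht i.succ
    exact HasCovDerivWithinAt.congr_deriv ((hvar t ht).2.2 i.succ) h1.symm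
  · intro t ht u v
    -- The frames at time `t` are orthonormal for all small `τ`; differentiating their Gram matrix
    -- at `τ = 0` yields skewness.
    refine inner_frameTensor_eq_neg (hon t ht) hcard (inner_covDeriv_add_eq_zero
      (c := fun τ => R.curve τ t) (e := fun τ => (Y τ t).2) ?_ (hvar t ht).2.2) u v
    filter_upwards [hnhds] with τ hτ
    exact (R.isBishopFrame τ hτ).orthonormal t ht
  · intro t ht
    have h1 := (hXD t ht).2.1
    rw [sum_bishopCoeff_fst] at h1
    exact HasCovDerivWithinAt.congr_deriv h1 (hA0 t ht).symm
  · intro t ht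
    have hu := uniqueDiffOn_Icc hL t ht
    have h1 := (hXD t ht).2.2
    rw [sum_bishopCoeff_fst] at h1
    exact hasTensorCovDerivWithinAt_frameTensor (c := R.curve 0) (e := fun t => (Y 0 t).2) hu
      hcard (hon t ht) (bishopCoeff_skew _)
      ((hasFrameDerivWithinAt_iff hu).1 (hY.self_of_nhds t ht)).2.2 h1

end BishopFrames

/-! ### Uniqueness for the generalized Jacobi equations. -/

section JacobiUniqueness

open Set
open scoped InnerProductSpace

variable {E : Type*} [NormedAddCommGroup E] [NormedSpace ℝ E] [FiniteDimensional ℝ E]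
  {M : Type*} [TopologicalSpace M] [ChartedSpace E M] [IsManifold 𝓘(ℝ, E) ∞ M]
  {ι : Type*} [Fintype ι] [Nonempty ι]
  [RiemannianBundle (fun x : M => TangentSpace 𝓘(ℝ, E) x)]
  [IsContMDiffRiemannianBundle 𝓘(ℝ, E) ∞ E (fun x : M => TangentSpace 𝓘(ℝ, E) x)]

set_option synthInstance.maxHeartbeats 200000 in
lemma continuousWithinAt_curvatureCoord {x : M} {z a b c : ℝ → E} {s : Set ℝ} {t : ℝ}
    (hz : z t ∈ (extChartAt 𝓘(ℝ, E) x).target) (h : ContinuousWithinAt z s t)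
    (ha : ContinuousWithinAt a s t) (hb : ContinuousWithinAt b s t)
    (hc : ContinuousWithinAt c s t) :
    ContinuousWithinAt (fun r => curvatureCoord x (z r) (a r) (b r) (c r)) s t := by
  have h1 : ContinuousWithinAt (fun r => chartChristoffel x (z r)) s t :=
    ContinuousAt.comp_continuousWithinAt (f := z) (contDiffAt_chartChristoffel hz).continuousAt h
  have h2 : ContinuousWithinAt (fun r => fderiv ℝ (chartChristoffel x) (z r)) s t :=
    ContinuousAt.comp_continuousWithinAt (f := z) ((contDiffAt_chartChristoffel hz).fderiv_right
      (m := 0) (by simp)).continuousAt h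
  exact ((((h2.clm_apply ha).clm_apply hb).clm_apply hc).sub
    (((h2.clm_apply hb).clm_apply ha).clm_apply hc)).add
    ((h1.clm_apply ha).clm_apply ((h1.clm_apply hb).clm_apply hc)) |>.sub
    ((h1.clm_apply hb).clm_apply ((h1.clm_apply ha).clm_apply hc))

/-- The components of the curvature tensor with respect to a differentiable frame along a curve are
continuous. -/
lemma continuousWithinAt_inner_curvature {Y : ℝ → FrameSpace E M ι} {s : Set ℝ} {t : ℝ}
    {v : TangentSpace 𝓘(ℝ, E) (Y t).1} {W : ι → TangentSpace 𝓘(ℝ, E) (Y t).1}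
    (h : HasFrameDerivWithinAt Y s t v W) (i j k l : ι) :
    ContinuousWithinAt (fun r => (⟪curvature (Y r).1 ((Y r).2 i) ((Y r).2 j) ((Y r).2 k),
      (Y r).2 l⟫_ℝ : ℝ)) s t := by
  have hxt := mem_chart_source E (Y t).1
  have hz := extChartAt_mem_target hxt
  have h1 := h.2.continuousWithinAt
  have h2 : ∀ i, ContinuousWithinAt (fun r => (frameCoord (Y t).1 (Y r)).2 i) s t := fun i =>
    (continuous_apply i).continuousAt.comp_continuousWithinAt h1.snd
  have hg : ContinuousWithinAt (fun r => metricCoord (Y t).1 (frameCoord (Y t).1 (Y r)).1) s t :=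
    ContinuousAt.comp_continuousWithinAt (f := fun r => (frameCoord (Y t).1 (Y r)).1)
      (contDiffAt_metricCoord hz).continuousAt h1.fst
  have h3 := (hg.clm_apply (continuousWithinAt_curvatureCoord (x := (Y t).1) hz h1.fst (h2 i)
    (h2 j) (h2 k))).clm_apply (h2 l)
  have heq : ∀ r, (Y r).1 ∈ (chartAt E (Y t).1).source →
      ⟪curvature (Y r).1 ((Y r).2 i) ((Y r).2 j) ((Y r).2 k), (Y r).2 l⟫_ℝ =
      metricCoord (Y t).1 (frameCoord (Y t).1 (Y r)).1 (curvatureCoord (Y t).1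
        (frameCoord (Y t).1 (Y r)).1 ((frameCoord (Y t).1 (Y r)).2 i)
        ((frameCoord (Y t).1 (Y r)).2 j) ((frameCoord (Y t).1 (Y r)).2 k))
        ((frameCoord (Y t).1 (Y r)).2 l) := fun r hr => by
    rw [inner_eq_metricCoord hr, chartCoord_curvature hr]
    rfl
  refine h3.congr_of_eventuallyEq ?_ (heq t hxt)
  filter_upwards [h.1.preimage_mem_nhdsWithin
    ((chartAt E (Y t).1).open_source.mem_nhds hxt)] with r hr
  exact heq r hr

/-- Solutions of the generalized Jacobi equations are determined by their initial values. -/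
theorem GeneralizedJacobi.eq_of_eq_zero {L : ℝ} (hL : 0 < L) {Y : ℝ → FrameSpace E M ι}
    (hcard : Module.finrank ℝ E = Fintype.card ι) {p : ℝ → (ι → ℝ) × (ι → ι → ℝ)}
    (hp : Continuous p) (hY : ∀ t ∈ Icc 0 L, FrameEquationAt (p t) Y (Icc 0 L) t)
    (he : ∀ t ∈ Icc 0 L, Orthonormal ℝ (Y t).2) {o : ι}
    (ho : ∀ t ∈ Icc 0 L, velocity (fun r => (Y r).1) (Icc 0 L) t = (Y t).2 o)
    {X X' : ∀ t, TangentSpace 𝓘(ℝ, E) (Y t).1}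
    {A A' : ∀ t, TangentSpace 𝓘(ℝ, E) (Y t).1 →L[ℝ] TangentSpace 𝓘(ℝ, E) (Y t).1}
    (h : GeneralizedJacobi L (fun r => (Y r).1) X A)
    (h' : GeneralizedJacobi L (fun r => (Y r).1) X' A') (hX : X 0 = X' 0) (hA : A 0 = A' 0) :
    ∀ t ∈ Icc 0 L, X t = X' t ∧ A t = A' t := by
  have huo := uniqueDiffOn_Icc hL
  have hde : ∀ t ∈ Icc 0 L, ∀ i, HasCovDerivWithinAt (fun r => (Y r).1) (fun r => (Y r).2 i)
      (Icc 0 L) t (∑ j, (p t).2 i j • (Y t).2 j) := fun t ht =>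
    ((hasFrameDerivWithinAt_iff (huo t ht)).1 (hY t ht)).2.2
  have hk : ∃ C, ∀ t ∈ Icc 0 L, ‖(p t).2‖ ≤ C :=
    isCompact_Icc.exists_bound_of_continuousOn (f := fun t => (p t).2)
      (continuous_snd.comp hp).continuousOn
  obtain ⟨Ck, hCk⟩ := hk
  let ρ : ℝ → ι → ι → ι → ℝ := fun t l i j =>
    ⟪curvature (Y t).1 ((Y t).2 o) ((Y t).2 l) ((Y t).2 i), (Y t).2 j⟫_ℝ
  obtain ⟨Cρ, hCρ⟩ : ∃ C, ∀ t ∈ Icc 0 L, ‖ρ t‖ ≤ C :=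
    isCompact_Icc.exists_bound_of_continuousOn (f := ρ) fun t ht =>
      continuousWithinAt_pi.2 fun l => continuousWithinAt_pi.2 fun i => continuousWithinAt_pi.2
        fun j => continuousWithinAt_inner_curvature (hY t ht) o l i j
  have hkb : ∀ t ∈ Icc 0 L, ∀ i j, |(p t).2 i j| ≤ Ck := fun t ht i j =>
    ((norm_le_pi_norm ((p t).2 i) j).trans (norm_le_pi_norm (p t).2 i)).trans (hCk t ht)
  have hρb : ∀ t ∈ Icc 0 L, ∀ l i j, |ρ t l i j| ≤ Cρ := fun t ht l i j =>
    (((norm_le_pi_norm (ρ t l i) j).trans (norm_le_pi_norm (ρ t l) i)).trans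
      (norm_le_pi_norm (ρ t) l)).trans (hCρ t ht)
  -- The components of the difference of the two solutions in the moving frame. They satisfy a
  -- homogeneous linear system whose coefficients, the `k` of the frame and the curvature components
  -- `ρ`, are bounded on `[0, L]`.
  let u : ℝ → (ι → ℝ) × (ι → ι → ℝ) := fun t =>
    (fun i => ⟪X t - X' t, (Y t).2 i⟫_ℝ, fun i j => ⟪(A t - A' t) ((Y t).2 i), (Y t).2 j⟫_ℝ)
  let u' : ℝ → (ι → ℝ) × (ι → ι → ℝ) := fun t =>
    (fun i => (u t).2 o i + ∑ j, (p t).2 i j * (u t).1 j, fun i j =>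
      ∑ l, (u t).1 l * ρ t l i j + ∑ l, (p t).2 i l * (u t).2 l j + ∑ l, (p t).2 j l * (u t).2 i l)
  have hu : ∀ t ∈ Icc 0 L, HasDerivWithinAt u (u' t) (Icc 0 L) t := by
    intro t ht
    refine HasDerivWithinAt.prodMk (hasDerivWithinAt_pi.2 fun i => ?_)
      (hasDerivWithinAt_pi.2 fun i => hasDerivWithinAt_pi.2 fun j => ?_)
    · have h1 := ((h.field t ht).inner (hde t ht i)).sub ((h'.field t ht).inner (hde t ht i))
      have h2 : (fun r => ⟪X r - X' r, (Y r).2 i⟫_ℝ) =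
          fun r => ⟪X r, (Y r).2 i⟫_ℝ - ⟪X' r, (Y r).2 i⟫_ℝ := funext fun r => inner_sub_left _ _ _
      simp only [u]
      rw [h2]
      refine h1.congr_deriv ?_
      rw [ho t ht]
      simp only [sub_apply, inner_sub_left, inner_sum, real_inner_smul_right, mul_sub,
        Finset.sum_sub_distrib]
      ring
    · have h1 := ((h.tensor t ht _ _ (hde t ht i)).inner (hde t ht j)).sub
        ((h'.tensor t ht _ _ (hde t ht i)).inner (hde t ht j))
      have h2 : (fun r => ⟪(A r - A' r) ((Y r).2 i), (Y r).2 j⟫_ℝ) =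
          fun r => ⟪A r ((Y r).2 i), (Y r).2 j⟫_ℝ - ⟪A' r ((Y r).2 i), (Y r).2 j⟫_ℝ :=
        funext fun r => by rw [sub_apply, inner_sub_left]
      simp only [u]
      rw [h2]
      refine h1.congr_deriv ?_
      -- Expanding the second argument of the curvature in the frame turns the term `R(T, X)` into a
      -- linear expression in the components of `X`.
      have h3 : ∀ Z : TangentSpace 𝓘(ℝ, E) (Y t).1,
          ⟪curvature (Y t).1 ((Y t).2 o) Z ((Y t).2 i), (Y t).2 j⟫_ℝ =
            ∑ l, ⟪Z, (Y t).2 l⟫_ℝ * ρ t l i j := fun Z => by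
        conv_lhs => rw [← (he t ht).sum_inner_smul hcard Z, curvature_sum_smul_middle]
        rw [sum_inner]
        refine Finset.sum_congr rfl fun l _ => ?_
        rw [real_inner_smul_left, real_inner_comm]
      rw [ho t ht, inner_add_left, inner_add_left, h3, h3]
      simp only [sub_apply, inner_sub_left, sum_inner, inner_sum, map_sum, map_smul,
        real_inner_smul_right, real_inner_smul_left, mul_sub, sub_mul, Finset.sum_sub_distrib]
      ring
  set n : ℝ := (Fintype.card ι : ℝ) with hn
  have hsum : ∀ (f g : ι → ℝ) (C U : ℝ), (∀ i, |f i| ≤ C) → (∀ i, |g i| ≤ U) →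
      |∑ i, f i * g i| ≤ n * C * U := by
    intro f g C U hf hg
    refine (Finset.abs_sum_le_sum_abs _ _).trans ?_
    have : ∀ i ∈ Finset.univ, |f i * g i| ≤ C * U := fun i _ => by
      rw [abs_mul]
      exact mul_le_mul (hf i) (hg i) (abs_nonneg _) ((abs_nonneg _).trans (hf i))
    refine (Finset.sum_le_card_nsmul _ _ _ this).trans ?_
    rw [nsmul_eq_mul, Finset.card_univ, mul_assoc]
  have hbound : ∀ t ∈ Icc 0 L, ‖u' t‖ ≤ (1 + n * Cρ + 2 * (n * Ck)) * ‖u t‖ := by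
    intro t ht
    have hx : ∀ i, |(u t).1 i| ≤ ‖u t‖ := fun i =>
      (norm_le_pi_norm (u t).1 i).trans (norm_fst_le _)
    have ha : ∀ i j, |(u t).2 i j| ≤ ‖u t‖ := fun i j =>
      ((norm_le_pi_norm ((u t).2 i) j).trans (norm_le_pi_norm (u t).2 i)).trans (norm_snd_le _)
    have hU := norm_nonneg (u t)
    have hn0 : 0 ≤ n := Nat.cast_nonneg _
    have hCk0 : 0 ≤ Ck := (norm_nonneg _).trans (hCk t ht)
    have hCρ0 : 0 ≤ Cρ := (norm_nonneg _).trans (hCρ t ht)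
    have hq1 : 0 ≤ n * Cρ * ‖u t‖ := by positivity
    have hq2 : 0 ≤ n * Ck * ‖u t‖ := by positivity
    have hR : 0 ≤ (1 + n * Cρ + 2 * (n * Ck)) * ‖u t‖ := by positivity
    refine max_le ((pi_norm_le_iff_of_nonneg hR).2 fun i => ?_)
      ((pi_norm_le_iff_of_nonneg hR).2 fun i => (pi_norm_le_iff_of_nonneg hR).2 fun j => ?_)
    · refine (abs_add_le _ _).trans ?_
      have h1 := hsum ((p t).2 i) (u t).1 Ck ‖u t‖ (hkb t ht i) hx
      have h2 := ha o i
      linarith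
    · refine (abs_add_le _ _).trans ((add_le_add (abs_add_le _ _) le_rfl).trans ?_)
      have h1 := hsum (fun l => ρ t l i j) (u t).1 Cρ ‖u t‖ (fun l => hρb t ht l i j) hx
      have h2 := hsum ((p t).2 i) (fun l => (u t).2 l j) Ck ‖u t‖ (hkb t ht i) fun l => ha l j
      have h3 := hsum ((p t).2 j) ((u t).2 i) Ck ‖u t‖ (hkb t ht j) (ha i)
      simp only [mul_comm (ρ t _ i j)] at h1
      linarith
  have hu0 : u 0 = 0 := by
    refine Prod.ext (funext fun i => ?_) (funext fun i => funext fun j => ?_)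
    · simp [u, hX]
    · simp [u, hA]
  intro t ht
  have hzero := eq_zero_of_norm_deriv_le_right hu hbound hu0 t ht
  refine ⟨?_, ?_⟩
  · rw [← sub_eq_zero, ← (he t ht).sum_inner_smul hcard (X t - X' t)]
    refine Finset.sum_eq_zero fun i _ => ?_
    have := congrFun (congrArg Prod.fst hzero) i
    rw [real_inner_comm]
    simp only [u] at this
    rw [this]
    simp
  · have h1 : ∀ i, (A t - A' t) ((Y t).2 i) = 0 := fun i => by
      rw [← (he t ht).sum_inner_smul hcard ((A t - A' t) ((Y t).2 i))]
      refine Finset.sum_eq_zero fun j _ => ?_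
      have := congrFun (congrFun (congrArg Prod.snd hzero) i) j
      rw [real_inner_comm]
      simp only [u] at this
      rw [this]
      simp
    rw [← sub_eq_zero]
    ext v
    rw [← (he t ht).sum_inner_smul hcard v]
    rw [map_sum, map_sum]
    exact Finset.sum_congr rfl fun i _ => by rw [map_smul, map_smul, h1, zero_apply]

end JacobiUniqueness

/-! ### Regularity, orthonormality and families of solutions of the frame equations. -/

section FrameSolutions

open Set Metric
open scoped InnerProductSpace NNReal

lemma contDiffWithinAt_succ_of_hasDerivWithinAt {F : Type*} [NormedAddCommGroup F]
    [NormedSpace ℝ F] {g g' : ℝ → F} {J : Set ℝ} {t : ℝ} (ht : t ∈ J) {n : ℕ}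
    (h : ∀ᶠ r in 𝓝[J] t, HasDerivWithinAt g (g' r) J r) (h' : ContDiffWithinAt ℝ n g' J t) :
    ContDiffWithinAt ℝ (n + 1) g J t := by
  rw [contDiffWithinAt_succ_iff_hasFDerivWithinAt' (by simp)]
  have hJ : insert t J = J := insert_eq_of_mem ht
  refine ⟨{r | HasDerivWithinAt g (g' r) J r} ∩ J, by
    rw [hJ]; exact Filter.inter_mem h self_mem_nhdsWithin, by rw [hJ]; exact inter_subset_right,
    by simp, fun r => ContinuousLinearMap.toSpanSingleton ℝ (g' r),
    fun r hr => hr.1.hasFDerivWithinAt, ?_⟩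
  exact (ContinuousLinearMap.toSpanSingletonCLE (𝕜 := ℝ) (E := F)).contDiff.contDiffAt
    |>.comp_contDiffWithinAt t h'

variable {E : Type*} [NormedAddCommGroup E] [NormedSpace ℝ E] [FiniteDimensional ℝ E]
  {M : Type*} [TopologicalSpace M] [ChartedSpace E M] [IsManifold 𝓘(ℝ, E) ∞ M]
  {ι : Type*} [Fintype ι]
  [RiemannianBundle (fun x : M => TangentSpace 𝓘(ℝ, E) x)]
  [IsContMDiffRiemannianBundle 𝓘(ℝ, E) ∞ E (fun x : M => TangentSpace 𝓘(ℝ, E) x)]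

variable {p : ℝ → (ι → ℝ) × (ι → ι → ℝ)} {Y : ℝ → FrameSpace E M ι} {J : Set ℝ}

/-- Solutions of the frame equations with continuous coefficients are continuously
differentiable. -/
lemma contDiffWithinAt_frameCoord (hp : Continuous p)
    (hY : ∀ t ∈ J, FrameEquationAt (p t) Y J t) {t : ℝ} (ht : t ∈ J) :
    ContDiffWithinAt ℝ 1 (fun r => frameCoord (Y t).1 (Y r)) J t := by
  have hxt := mem_chart_source E (Y t).1
  set x := (Y t).1 with hx
  set u : Set ℝ := J ∩ {r | (Y r).1 ∈ (chartAt E x).source} with hu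
  have hev : u ∈ 𝓝[J] t := Filter.inter_mem self_mem_nhdsWithin
    ((hY t ht).1.preimage_mem_nhdsWithin ((chartAt E x).open_source.mem_nhds hxt))
  have hd : ∀ r ∈ u, HasDerivWithinAt (fun r => frameCoord x (Y r))
      (frameField x (p r, frameCoord x (Y r))) J r := fun r hr =>
    ((frameEquationAt_iff_chart hr.2).1 (hY r hr.1)).2
  refine contDiffWithinAt_succ_of_hasDerivWithinAt (n := 0) ht
    (g' := fun r => frameField x (p r, frameCoord x (Y r))) (by filter_upwards [hev] using hd) ?_
  rw [Nat.cast_zero, contDiffWithinAt_zero ht]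
  refine ⟨u, hev, fun r hr => ?_⟩
  refine ContinuousAt.comp_continuousWithinAt (f := fun r => (p r, frameCoord x (Y r)))
    (contDiffAt_frameField (extChartAt_mem_target hr.2.2)).continuousAt ?_
  exact (hp.continuousWithinAt).prodMk
    ((hd r hr.2).continuousWithinAt.mono inter_subset_left)

lemma contMDiffWithinAt_point (hp : Continuous p)
    (hY : ∀ t ∈ J, FrameEquationAt (p t) Y J t) {t : ℝ} (ht : t ∈ J) :
    ContMDiffWithinAt 𝓘(ℝ, ℝ) 𝓘(ℝ, E) 1 (fun r => (Y r).1) J t :=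
  contMDiffWithinAt_curve_iff.2 ⟨(hY t ht).1, (contDiffWithinAt_frameCoord hp hY ht).fst⟩

lemma contMDiffWithinAt_vector (hp : Continuous p)
    (hY : ∀ t ∈ J, FrameEquationAt (p t) Y J t) {t : ℝ} (ht : t ∈ J) (i : ι) :
    ContMDiffWithinAt 𝓘(ℝ, ℝ) (𝓘(ℝ, E).prod 𝓘(ℝ, E)) 1
      (fun r => (⟨(Y r).1, (Y r).2 i⟩ : TangentBundle 𝓘(ℝ, E) M)) J t :=
  contMDiffWithinAt_field_iff.2 ⟨contMDiffWithinAt_point hp hY ht,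
    contDiffWithinAt_pi.1 (contDiffWithinAt_frameCoord hp hY ht).snd i⟩

/-- Solutions of the frame equations with skew coefficients which are orthonormal at one time are
orthonormal at all times. -/
lemma orthonormal_of_frameEquationAt (hp : Continuous p) {a b : ℝ} (hab : a < b)
    (hskew : ∀ t i j, (p t).2 i j = -(p t).2 j i)
    (hY : ∀ t ∈ Icc a b, FrameEquationAt (p t) Y (Icc a b) t) {s : ℝ} (hs : s ∈ Icc a b)
    (hon : Orthonormal ℝ (Y s).2) : ∀ t ∈ Icc a b, Orthonormal ℝ (Y t).2 := by
  classical
  obtain ⟨C, hC⟩ : ∃ C, ∀ t ∈ Icc a b, ‖(p t).2‖ ≤ C :=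
    isCompact_Icc.exists_bound_of_continuousOn (f := fun t => (p t).2)
      (continuous_snd.comp hp).continuousOn
  have hkb : ∀ t ∈ Icc a b, ∀ i j, |(p t).2 i j| ≤ C := fun t ht i j =>
    ((norm_le_pi_norm ((p t).2 i) j).trans (norm_le_pi_norm (p t).2 i)).trans (hC t ht)
  -- The deviation of the Gram matrix from the identity. The identity itself contributes `kᵢⱼ + kⱼᵢ
  -- = 0` to its derivative, so the deviation solves a homogeneous linear equation and vanishes
  -- identically.
  let G : ℝ → ι → ι → ℝ := fun t i j => ⟪(Y t).2 i, (Y t).2 j⟫_ℝ - if i = j then 1 else 0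
  let G' : ℝ → ι → ι → ℝ := fun t i j =>
    ∑ l, (p t).2 i l * G t l j + ∑ l, (p t).2 j l * G t i l
  have hG : ∀ t ∈ Icc a b, HasDerivWithinAt G (G' t) (Icc a b) t := by
    intro t ht
    have hu := uniqueDiffOn_Icc hab t ht
    have hde := ((hasFrameDerivWithinAt_iff hu).1 (hY t ht)).2.2
    refine hasDerivWithinAt_pi.2 fun i => hasDerivWithinAt_pi.2 fun j => ?_
    refine (((hde i).inner (hde j)).sub_const (if i = j then (1 : ℝ) else 0)).congr_deriv ?_
    simp only [G', G, sum_inner, inner_sum, real_inner_smul_left, real_inner_smul_right, mul_sub,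
      mul_ite, mul_one, mul_zero, Finset.sum_sub_distrib, Finset.sum_ite_eq,
      Finset.sum_ite_eq', Finset.mem_univ, if_true]
    rw [hskew t i j]
    ring
  set n : ℝ := (Fintype.card ι : ℝ) with hn
  have hsum : ∀ (f g : ι → ℝ) (C U : ℝ), (∀ i, |f i| ≤ C) → (∀ i, |g i| ≤ U) →
      |∑ i, f i * g i| ≤ n * C * U := by
    intro f g C U hf hg
    refine (Finset.abs_sum_le_sum_abs _ _).trans ?_
    have : ∀ i ∈ Finset.univ, |f i * g i| ≤ C * U := fun i _ => by
      rw [abs_mul]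
      exact mul_le_mul (hf i) (hg i) (abs_nonneg _) ((abs_nonneg _).trans (hf i))
    refine (Finset.sum_le_card_nsmul _ _ _ this).trans ?_
    rw [nsmul_eq_mul, Finset.card_univ, mul_assoc]
  have hbound : ∀ t ∈ Icc a b, ‖G' t‖ ≤ 2 * (n * C) * ‖G t‖ := by
    intro t ht
    have hG : ∀ i j, |G t i j| ≤ ‖G t‖ := fun i j =>
      (norm_le_pi_norm (G t i) j).trans (norm_le_pi_norm (G t) i)
    have hC0 : 0 ≤ C := (norm_nonneg _).trans (hC t ht)
    have hn0 : 0 ≤ n := Nat.cast_nonneg _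
    have hR : 0 ≤ 2 * (n * C) * ‖G t‖ := by positivity
    refine (pi_norm_le_iff_of_nonneg hR).2 fun i => (pi_norm_le_iff_of_nonneg hR).2 fun j => ?_
    refine (abs_add_le _ _).trans ?_
    have h1 := hsum ((p t).2 i) (fun l => G t l j) C ‖G t‖ (hkb t ht i) fun l => hG l j
    have h2 := hsum ((p t).2 j) (G t i) C ‖G t‖ (hkb t ht j) (hG i)
    linarith
  have h0 : G s = 0 := by
    ext i j
    simp only [G, orthonormal_iff_ite.1 hon i j, sub_self, Pi.zero_apply]
  intro t ht
  have hzero := eq_zero_of_norm_deriv_le hs hG hbound h0 t ht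
  refine orthonormal_iff_ite.2 fun i j => ?_
  exact sub_eq_zero.1 (congrFun (congrFun hzero i) j)

/-- Solutions of the frame equations exist for all initial values near that of a given solution, if
these depend differentiably on a parameter. -/
theorem exists_frame_family [T2Space M] {L : ℝ} (hL : 0 < L) (hp : Continuous p)
    (hY : ∀ t ∈ Icc 0 L, FrameEquationAt (p t) Y (Icc 0 L) t) {I : ℝ → FrameSpace E M ι}
    (hI : I 0 = Y 0) {v : TangentSpace 𝓘(ℝ, E) (I 0).1} {W : ι → TangentSpace 𝓘(ℝ, E) (I 0).1}
    (hd : HasFrameDerivWithinAt I univ 0 v W) :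
    ∃ Z : ℝ → ℝ → FrameSpace E M ι, Z 0 = Y ∧ ∀ᶠ τ in 𝓝 (0 : ℝ), Z τ 0 = I τ ∧
      ∀ t ∈ Icc 0 L, FrameEquationAt (p t) (Z τ) (Icc 0 L) t := by
  classical
  -- Differentiability in `τ` at the end time is carried along in the induction: it provides the
  -- initial data for the next window and ensures that they are near those of `Y` for small `τ`.
  let P (t : ℝ) : Prop := ∃ Z : ℝ → ℝ → FrameSpace E M ι, Z 0 = Y ∧
    (∀ᶠ τ in 𝓝 (0 : ℝ), Z τ 0 = I τ ∧ ∀ r ∈ Icc 0 t, FrameEquationAt (p r) (Z τ) (Icc 0 t) r) ∧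
    ∃ (v : TangentSpace 𝓘(ℝ, E) (Z 0 t).1) (W : ι → TangentSpace 𝓘(ℝ, E) (Z 0 t).1),
      HasFrameDerivWithinAt (fun τ => Z τ t) univ 0 v W
  suffices h : P L by
    obtain ⟨Z, h1, h2, -⟩ := h
    exact ⟨Z, h1, h2⟩
  refine forall_mem_Icc_of_local_propagation (P := P) ?_ (fun t₀ ht₀ => ?_) L ⟨hL.le, le_rfl⟩
  -- On `[0, 0]` the equation is vacuous, so constant families with the right initial value serve
  -- for `τ ≠ 0`.
  · have hZ : ∀ τ, (if τ = 0 then Y else fun _ => I τ) 0 = I τ := fun τ => by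
      split_ifs with h
      · rw [h, hI]
      · rfl
    have hZ' : (fun τ => (if τ = 0 then Y else fun _ => I τ) 0) = I := funext hZ
    refine ⟨fun τ => if τ = 0 then Y else fun _ => I τ, if_pos rfl,
      Filter.Eventually.of_forall fun τ => ⟨hZ τ, fun r hr => ?_⟩, ?_⟩
    · obtain rfl : r = 0 := le_antisymm hr.2 hr.1
      have hs : Icc (0 : ℝ) 0 = {0} := Icc_self 0
      refine ⟨by rw [hs]; exact continuousWithinAt_singleton,
        hasDerivWithinAt_of_not_uniqueDiffWithinAt ?_ _⟩
      rw [hs, uniqueDiffWithinAt_iff_accPt, accPt_iff_nhds]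
      intro h
      obtain ⟨y, hy, hne⟩ := h univ Filter.univ_mem
      exact hne hy.2
    · have hd' : ∃ v W, HasFrameDerivWithinAt I univ 0 v W := ⟨v, W, hd⟩
      rw [← hZ'] at hd'
      exact hd'
  obtain ⟨δ, a, K, hwin, hnear⟩ := exists_frameWindow_of_solution hp (hY t₀ ht₀)
  refine ⟨δ, hwin.pos, fun s hs hδs hPs t ht htδ => ?_⟩
  obtain ⟨Z, hZ0, hZ, v, W, hvW⟩ := hPs
  have hδ := hwin.pos
  set x := (Y t₀).1 with hx
  have hs0 : s ∈ Icc (t₀ - δ) (t₀ + δ) := ⟨hδs, by linarith [hs.2]⟩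
  obtain ⟨hsx, hsw⟩ := hnear s ⟨hs0, hs.1, hs.2.trans ht₀.2⟩
  rw [← congrFun hZ0 s] at hsx hsw
  obtain ⟨hc, hζ⟩ := hvW.hasDerivAt hsx
  let good (τ : ℝ) : Prop := (Z τ s).1 ∈ (chartAt E x).source ∧
    frameCoord x (Z τ s) ∈ ball (frameCoord x (Y t₀)) (a / 2)
  have hgood : ∀ᶠ τ in 𝓝 (0 : ℝ), good τ :=
    Filter.Eventually.and (hc.preimage_mem_nhds ((chartAt E x).open_source.mem_nhds hsx))
      (hζ.continuousAt.preimage_mem_nhds (isOpen_ball.mem_nhds hsw))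
  have hsol : ∀ τ, ∃ V : ℝ → FrameSpace E M ι, good τ → V s = Z τ s ∧
      ∀ r ∈ Icc (t₀ - δ) (t₀ + δ), FrameEquationAt (p r) V (Icc (t₀ - δ) (t₀ + δ)) r := by
    intro τ
    by_cases h : good τ
    · obtain ⟨V, h1, h2⟩ := hwin.exists_solution hs0 (ball_subset_closedBall h.2)
      exact ⟨V, fun _ => ⟨by rw [h1, frameOfCoord_frameCoord h.1], h2⟩⟩
    · exact ⟨Y, fun h' => absurd h' h⟩
  choose V hV using hsol
  -- For `τ = 0` the given solution is retained, so that `Z' 0 = Y` holds as functions on all of `ℝ`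
  -- without appeal to uniqueness.
  let Z' : ℝ → ℝ → FrameSpace E M ι := fun τ =>
    if τ = 0 then Y else fun r => if r ≤ s then Z τ r else V τ r
  have hZ'0 : Z' 0 = Y := if_pos rfl
  have hZ'le : ∀ τ, ∀ r ≤ s, Z' τ r = Z τ r := fun τ r hr => by
    by_cases h : τ = 0
    · subst h
      rw [hZ'0, hZ0]
    · simp only [Z', if_neg h, if_pos hr]
  have hsub : Icc s t ⊆ Icc (t₀ - δ) (t₀ + δ) := Icc_subset_Icc hδs htδ
  have hZ'sol : ∀ᶠ τ in 𝓝 (0 : ℝ), Z' τ 0 = I τ ∧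
      ∀ r ∈ Icc 0 t, FrameEquationAt (p r) (Z' τ) (Icc 0 t) r := by
    filter_upwards [hZ, hgood] with τ h1 h2
    refine ⟨(hZ'le τ 0 hs.1).trans h1.1, ?_⟩
    by_cases h : τ = 0
    · simp only [Z', if_pos h]
      exact fun r hr => (hY r ⟨hr.1, hr.2.trans ht.2⟩).mono (Icc_subset_Icc_right ht.2)
    · simp only [Z', if_neg h]
      exact FrameEquationAt.concat ⟨hs.1, ht.1⟩ h1.2
        (fun r hr => ((hV τ h2).2 r (hsub hr)).mono hsub) (hV τ h2).1.symm
  have hZs : (fun τ => Z' τ s) = fun τ => Z τ s := funext fun τ => hZ'le τ s le_rfl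
  obtain ⟨z, -, -, hz⟩ := hwin.hasDerivAt_parameter (Y := Z') ht.1 hsub
    (hZ'sol.mono fun τ h r hr => (h.2 r ⟨hs.1.trans hr.1, hr.2⟩).mono
      (Icc_subset_Icc_left hs.1))
    (by rw [hZ'le 0 s le_rfl]; exact hsx) (by rw [hZ'le 0 s le_rfl]; exact hsw)
    (ζ := frameCoordDeriv x (Z 0 s) v W)
    (by simp only [hZ'le _ s le_rfl]; exact hc) (by simp only [hZ'le _ s le_rfl]; exact hζ)
  obtain ⟨h1, h2, h3⟩ := hz t ⟨ht.1, le_rfl⟩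
  exact ⟨Z', hZ'0, hZ'sol, _, _,
    hasFrameDerivWithinAt_of_hasDerivAt (Y := fun τ => Z' τ t) h1 h2 h3⟩

section Bishop

variable {m : ℕ} {L : ℝ} {κ : ℝ → Fin m → ℝ} {Y : ℝ → FrameSpace E M (Fin (m + 1))}

lemma velocity_of_frameEquationAt_bishopCoeff (hL : 0 < L)
    (hY : ∀ t ∈ Icc 0 L, FrameEquationAt (bishopCoeff (κ t)) Y (Icc 0 L) t) {t : ℝ}
    (ht : t ∈ Icc 0 L) : velocity (fun r => (Y r).1) (Icc 0 L) t = (Y t).2 0 := by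
  have h := ((hasFrameDerivWithinAt_iff (uniqueDiffOn_Icc hL t ht)).1 (hY t ht)).2.1
  rwa [sum_bishopCoeff_fst] at h

/-- Orthonormal solutions of the frame equations of Bishop frames have the prescribed geodesic
curvatures. -/
lemma hasGeodesicCurvatures_of_frameEquationAt (hL : 0 < L)
    (hY : ∀ t ∈ Icc 0 L, FrameEquationAt (bishopCoeff (κ t)) Y (Icc 0 L) t) :
    HasGeodesicCurvatures L (fun r => (Y r).1) (fun i r => (Y r).2 i.succ) (fun i t => κ t i) := by
  intro t ht
  have h := ((hasFrameDerivWithinAt_iff (uniqueDiffOn_Icc hL t ht)).1 (hY t ht)).2.2 0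
  rw [sum_bishopCoeff_zero] at h
  exact h.congr ht fun r hr => velocity_of_frameEquationAt_bishopCoeff hL hY hr

/-- Orthonormal solutions of the frame equations of Bishop frames are Bishop frames. -/
lemma isBishopFrame_of_frameEquationAt (hm : Module.finrank ℝ E = m + 1) (hL : 0 < L)
    (hκ : Continuous fun t => bishopCoeff (κ t))
    (hY : ∀ t ∈ Icc 0 L, FrameEquationAt (bishopCoeff (κ t)) Y (Icc 0 L) t)
    (hon : ∀ t ∈ Icc 0 L, Orthonormal ℝ (Y t).2) :
    IsBishopFrame L (fun r => (Y r).1) (fun i r => (Y r).2 i.succ) where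
  isArcLengthCurve :=
    { contMDiffOn := by
        intro t ht
        have hxt := mem_chart_source E (Y t).1
        refine contMDiffWithinAt_curve_iff.2 ⟨(hY t ht).1, ?_⟩
        have h1 := contDiffWithinAt_pi.1 (contDiffWithinAt_frameCoord hκ hY ht).snd 0
        -- The velocity is the first frame vector, which is already `C¹`; hence the curve is `C²`.
        refine contDiffWithinAt_succ_of_hasDerivWithinAt (n := 1) ht ?_ h1
        filter_upwards [self_mem_nhdsWithin, (hY t ht).1.preimage_mem_nhdsWithin
          ((chartAt E (Y t).1).open_source.mem_nhds hxt)] with r hr hxr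
        have h2 := hasDerivWithinAt_fst ((frameEquationAt_iff_chart hxr).1 (hY r hr)).2
        refine h2.congr_deriv ?_
        exact sum_bishopCoeff_fst _ _
      norm_velocity := fun t ht => by
        rw [velocity_of_frameEquationAt_bishopCoeff hL hY ht]
        exact (hon t ht).1 0 }
  contMDiffOn := fun i t ht => contMDiffWithinAt_vector hκ hY ht i.succ
  orthonormal := fun t ht => by
    rw [velocity_of_frameEquationAt_bishopCoeff hL hY ht]
    convert hon t ht using 1
    refine funext fun i => ?_
    refine Fin.cases ?_ (fun i => ?_) i <;> rfl
  spanning := hm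
  normalParallel := fun i t ht => by
    have h := ((hasFrameDerivWithinAt_iff (uniqueDiffOn_Icc hL t ht)).1 (hY t ht)).2.2 i.succ
    rw [sum_bishopCoeff_succ] at h
    refine ⟨-κ t i, ?_⟩
    rw [velocity_of_frameEquationAt_bishopCoeff hL hY ht]
    exact h

end Bishop

end FrameSolutions

/-! ### Existence of Bishop frames along arc-length curves. -/

section BishopFrameExistence

open Set Metric
open scoped InnerProductSpace NNReal

variable {E : Type*} [NormedAddCommGroup E] [NormedSpace ℝ E] [FiniteDimensional ℝ E]
  {M : Type*} [TopologicalSpace M] [ChartedSpace E M] [IsManifold 𝓘(ℝ, E) ∞ M]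
  {ι : Type*} [Fintype ι]
  [RiemannianBundle (fun x : M => TangentSpace 𝓘(ℝ, E) x)]
  [IsContMDiffRiemannianBundle 𝓘(ℝ, E) ∞ E (fun x : M => TangentSpace 𝓘(ℝ, E) x)]
  {L : ℝ} {γ : ℝ → M}

/-- The acceleration of a `C²` curve exists and is continuous. -/
lemma exists_acceleration (hL : 0 < L)
    (hγ : ContMDiffOn 𝓘(ℝ, ℝ) 𝓘(ℝ, E) 2 γ (Icc 0 L)) :
    ∃ a : ∀ t, TangentSpace 𝓘(ℝ, E) (γ t), ∀ t ∈ Icc 0 L,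
      HasCovDerivWithinAt γ (fun r => velocity γ (Icc 0 L) r) (Icc 0 L) t (a t) ∧
      ∀ x : M, γ t ∈ (chartAt E x).source →
        ContinuousWithinAt (fun r => chartCoord (E := E) x (γ r) (velocity (E := E) γ (Icc 0 L) r))
          (Icc 0 L) t ∧
        ContinuousWithinAt (fun r => chartCoord (E := E) x (γ r) (a r)) (Icc 0 L) t := by
  have huo := uniqueDiffOn_Icc hL
  have hd : ∀ t ∈ Icc 0 L, MDifferentiableWithinAt 𝓘(ℝ, ℝ) 𝓘(ℝ, E) γ (Icc 0 L) t := fun t ht =>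
    (hγ t ht).mdifferentiableWithinAt (by norm_num)
  have hsrc : ∀ t ∈ Icc 0 L, ∀ x : M, γ t ∈ (chartAt E x).source →
      ∀ᶠ r in 𝓝[Icc 0 L] t, r ∈ Icc 0 L ∧ γ r ∈ (chartAt E x).source := fun t ht x hx =>
    Filter.Eventually.and self_mem_nhdsWithin ((hγ t ht).continuousWithinAt.preimage_mem_nhdsWithin
      ((chartAt E x).open_source.mem_nhds hx))
  have hvel : ∀ r ∈ Icc 0 L, ∀ x : M, γ r ∈ (chartAt E x).source →
      chartCoord (E := E) x (γ r) (velocity (E := E) γ (Icc 0 L) r) =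
        derivWithin (fun r => extChartAt 𝓘(ℝ, E) x (γ r)) (Icc 0 L) r := fun r hr x hx =>
    ((hasDerivWithinAt_extChartAt_comp hx (hd r hr)).derivWithin (huo r hr)).symm
  have hC : ∀ t ∈ Icc 0 L, ∀ x : M, γ t ∈ (chartAt E x).source →
      ContDiffWithinAt ℝ 1 (fun r => chartCoord (E := E) x (γ r) (velocity (E := E) γ (Icc 0 L) r))
        (Icc 0 L) t := by
    intro t ht x hx
    have h1 : ContDiffWithinAt ℝ 2 (fun r => extChartAt 𝓘(ℝ, E) x (γ r)) (Icc 0 L) t :=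
      contMDiffWithinAt_iff_contDiffWithinAt.1
        ((contMDiffWithinAt_iff_target_of_mem_source (by exact hx)).1
          ((hγ t ht).of_le le_rfl)).2
    have h2 : ContDiffWithinAt ℝ 1
        (derivWithin (fun r => extChartAt 𝓘(ℝ, E) x (γ r)) (Icc 0 L)) (Icc 0 L) t :=
      h1.fderivWithin_right_apply (k := fun _ => (1 : ℝ)) (m := 1) contDiffWithinAt_const
        huo (by norm_num) ht
    refine h2.congr_of_eventuallyEq ?_ (hvel t ht x hx)
    filter_upwards [hsrc t ht x hx] with r hr using hvel r hr.1 x hr.2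
  let a : ∀ t, TangentSpace 𝓘(ℝ, E) (γ t) := fun t =>
    chartVector (γ t) (γ t) (derivWithin (fun r => chartCoord (γ t) (γ r)
      (velocity γ (Icc 0 L) r)) (Icc 0 L) t) +
      leviCivita E M (constField (velocity γ (Icc 0 L) t)) (γ t) (velocity γ (Icc 0 L) t)
  have ha : ∀ t ∈ Icc 0 L,
      HasCovDerivWithinAt γ (fun r => velocity γ (Icc 0 L) r) (Icc 0 L) t (a t) := fun t ht =>
    ⟨hd t ht, _, ((hC t ht _ (mem_chart_source E (γ t))).differentiableWithinAt
      (by norm_num)).hasDerivWithinAt, rfl⟩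
  refine ⟨a, fun t ht => ⟨ha t ht, fun x hx => ⟨(hC t ht x hx).continuousWithinAt, ?_⟩⟩⟩
  have heq : ∀ r ∈ Icc 0 L, γ r ∈ (chartAt E x).source → chartCoord (E := E) x (γ r) (a r) =
      derivWithin (fun r => chartCoord (E := E) x (γ r) (velocity (E := E) γ (Icc 0 L) r))
        (Icc 0 L) r +
        chartChristoffel x (extChartAt 𝓘(ℝ, E) x (γ r))
          (chartCoord (E := E) x (γ r) (velocity (E := E) γ (Icc 0 L) r))
          (chartCoord (E := E) x (γ r) (velocity (E := E) γ (Icc 0 L) r)) := fun r hr hxr => by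
    rw [((ha r hr).hasDerivWithinAt_chartCoord hxr).derivWithin (huo r hr)]
    abel
  have hΓ : ContinuousWithinAt (fun r => chartChristoffel x (extChartAt 𝓘(ℝ, E) x (γ r)))
      (Icc 0 L) t :=
    ContinuousAt.comp_continuousWithinAt (f := fun r => extChartAt 𝓘(ℝ, E) x (γ r))
      (contDiffAt_chartChristoffel (extChartAt_mem_target hx)).continuousAt
      (hasDerivWithinAt_extChartAt_comp hx (hd t ht)).continuousWithinAt
  have hv := (hC t ht x hx).continuousWithinAt
  have hdv : ContinuousWithinAt (derivWithin (fun r => chartCoord x (γ r)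
      (velocity γ (Icc 0 L) r)) (Icc 0 L)) (Icc 0 L) t :=
    ((hC t ht x hx).fderivWithin_right_apply (k := fun _ => (1 : ℝ)) (m := 0)
      contDiffWithinAt_const huo (by norm_num) ht).continuousWithinAt
  refine (hdv.add ((hΓ.clm_apply hv).clm_apply hv)).congr_of_eventuallyEq ?_ (heq t ht hx)
  filter_upwards [hsrc t ht x hx] with r hr using heq r hr.1 hr.2

lemma HasFrameDerivWithinAt.congr_field {N N' : ∀ r, ι → TangentSpace 𝓘(ℝ, E) (γ r)} {s : Set ℝ}
    {t : ℝ} {v : TangentSpace 𝓘(ℝ, E) (γ t)} {W : ι → TangentSpace 𝓘(ℝ, E) (γ t)}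
    (h : HasFrameDerivWithinAt (fun r => ⟨γ r, N r⟩) s t v W) (ht : t ∈ s)
    (hN : ∀ r ∈ s, N' r = N r) : HasFrameDerivWithinAt (fun r => ⟨γ r, N' r⟩) s t v W := by
  refine ⟨h.1, ?_⟩
  have h1 : frameCoordDeriv (γ t) (⟨γ t, N' t⟩ : FrameSpace E M ι) v W =
      frameCoordDeriv (γ t) (⟨γ t, N t⟩ : FrameSpace E M ι) v W := by rw [hN t ht]
  have h2 : ∀ r ∈ s, frameCoord (γ t) (⟨γ r, N' r⟩ : FrameSpace E M ι) =
      frameCoord (γ t) (⟨γ r, N r⟩ : FrameSpace E M ι) := fun r hr => by rw [hN r hr]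
  have h3 := h.2.congr h2 (h2 t ht)
  rw [← h1] at h3
  exact h3

/-- Fields along a curve with prescribed initial value which are parallel in its normal bundle. -/
lemma exists_normalParallel (hL : 0 < L) {a : ∀ t, TangentSpace 𝓘(ℝ, E) (γ t)}
    (hd : ∀ t ∈ Icc 0 L, MDifferentiableWithinAt 𝓘(ℝ, ℝ) 𝓘(ℝ, E) γ (Icc 0 L) t)
    (hcont : ∀ t ∈ Icc 0 L, ∀ x : M, γ t ∈ (chartAt E x).source →
        ContinuousWithinAt (fun r => chartCoord (E := E) x (γ r) (velocity (E := E) γ (Icc 0 L) r))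
          (Icc 0 L) t ∧
        ContinuousWithinAt (fun r => chartCoord (E := E) x (γ r) (a r)) (Icc 0 L) t)
    (n₀ : TangentSpace 𝓘(ℝ, E) (γ 0)) :
    ∃ N : ∀ t, TangentSpace 𝓘(ℝ, E) (γ t), N 0 = n₀ ∧ ∀ t ∈ Icc 0 L,
      HasCovDerivWithinAt γ N (Icc 0 L) t (-⟪N t, a t⟫_ℝ • velocity γ (Icc 0 L) t) := by
  let Q (N : ∀ t, TangentSpace 𝓘(ℝ, E) (γ t)) (s : Set ℝ) (t : ℝ) : Prop :=
    HasFrameDerivWithinAt (fun r => (⟨γ r, fun _ => N r⟩ : FrameSpace E M Unit)) s t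
      (velocity γ (Icc 0 L) t) (fun _ => -⟪N t, a t⟫_ℝ • velocity γ (Icc 0 L) t)
  have hQcongr : ∀ {N N' : ∀ t, TangentSpace 𝓘(ℝ, E) (γ t)} {s : Set ℝ} {t : ℝ}, Q N s t → t ∈ s →
      (∀ r ∈ s, N' r = N r) → Q N' s t := by
    intro N N' s t h ht hN
    have h1 := HasFrameDerivWithinAt.congr_field (N := fun r _ => N r) (N' := fun r _ => N' r)
      h ht fun r hr => funext fun _ => hN r hr
    simp only [Q]
    rw [hN t ht]
    exact h1
  let P (t : ℝ) : Prop := ∃ N : ∀ t, TangentSpace 𝓘(ℝ, E) (γ t), N 0 = n₀ ∧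
    ∀ r ∈ Icc 0 t, Q N (Icc 0 t) r
  suffices h : P L by
    obtain ⟨N, h1, h2⟩ := h
    exact ⟨N, h1, fun t ht =>
      ((hasFrameDerivWithinAt_iff (uniqueDiffOn_Icc hL t ht)).1 (h2 t ht)).2.2 ()⟩
  refine forall_mem_Icc_of_local_propagation (P := P) ?_ (fun t₀ ht₀ => ?_) L ⟨hL.le, le_rfl⟩
  · refine ⟨fun t => if h : t = 0 then h ▸ n₀ else 0, by simp, fun r hr => ?_⟩
    have hs : Icc (0 : ℝ) 0 = {0} := Icc_self 0
    obtain rfl : r = 0 := le_antisymm hr.2 hr.1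
    refine ⟨by rw [hs]; exact continuousWithinAt_singleton,
      hasDerivWithinAt_of_not_uniqueDiffWithinAt ?_ _⟩
    rw [hs, uniqueDiffWithinAt_iff_accPt, accPt_iff_nhds]
    intro h
    obtain ⟨y, hy, hne⟩ := h univ Filter.univ_mem
    exact hne hy.2
  set x := γ t₀ with hx
  have hev : {r | γ r ∈ (chartAt E x).source} ∈ 𝓝[Icc 0 L] t₀ :=
    (hd t₀ ht₀).continuousWithinAt.preimage_mem_nhdsWithin
      ((chartAt E x).open_source.mem_nhds (mem_chart_source E x))
  obtain ⟨ε, hε, hball⟩ := Metric.mem_nhdsWithin_iff.1 hev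
  set J : Set ℝ := Icc (max 0 (t₀ - ε / 2)) (min L (t₀ + ε / 2)) with hJ
  have hJL : J ⊆ Icc 0 L := Icc_subset_Icc (le_max_left _ _) (min_le_left _ _)
  have hJx : ∀ r ∈ J, γ r ∈ (chartAt E x).source := fun r hr => by
    refine hball ⟨?_, hJL hr⟩
    have h1 := (le_max_right _ _).trans hr.1
    have h2 := hr.2.trans (min_le_right _ _)
    rw [mem_ball, Real.dist_eq, abs_lt]
    constructor <;> linarith
  set φ : ℝ → E := fun r => extChartAt 𝓘(ℝ, E) x (γ r) with hφ
  set v : ℝ → E := fun r => chartCoord (E := E) x (γ r) (velocity (E := E) γ (Icc 0 L) r) with hv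
  set α : ℝ → E := fun r => chartCoord (E := E) x (γ r) (a r) with hα
  -- In coordinates the equation `∇N = -⟪N, a⟫ T` is linear, `z' = B z`: the first term is the
  -- Christoffel correction and the second is `z ↦ ⟪a, z⟫ T`.
  let B : ℝ → E →L[ℝ] E := fun r => -chartChristoffel x (φ r) (v r) -
    ContinuousLinearMap.smulRightL ℝ E E (metricCoord x (φ r) (α r)) (v r)
  have hφd : ∀ r ∈ J, HasDerivWithinAt φ (v r) (Icc 0 L) r := fun r hr =>
    hasDerivWithinAt_extChartAt_comp (hJx r hr) (hd r (hJL hr))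
  have hB : ContinuousOn B J := by
    intro r hr
    obtain ⟨h1, h2⟩ := hcont r (hJL hr) x (hJx r hr)
    have hz := extChartAt_mem_target (hJx r hr)
    have hΓ : ContinuousWithinAt (fun r => chartChristoffel x (φ r)) (Icc 0 L) r :=
      ContinuousAt.comp_continuousWithinAt (f := φ) (contDiffAt_chartChristoffel hz).continuousAt
        (hφd r hr).continuousWithinAt
    have hg : ContinuousWithinAt (fun r => metricCoord x (φ r)) (Icc 0 L) r :=
      ContinuousAt.comp_continuousWithinAt (f := φ) (contDiffAt_metricCoord hz).continuousAt
        (hφd r hr).continuousWithinAt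
    exact ((hΓ.clm_apply h1).neg.sub
      ((continuousWithinAt_const.clm_apply (hg.clm_apply h2)).clm_apply h1)).mono hJL
  obtain ⟨C, hC⟩ := isCompact_Icc.exists_bound_of_continuousOn hB
  set K : ℝ≥0 := C.toNNReal with hK
  have hK0 : (0 : ℝ) ≤ K := K.2
  set δ := min (ε / 2) (1 / (4 * (K + 1))) with hδ
  have hδ0 : 0 < δ := by positivity
  have hδε : δ ≤ ε / 2 := min_le_left _ _
  have hKδ : K * (2 * δ) ≤ 1 / 2 := by
    have h1 : δ ≤ 1 / (4 * (K + 1)) := min_le_right _ _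
    rw [le_div_iff₀ (by positivity)] at h1
    nlinarith
  refine ⟨δ, hδ0, fun s hs hδs ⟨N, hN0, hN⟩ t ht htδ => ?_⟩
  have hsub : Icc s t ⊆ J := Icc_subset_Icc (max_le hs.1 (by linarith))
    (le_min ht.2 (by linarith))
  obtain ⟨z, hz0, hz⟩ := exists_linear_solution (K := K) ht.1 (hB.mono hsub)
    (fun r hr => (hC r (hsub hr)).trans (Real.le_coe_toNNReal C))
    (le_trans (by gcongr; linarith) hKδ) (chartCoord x (γ s) (N s))
  have hsx : γ s ∈ (chartAt E x).source := hJx s (hsub (left_mem_Icc.2 ht.1))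
  let N₁ : ∀ r, TangentSpace 𝓘(ℝ, E) (γ r) := fun r => chartVector x (γ r) (z r)
  let N₂ : ∀ r, TangentSpace 𝓘(ℝ, E) (γ r) := fun r => if r ≤ s then N r else N₁ r
  have hN₁ : ∀ r ∈ Icc s t, Q N₁ (Icc s t) r := by
    intro r hr
    have hxr := hJx r (hsub hr)
    refine (hasFrameDerivWithinAt_iff_chart (x := x) hxr).2
      ⟨((hd r (hJL (hsub hr))).continuousWithinAt).mono (hsub.trans hJL), ?_⟩
    have hc : ∀ r ∈ Icc s t, chartCoord x (γ r) (N₁ r) = z r := fun r hr =>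
      chartCoord_chartVector (hJx r (hsub hr)) _
    have h1 : HasDerivWithinAt (fun r => ((φ r, fun _ => z r) : E × (Unit → E)))
        (v r, fun _ => B r (z r)) (Icc s t) r :=
      ((hφd r (hsub hr)).mono (hsub.trans hJL)).prodMk (hasDerivWithinAt_pi.2 fun _ => hz r hr)
    have h2 : ∀ r ∈ Icc s t, frameCoord x (⟨γ r, fun _ => N₁ r⟩ : FrameSpace E M Unit) =
        (φ r, fun _ => z r) := fun r hr => Prod.ext rfl (funext fun _ => hc r hr)
    refine (h1.congr h2 (h2 r hr)).congr_deriv (Prod.ext rfl (funext fun _ => ?_))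
    simp only [frameCoordDeriv, B, map_smul]
    rw [inner_eq_metricCoord hxr, hc r hr, metricCoord_comm]
    simp only [ContinuousLinearMap.smulRightL_apply_apply, sub_apply, neg_apply,
      ContinuousLinearMap.smulRight_apply, neg_smul]
    abel
  have hs₁ : N₁ s = N s := by
    simp only [N₁]
    rw [hz0, chartVector_chartCoord hsx]
  have hQ₁ : ∀ r ∈ Icc 0 s, Q N₂ (Icc 0 s) r := fun r hr =>
    hQcongr (hN r hr) hr fun r' hr' => if_pos hr'.2
  have hQ₂ : ∀ r ∈ Icc s t, Q N₂ (Icc s t) r := fun r hr =>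
    hQcongr (hN₁ r hr) hr fun r' hr' => by
      rcases eq_or_lt_of_le hr'.1 with rfl | hlt
      · simp only [N₂, if_pos le_rfl, hs₁]
      · exact if_neg (not_le.2 hlt)
  refine ⟨N₂, (if_pos hs.1).trans hN0, fun r hr => ?_⟩
  rcases lt_trichotomy r s with hlt | rfl | hlt
  · refine HasFrameDerivWithinAt.mono_of_mem (hQ₁ r ⟨hr.1, hlt.le⟩) ?_
    filter_upwards [self_mem_nhdsWithin, mem_nhdsWithin_of_mem_nhds (Iio_mem_nhds hlt)]
      with q hq hq'
    exact ⟨hq.1, le_of_lt hq'⟩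
  · have h1 := HasFrameDerivWithinAt.union (hQ₁ r ⟨hs.1, le_rfl⟩) (hQ₂ r ⟨le_rfl, ht.1⟩)
    rwa [Icc_union_Icc_eq_Icc hs.1 ht.1] at h1
  · refine HasFrameDerivWithinAt.mono_of_mem (hQ₂ r ⟨hlt.le, hr.2⟩) ?_
    filter_upwards [self_mem_nhdsWithin, mem_nhdsWithin_of_mem_nhds (Ioi_mem_nhds hlt)]
      with q hq hq'
    exact ⟨le_of_lt hq', hq.2⟩

lemma eq_of_hasDerivWithinAt_zero {f : ℝ → ℝ} (hf : ∀ t ∈ Icc 0 L, HasDerivWithinAt f 0 (Icc 0 L) t)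
    {t : ℝ} (ht : t ∈ Icc 0 L) : f t = f 0 := by
  have h := eq_zero_of_norm_deriv_le_right (z := fun r => f r - f 0) (z' := fun _ => 0) (C := 0)
    (fun r hr => (hf r hr).sub_const (f 0)) (fun r hr => by simp) (sub_self _) t ht
  exact sub_eq_zero.1 h

/-- Every `C²` curve parameterized by arc length has a Bishop frame. -/
theorem IsArcLengthCurve.exists_bishopFrame {m : ℕ} (hm : Module.finrank ℝ E = m + 1) (hL : 0 < L)
    (hγ : IsArcLengthCurve (E := E) L γ) :
    ∃ (N : Fin m → ∀ t, TangentSpace 𝓘(ℝ, E) (γ t)) (κ : ℝ → Fin m → ℝ),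
      (∀ i, Continuous fun t => κ t i) ∧ ∀ t ∈ Icc 0 L,
        FrameEquationAt (bishopCoeff (κ t)) (bishopFrame L γ N) (Icc 0 L) t ∧
        Orthonormal ℝ (bishopFrame L γ N t).2 := by
  have huo := uniqueDiffOn_Icc hL
  have h0L : (0 : ℝ) ∈ Icc 0 L := ⟨le_rfl, hL.le⟩
  obtain ⟨a, ha⟩ := exists_acceleration hL hγ.contMDiffOn
  set T : ∀ t, TangentSpace 𝓘(ℝ, E) (γ t) := fun t => velocity γ (Icc 0 L) t with hT
  have hTT : ∀ t ∈ Icc 0 L, ⟪T t, T t⟫_ℝ = 1 := fun t ht => by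
    rw [real_inner_self_eq_norm_sq, hγ.norm_velocity t ht, one_pow]
  have hcard : Module.finrank ℝ E = Fintype.card (Fin (m + 1)) := by rw [hm, Fintype.card_fin]
  -- The initial normals complete the unit vector `T 0` to an orthonormal basis of the tangent
  -- space.
  obtain ⟨b, hb⟩ := Orthonormal.exists_orthonormalBasis_extension_of_card_eq (𝕜 := ℝ)
    (E := TangentSpace 𝓘(ℝ, E) (γ 0)) hcard (v := fun _ => T 0) (s := {0}) (by
      refine ⟨fun i => hγ.norm_velocity 0 h0L, fun i j hij => ?_⟩
      exact absurd (Subsingleton.elim i j) hij)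
  have hb0 : b 0 = T 0 := hb 0 rfl
  have hex := fun i : Fin m => exists_normalParallel hL (fun t ht => (ha t ht).1.1)
    (fun t ht => (ha t ht).2) (b i.succ)
  choose N hN0 hN using hex
  have haT : ∀ t ∈ Icc 0 L, ⟪a t, T t⟫_ℝ = 0 := by
    intro t ht
    have h1 := (ha t ht).1.inner (ha t ht).1
    have h2 : HasDerivWithinAt (fun r => ⟪T r, T r⟫_ℝ) 0 (Icc 0 L) t :=
      (hasDerivWithinAt_const t (Icc 0 L) (1 : ℝ)).congr hTT (hTT t ht)
    have h3 := (huo t ht).eq_deriv _ h1 h2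
    rw [real_inner_comm (a t)] at h3
    have h4 : ⟪a t, velocity γ (Icc 0 L) t⟫_ℝ = ⟪a t, T t⟫_ℝ := rfl
    linarith
  have hNT : ∀ i, ∀ t ∈ Icc 0 L, ⟪N i t, T t⟫_ℝ = 0 := by
    intro i t ht
    have h1 : ∀ t ∈ Icc 0 L, HasDerivWithinAt (fun r => ⟪N i r, T r⟫_ℝ) 0 (Icc 0 L) t :=
      -- The derivative of `⟪Nᵢ, T⟫` is `-⟪Nᵢ, a⟫ ⟪T, T⟫ + ⟪Nᵢ, a⟫ = 0`; this is why the coefficient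
      -- in the equation for `N` was chosen.
      fun t ht => ((hN i t ht).inner (ha t ht).1).congr_deriv (by
        rw [real_inner_smul_left, hTT t ht]; ring)
    rw [eq_of_hasDerivWithinAt_zero h1 ht, hN0, ← hb0]
    exact b.orthonormal.2 (Fin.succ_ne_zero i)
  have hNN : ∀ i j, ∀ t ∈ Icc 0 L, ⟪N i t, N j t⟫_ℝ = if i = j then 1 else 0 := by
    intro i j t ht
    have h1 : ∀ t ∈ Icc 0 L, HasDerivWithinAt (fun r => ⟪N i r, N j r⟫_ℝ) 0 (Icc 0 L) t :=
      -- The derivatives of the normals are tangential and the normals are orthogonal to `T`, so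
      -- their inner products are constant.
      fun t ht => ((hN i t ht).inner (hN j t ht)).congr_deriv (by
        rw [real_inner_smul_left, real_inner_smul_right, hNT i t ht, real_inner_comm (N j t)]
        have h2 : ⟪N j t, velocity γ (Icc 0 L) t⟫_ℝ = 0 := hNT j t ht
        rw [h2]
        ring)
    rw [eq_of_hasDerivWithinAt_zero h1 ht, hN0, hN0]
    have := orthonormal_iff_ite.1 b.orthonormal i.succ j.succ
    simpa only [Fin.succ_inj] using this
  have hon : ∀ t ∈ Icc 0 L, Orthonormal ℝ (bishopFrame L γ N t).2 := by
    intro t ht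
    rw [orthonormal_iff_ite]
    refine Fin.cases (Fin.cases ?_ fun j => ?_) fun i => Fin.cases ?_ fun j => ?_
    · exact hTT t ht
    · rw [if_neg (Fin.succ_ne_zero j).symm, real_inner_comm]
      exact hNT j t ht
    · rw [if_neg (Fin.succ_ne_zero i)]
      exact hNT i t ht
    · simp only [Fin.succ_inj]
      exact hNN i j t ht
  let κ₀ : Fin m → ℝ → ℝ := fun i t => ⟪N i t, a t⟫_ℝ
  have hκ₀ : ∀ i, ContinuousOn (κ₀ i) (Icc 0 L) := by
    intro i t ht
    have hxt := mem_chart_source E (γ t)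
    have hg : ContinuousWithinAt (fun r => metricCoord (γ t) (extChartAt 𝓘(ℝ, E) (γ t) (γ r)))
        (Icc 0 L) t :=
      ContinuousAt.comp_continuousWithinAt (f := fun r => extChartAt 𝓘(ℝ, E) (γ t) (γ r))
        (contDiffAt_metricCoord (extChartAt_mem_target hxt)).continuousAt
        (hasDerivWithinAt_extChartAt_comp hxt (ha t ht).1.1).continuousWithinAt
    refine ((hg.clm_apply ((hN i t ht).hasDerivWithinAt_chartCoord hxt).continuousWithinAt)
      |>.clm_apply ((ha t ht).2 _ hxt).2).congr_of_eventuallyEq ?_ (inner_eq_metricCoord hxt _ _)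
    filter_upwards [(ha t ht).1.1.continuousWithinAt.preimage_mem_nhdsWithin
      ((chartAt E (γ t)).open_source.mem_nhds hxt)] with r hr
    exact inner_eq_metricCoord hr _ _
  refine ⟨N, fun t i => κ₀ i (projIcc 0 L hL.le t), fun i => (hκ₀ i).comp_continuous
    (continuous_subtype_val.comp continuous_projIcc) fun t => Subtype.coe_prop _,
    fun t ht => ⟨?_, hon t ht⟩⟩
  have hproj : (projIcc 0 L hL.le t : ℝ) = t := by rw [projIcc_of_mem hL.le ht]
  beta_reduce
  rw [hproj]
  refine (hasFrameDerivWithinAt_iff (huo t ht)).2 ⟨(ha t ht).1.1, ?_, Fin.cases ?_ fun i => ?_⟩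
  · rw [sum_bishopCoeff_fst]; rfl
  · rw [sum_bishopCoeff_zero]
    refine (ha t ht).1.congr_deriv ?_
    -- Expand the acceleration in the frame; its tangential component vanishes because `T` has
    -- constant length.
    have h1 := (hon t ht).sum_inner_smul (by exact hcard) (a t)
    rw [Fin.sum_univ_succ] at h1
    have h2 : ⟪(bishopFrame L γ N t).2 0, a t⟫_ℝ = 0 :=
      (real_inner_comm (T t) (a t)).symm.trans (haT t ht)
    rw [h2, zero_smul, zero_add] at h1
    exact h1.symm
  · rw [sum_bishopCoeff_succ]
    exact hN i t ht

end BishopFrameExistence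

/-! ### Construction of rigid variations; proof of part (2). -/

section RigidVariationExistence

open Set Metric
open scoped InnerProductSpace

variable {E : Type*} [NormedAddCommGroup E] [NormedSpace ℝ E] [FiniteDimensional ℝ E]
  {M : Type*} [TopologicalSpace M] [ChartedSpace E M] [IsManifold 𝓘(ℝ, E) ∞ M]
  {ι : Type*} [Fintype ι]
  [RiemannianBundle (fun x : M => TangentSpace 𝓘(ℝ, E) x)]
  [IsContMDiffRiemannianBundle 𝓘(ℝ, E) ∞ E (fun x : M => TangentSpace 𝓘(ℝ, E) x)]

/-- The frame equation with constant coefficients has local solutions. -/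
lemma exists_frameEquationAt_const (q : (ι → ℝ) × (ι → ι → ℝ)) (Y₀ : FrameSpace E M ι) :
    ∃ δ > 0, ∃ I : ℝ → FrameSpace E M ι, I 0 = Y₀ ∧
      ∀ τ ∈ Icc (-δ) δ, FrameEquationAt q I (Icc (-δ) δ) τ := by
  have hx : Y₀.1 ∈ (chartAt E Y₀.1).source := mem_chart_source E Y₀.1
  have hw : (frameCoord Y₀.1 Y₀).1 ∈ (extChartAt 𝓘(ℝ, E) Y₀.1).target := extChartAt_mem_target hx
  obtain ⟨δ, a, K, h⟩ := exists_frameWindow (p := fun _ => q) continuous_const Y₀.1 hw 0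
  obtain ⟨I, hI, hI'⟩ := h.exists_solution (s := 0) (w := frameCoord Y₀.1 Y₀)
    (by simp [h.pos.le]) (mem_closedBall_self (half_pos h.radius_pos).le)
  refine ⟨δ, h.pos, I, hI.trans (frameOfCoord_frameCoord hx), ?_⟩
  simpa using hI'

/-- Solutions of the generalized Jacobi equations along a curve with a Bishop frame are generated by
a rigid variation. -/
theorem exists_rigidVariation [T2Space M] {m : ℕ} (hm : Module.finrank ℝ E = m + 1) {L : ℝ}
    (hL : 0 < L) {κ : ℝ → Fin m → ℝ} (hκ : ∀ i, Continuous fun t => κ t i)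
    {Y : ℝ → FrameSpace E M (Fin (m + 1))}
    (hY : ∀ t ∈ Icc 0 L, FrameEquationAt (bishopCoeff (κ t)) Y (Icc 0 L) t)
    (hon : ∀ t ∈ Icc 0 L, Orthonormal ℝ (Y t).2)
    {X : ∀ t, TangentSpace 𝓘(ℝ, E) (Y t).1}
    {A : ∀ t, TangentSpace 𝓘(ℝ, E) (Y t).1 →L[ℝ] TangentSpace 𝓘(ℝ, E) (Y t).1}
    (hA : IsSkewAlong L (fun t => (Y t).1) A)
    (hXA : GeneralizedJacobi L (fun t => (Y t).1) X A) :
    ∃ (R : RigidVariation E M m L) (h : R.curve 0 = fun t => (Y t).1),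
      R.Generates (h ▸ X) (h ▸ A) := by
  have h0L : (0 : ℝ) ∈ Icc 0 L := ⟨le_rfl, hL.le⟩
  have hcard : Module.finrank ℝ E = Fintype.card (Fin (m + 1)) := by rw [hm, Fintype.card_fin]
  have hp := continuous_bishopCoeff hκ
  -- The components of `X 0` and `A 0` in the initial frame. The frame equation in `τ` with these
  -- constant coefficients moves that frame with initial velocity `X 0` and initial covariant
  -- derivative `A 0`.
  let q : (Fin (m + 1) → ℝ) × (Fin (m + 1) → Fin (m + 1) → ℝ) :=
    (fun j => ⟪(Y 0).2 j, X 0⟫_ℝ, fun i j => ⟪(Y 0).2 j, A 0 ((Y 0).2 i)⟫_ℝ)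
  have hq : ∀ i j, q.2 i j = -q.2 j i := fun i j => by
    have h := hA 0 h0L ((Y 0).2 i) ((Y 0).2 j)
    simp only [q]
    rw [real_inner_comm]
    exact h
  obtain ⟨δ, hδ, I, hI0, hI⟩ := exists_frameEquationAt_const q (Y 0)
  have hId : FrameEquationAt q I univ 0 :=
    HasFrameDerivWithinAt.mono_of_mem (hI 0 ⟨by linarith, hδ.le⟩)
      (by rw [nhdsWithin_univ]; exact Icc_mem_nhds (by linarith) hδ)
  obtain ⟨Z, rfl, hZ⟩ := exists_frame_family hL hp hY hI0 hId
  obtain ⟨ρ, hρ, hball⟩ := Metric.eventually_nhds_iff_ball.1 hZ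
  set η := min δ (ρ / 2) with hη
  have hη0 : 0 < η := by positivity
  have hsub : Icc (-η) η ⊆ Icc (-δ) δ :=
    Icc_subset_Icc (neg_le_neg (min_le_left _ _)) (min_le_left _ _)
  have hZη : ∀ τ ∈ Icc (-η) η, Z τ 0 = I τ ∧
      ∀ t ∈ Icc 0 L, FrameEquationAt (bishopCoeff (κ t)) (Z τ) (Icc 0 L) t := fun τ hτ => by
    refine hball τ ?_
    have h1 : η ≤ ρ / 2 := min_le_right _ _
    rw [mem_ball_zero_iff, Real.norm_eq_abs]
    exact (abs_le.2 hτ).trans_lt (by linarith)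
  have hinit : ∀ τ ∈ Icc (-η) η, FrameEquationAt q (fun τ => Z τ 0) (Icc (-η) η) τ := fun τ hτ =>
    FrameEquationAt.congr ((hI τ (hsub hτ)).mono hsub) hτ fun r hr => (hZη r hr).1
  have h0η : (0 : ℝ) ∈ Icc (-η) η := ⟨by linarith, hη0.le⟩
  -- Orthonormality spreads twice: here in `τ` along the initial points, by skewness of `A 0`, and
  -- then in `t` along each curve, by skewness of the Bishop coefficients.
  have honi := orthonormal_of_frameEquationAt (p := fun _ => q) (Y := fun τ => Z τ 0)
    continuous_const (by linarith : -η < η) (fun _ => hq) hinit h0η (hon 0 h0L)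
  have honZ : ∀ τ ∈ Icc (-η) η, ∀ t ∈ Icc 0 L, Orthonormal ℝ (Z τ t).2 := fun τ hτ =>
    orthonormal_of_frameEquationAt hp hL (fun t => bishopCoeff_skew (κ t)) (hZη τ hτ).2 h0L
      (honi τ hτ)
  have hvel : ∀ τ ∈ Icc (-η) η, velocity (fun t => (Z τ t).1) (Icc 0 L) 0 = (Z τ 0).2 0 :=
    fun τ hτ => velocity_of_frameEquationAt_bishopCoeff hL (hZη τ hτ).2 h0L
  have hvec : ∀ i, ContMDiffOn 𝓘(ℝ, ℝ) (𝓘(ℝ, E).prod 𝓘(ℝ, E)) 1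
      (fun τ => (⟨(Z τ 0).1, (Z τ 0).2 i⟩ : TangentBundle 𝓘(ℝ, E) M)) (Icc (-η) η) := fun i τ hτ =>
    contMDiffWithinAt_vector (p := fun _ => q) (Y := fun τ => Z τ 0) continuous_const hinit hτ i
  let R : RigidVariation E M m L :=
    { ε := η
      ε_pos := hη0
      curve := fun τ t => (Z τ t).1
      normal := fun τ i t => (Z τ t).2 i.succ
      isBishopFrame := fun τ hτ => isBishopFrame_of_frameEquationAt hm hL hp
        (hZη τ (Ioo_subset_Icc_self hτ)).2 (honZ τ (Ioo_subset_Icc_self hτ))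
      κ := fun i t => κ t i
      hasGeodesicCurvatures := fun τ hτ => hasGeodesicCurvatures_of_frameEquationAt hL
        (hZη τ (Ioo_subset_Icc_self hτ)).2
      contMDiffOn_point := fun τ hτ =>
        (contMDiffWithinAt_point (p := fun _ => q) (Y := fun τ => Z τ 0) continuous_const hinit
          (Ioo_subset_Icc_self hτ)).mono Ioo_subset_Icc_self
      contMDiffOn_tangent := ((hvec 0).mono Ioo_subset_Icc_self).congr fun τ hτ => by
        rw [hvel τ (Ioo_subset_Icc_self hτ)]
      contMDiffOn_normal := fun i => (hvec i.succ).mono Ioo_subset_Icc_self }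
  -- Part (1) applied to the constructed variation; it remains to show that its pair coincides with
  -- the given one.
  obtain ⟨X', A', hG, -, hJ⟩ := R.exists_generates hm hL
  have hd0 : HasFrameDerivWithinAt (fun τ => Z τ 0) univ 0 (X 0) (fun i => A 0 ((Z 0 0).2 i)) := by
    have h1 : FrameEquationAt q (fun τ => Z τ 0) univ 0 :=
      HasFrameDerivWithinAt.mono_of_mem (hinit 0 h0η)
        (by rw [nhdsWithin_univ]; exact Icc_mem_nhds (by linarith) hη0)
    have h2 : ∑ j, q.1 j • (Z 0 0).2 j = X 0 := (hon 0 h0L).sum_inner_smul hcard (X 0)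
    have h3 : ∀ i, ∑ j, q.2 i j • (Z 0 0).2 j = A 0 ((Z 0 0).2 i) := fun i =>
      (hon 0 h0L).sum_inner_smul hcard (A 0 ((Z 0 0).2 i))
    simp only [FrameEquationAt, h2, h3] at h1
    exact h1
  have hd0' : HasFrameDerivWithinAt (fun τ => Z τ 0) univ 0 (X' 0)
      (fun i => A' 0 ((Z 0 0).2 i)) := by
    refine (hasFrameDerivWithinAt_iff uniqueDiffWithinAt_univ).2
      ⟨(hG.mdifferentiableAt 0 h0L).mdifferentiableWithinAt, hG.field 0 h0L,
        Fin.cases ?_ fun i => hG.normal i 0 h0L⟩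
    -- The velocity at `t = 0` equals the first frame vector only for small `τ`, so the covariant
    -- derivative is unfolded and its coordinate derivative transferred by eventual equality.
    obtain ⟨h1, a, h2, h3⟩ := hG.tangent 0 h0L
    refine ⟨h1, a, ?_, ?_⟩
    · rw [hasDerivWithinAt_univ] at h2 ⊢
      refine h2.congr_of_eventuallyEq ?_
      filter_upwards [Icc_mem_nhds (by linarith : -η < 0) hη0] with τ hτ
      exact congrArg _ (hvel τ hτ).symm
    · have h4 : A' 0 (velocity (fun t => (Z 0 t).1) (Icc 0 L) 0) =
          chartVector (Z 0 0).1 (Z 0 0).1 a +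
            leviCivita E M (constField (velocity (fun t => (Z 0 t).1) (Icc 0 L) 0)) (Z 0 0).1
              (velocity (fun r => (Z r 0).1) univ 0) := h3
      rw [hvel 0 h0η] at h4
      exact h4
  obtain ⟨hX0, hW0⟩ := HasFrameDerivWithinAt.unique (Y := fun τ => Z τ 0) uniqueDiffWithinAt_univ
    hd0 hd0'
  have hA0 : A 0 = A' 0 := by
    refine ContinuousLinearMap.ext fun u => ?_
    rw [← (hon 0 h0L).sum_inner_smul hcard u, map_sum, map_sum]
    refine Finset.sum_congr rfl fun i _ => ?_
    rw [map_smul, map_smul]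
    exact congrArg _ (congrFun hW0 i)
  have hu := GeneralizedJacobi.eq_of_eq_zero hL hcard hp hY (o := 0) hon
    (fun t ht => velocity_of_frameEquationAt_bishopCoeff hL hY ht) hXA hJ hX0 hA0
  refine ⟨R, rfl, hG.mdifferentiableAt, fun t ht => ?_, fun t ht => ?_, fun i t ht => ?_⟩
  · exact (hG.field t ht).trans (hu t ht).1.symm
  · have h := hG.tangent t ht
    rw [← (hu t ht).2] at h
    exact h
  · have h := hG.normal i t ht
    rw [← (hu t ht).2] at h
    exact h

end RigidVariationExistence

end

theorem theorem3p2 {E : Type*} [NormedAddCommGroup E] [NormedSpace ℝ E] [FiniteDimensional ℝ E]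
    {M : Type*} [TopologicalSpace M] [T2Space M] [ChartedSpace E M] [IsManifold 𝓘(ℝ, E) ∞ M]
    [RiemannianBundle (fun x : M => TangentSpace 𝓘(ℝ, E) x)]
    [IsContMDiffRiemannianBundle 𝓘(ℝ, E) ∞ E (fun x : M => TangentSpace 𝓘(ℝ, E) x)]
    (m : ℕ) (hm : Module.finrank ℝ E = m + 1) (L : ℝ) (hL : 0 < L)
    (γ : ℝ → M) (hγ : IsArcLengthCurve (E := E) L γ) :
    (∀ (R : RigidVariation E M m L) (h : R.curve 0 = γ),
      ∃ (X : ∀ t, TangentSpace 𝓘(ℝ, E) (γ t))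
        (A : ∀ t, TangentSpace 𝓘(ℝ, E) (γ t) →L[ℝ] TangentSpace 𝓘(ℝ, E) (γ t)),
        R.Generates (h ▸ X) (h ▸ A) ∧ IsSkewAlong L γ A ∧ GeneralizedJacobi L γ X A) ∧
    (∀ (X : ∀ t, TangentSpace 𝓘(ℝ, E) (γ t))
        (A : ∀ t, TangentSpace 𝓘(ℝ, E) (γ t) →L[ℝ] TangentSpace 𝓘(ℝ, E) (γ t)),
      IsSkewAlong L γ A → GeneralizedJacobi L γ X A →
        ∃ (R : RigidVariation E M m L) (h : R.curve 0 = γ),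
          R.Generates (h ▸ X) (h ▸ A)) := by
  refine ⟨?_, fun X A hA hXA => ?_⟩
  -- Substituting `γ` makes the transports along the equality of curves trivial.
  · rintro R rfl
    exact R.exists_generates hm hL
  · obtain ⟨N, κ, hκ, h⟩ := hγ.exists_bishopFrame hm hL
    exact exists_rigidVariation hm hL hκ (fun t ht => (h t ht).1) (fun t ht => (h t ht).2) hA hXA
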